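/- All manifolds are smooth, Hausdorff, finite-dimensional and without boundary; $M$ is connected, and $k\ge 1$. Definitions. A $k$-contact form on $M$ is a smooth $\boldsymbol\eta\in\Omega^1(M,\mathbb R^k)$ such that $\ker\boldsymbol\eta$ is a non-zero distribution of constant corank $k$, $\ker\mathrm d\boldsymbol\eta=\{v:\iota_v\mathrm d\boldsymbol\eta=0\}$ is a distribution of constant rank $k$, and $\ker\boldsymbol\eta\cap\ker\mathrm d\boldsymbol\eta=0$. Its Reeb vector fields $R_1,\dots,R_k$ are determined by $\iota_{R_\alpha}\boldsymbol\eta=e_\alpha$ and $\iota_{R_\alpha}\mathrm d\boldsymbol\eta=0$. A vector field $Y$ is $\boldsymbol\eta$-Hamiltonian if $[Y,Z]$ takes values in $\ker\boldsymbol\eta$ whenever the vector field $Z$ does; its $\boldsymbol\eta$-Hamiltonian $k$-function is $-\iota_Y\boldsymbol\eta$. A $t$-dependent vector field $X=(X_t)_{t\in\mathbb R}$ is a Lie system if all the $X_t$ lie in one finite-dimensional real Lie algebra of vector fields (a Vessiot–Guldberg Lie algebra of $X$); $V^X$ is the smallest Lie algebra of vector fields containing all $X_t$. The triple $(M,\boldsymbol\eta,X)$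 is a projectable $k$-contact Lie system if $\boldsymbol\eta$ is a $k$-contact form, $X$ is a Lie system, every element of $V^X$ is $\boldsymbol\eta$-Hamiltonian, and the $\boldsymbol\eta$-Hamiltonian $k$-functions of the elements of $V^X$ are first integrals of $R_1,\dots,R_k$. A $k$-symplectic form is a closed two-form $\boldsymbol\omega$ with values in $\mathbb R^k$ and $\ker\boldsymbol\omega=0$; a vector field $Y$ is $\boldsymbol\omega$-Hamiltonian if $\iota_Y\boldsymbol\omega=\mathrm d\boldsymbol g$ for some smooth $\mathbb R^k$-valued function $\boldsymbol g$; a $k$-symplectic Lie system is a Lie system admitting a Vessiot–Guldberg Lie algebra of $\boldsymbol\omega$-Hamiltonian vector fields, for a $k$-symplectic form $\boldsymbol\omega$. Proposition. Let $(M,\boldsymbol\eta,X)$ be a projectable $k$-contact Lie system. Let $M/\mathcal D^R$ be the space of leaves of the Reeb distribution $\mathcal D^R=\ker\mathrm d\boldsymbol\eta$ (two points being on the same leaf when they are joined by a piecewise $C^1$ curve tangent to $\mathcal D^R$), with its quotient topology, and assume that it carries a manifold structure for which the canonical projection $\mathfrak p_R:M\to M/\mathcal D^R$ is a smooth submersion.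 Then there is a unique $\mathbb R^k$-valued two-form $\boldsymbol\omega$ on $M/\mathcal D^R$ with $\mathfrak p_R^*\boldsymbol\omega=\mathrm d\boldsymbol\eta$, and it is a $k$-symplectic form. Moreover, there is a unique $t$-dependent vector field $\mathfrak p_{R*}X$ on $M/\mathcal D^R$ with $\mathrm T\mathfrak p_R\circ X_t=(\mathfrak p_{R*}X)_t\circ\mathfrak p_R$ for all $t\in\mathbb R$, the triple $(M/\mathcal D^R,\boldsymbol\omega,\mathfrak p_{R*}X)$ is a $k$-symplectic Lie system, and each vector field $(\mathfrak p_{R*}X)_t$ is $\boldsymbol\omega$-Hamiltonian. If $X$ is smooth as a map $\mathbb R\times M\to\mathrm TM$, then $\mathfrak p_{R*}X$ is smooth as a map $\mathbb R\times M/\mathcal D^R\to\mathrm T(M/\mathcal D^R)$. -/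

import Mathlib

open scoped Manifold ContDiff

noncomputable section

namespace KContact

section Basic

variable (E : Type*) [NormedAddCommGroup E] [NormedSpace ℝ E]
  (M : Type*) [TopologicalSpace M] [ChartedSpace E M]

/-- (Not necessarily smooth) vector fields on `M`. -/
abbrev VField : Type _ := ∀ x : M, TangentSpace 𝓘(ℝ, E) x

/-- (Not necessarily smooth) differential `n`-forms on `M` with values in `ℝ^k`. -/
abbrev DForm (n k : ℕ) : Type _ :=
  ∀ x : M, TangentSpace 𝓘(ℝ, E) x [⋀^Fin n]→L[ℝ] (Fin k → ℝ)

end Basic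

section Forms

variable {E : Type*} [NormedAddCommGroup E] [NormedSpace ℝ E]
  {M : Type*} [TopologicalSpace M] [ChartedSpace E M]
  {E' : Type*} [NormedAddCommGroup E'] [NormedSpace ℝ E']
  {N : Type*} [TopologicalSpace N] [ChartedSpace E' N] {n k : ℕ}

/-- The coordinate expression of `Ω` in the preferred chart at `x₀`, i.e. the pullback of `Ω` by
the inverse of that chart. It is meaningful on the target of the chart. -/
def localRep (Ω : DForm E M n k) (x₀ : M) (y : E) : E [⋀^Fin n]→L[ℝ] (Fin k → ℝ) :=
  (Ω ((extChartAt 𝓘(ℝ, E) x₀).symm y)).compContinuousLinearMap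
    (mfderiv 𝓘(ℝ, E) 𝓘(ℝ, E) (extChartAt 𝓘(ℝ, E) x₀).symm y)

/-- A form is smooth if all its coordinate expressions are smooth. -/
def IsSmoothForm (Ω : DForm E M n k) : Prop :=
  ∀ x₀ : M, ContDiffOn ℝ ∞ (localRep Ω x₀) (extChartAt 𝓘(ℝ, E) x₀).target

/-- The exterior derivative, computed at `x` in the preferred chart at `x`. -/
def dExt (Ω : DForm E M n k) : DForm E M (n + 1) k := fun x =>
  (extDeriv (localRep Ω x) (extChartAt 𝓘(ℝ, E) x x)).compContinuousLinearMap
    (mfderiv 𝓘(ℝ, E) 𝓘(ℝ, E) (extChartAt 𝓘(ℝ, E) x) x)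

/-- The pullback `f^* Ω`. -/
def pullbackForm (f : M → N) (Ω : DForm E' N n k) : DForm E M n k := fun x =>
  (Ω (f x)).compContinuousLinearMap (mfderiv 𝓘(ℝ, E) 𝓘(ℝ, E') f x)

/-- The kernel at `x` of an `ℝ^k`-valued form of positive degree: the tangent vectors `v` with
`ι_v Ω = 0`. -/
def kerForm (Ω : DForm E M (n + 1) k) (x : M) : Submodule ℝ (TangentSpace 𝓘(ℝ, E) x) where
  carrier := {v | ∀ w : Fin n → TangentSpace 𝓘(ℝ, E) x, Ω x (Fin.cons v w) = 0}
  add_mem' := by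
    intro a b ha hb w
    have := (Ω x).toMultilinearMap.cons_add w a b
    simpa [ha w, hb w] using this
  zero_mem' := fun w => (Ω x).map_coord_zero 0 (by simp)
  smul_mem' := by
    intro c a ha w
    have := (Ω x).toMultilinearMap.cons_smul w c a
    simpa [ha w] using this

/-- `k`-contact forms. -/
structure IsKContactForm (η : DForm E M 1 k) : Prop where
  smooth : IsSmoothForm η
  ker_ne_bot : ∀ x, kerForm η x ≠ ⊥
  corank_ker : ∀ x, Module.finrank ℝ (kerForm η x) + k = Module.finrank ℝ E
  rank_ker_d : ∀ x, Module.finrank ℝ (kerForm (dExt η) x) = k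
  inf_eq_bot : ∀ x, kerForm η x ⊓ kerForm (dExt η) x = ⊥

/-- `x` and `y` are joined by a `C^1` curve tangent to the distribution `ker dη`. -/
def TangentlyJoined (η : DForm E M 1 k) (x y : M) : Prop :=
  ∃ γ : ℝ → M, ContMDiff 𝓘(ℝ, ℝ) 𝓘(ℝ, E) 1 γ ∧
    (∀ t : ℝ, mfderiv 𝓘(ℝ, ℝ) 𝓘(ℝ, E) γ t (1 : ℝ) ∈ kerForm (dExt η) (γ t)) ∧
    γ 0 = x ∧ γ 1 = y

/-- Two points are equivalent when they lie on the same leaf of the Reeb distribution `ker dη`,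
i.e. when they are joined by a finite chain of curves tangent to it. -/
def leafSetoid (η : DForm E M 1 k) : Setoid M := Relation.EqvGen.setoid (TangentlyJoined η)

/-- The leaf space `M / ker dη` of the Reeb distribution, with the quotient topology. -/
abbrev LeafSpace (η : DForm E M 1 k) : Type _ := Quotient (leafSetoid η)

/-- The canonical projection `p_R : M → M / ker dη`. -/
def leafProj (η : DForm E M 1 k) : M → LeafSpace η := Quotient.mk (leafSetoid η)

/-- `k`-symplectic forms: closed nondegenerate `ℝ^k`-valued two-forms. -/
structure IsKSymplecticForm (Ω : DForm E M 2 k) : Prop where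
  smooth : IsSmoothForm Ω
  closed : dExt Ω = 0
  nondegenerate : ∀ x, kerForm Ω x = ⊥

/-- The `η`-Hamiltonian `k`-function `-ι_Y η` of `Y`. -/
def hamFun (η : DForm E M 1 k) (Y : VField E M) : M → (Fin k → ℝ) := fun x => -(η x ![Y x])

/-- The `t`-dependent vector field `X'` is the pushforward `f_* X`. -/
def IsPushforward (f : M → N) (X : ℝ → VField E M) (X' : ℝ → VField E' N) : Prop :=
  ∀ t x, mfderiv 𝓘(ℝ, E) 𝓘(ℝ, E') f x (X t x) = X' t (f x)

end Forms

section Systems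

variable {E : Type*} [NormedAddCommGroup E] [NormedSpace ℝ E]
  {M : Type*} [TopologicalSpace M] [ChartedSpace E M] [IsManifold 𝓘(ℝ, E) ∞ M]
  {k : ℕ}

/-- Smoothness of a vector field. -/
def IsSmoothVF (Y : VField E M) : Prop :=
  ContMDiff 𝓘(ℝ, E) 𝓘(ℝ, E).tangent ∞ (fun x => (⟨x, Y x⟩ : TangentBundle 𝓘(ℝ, E) M))

/-- `V` is a (real) Lie algebra of smooth vector fields. -/
structure IsLieAlgebraOfVF (V : Submodule ℝ (VField E M)) : Prop where
  smooth : ∀ Y ∈ V, IsSmoothVF Y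
  lie_mem : ∀ Y ∈ V, ∀ Z ∈ V, VectorField.mlieBracket 𝓘(ℝ, E) Y Z ∈ V

/-- The smallest Lie algebra `V^X` of smooth vector fields containing all the `X_t`. -/
def smallestLieAlgebra (X : ℝ → VField E M) : Submodule ℝ (VField E M) :=
  sInf {V | IsLieAlgebraOfVF V ∧ ∀ t, X t ∈ V}

/-- `V` is a Vessiot--Guldberg Lie algebra of `X`: a finite-dimensional Lie algebra of vector
fields such that, for a basis `X_1, …, X_r` of `V`, one has `X_t = ∑ b_α(t) X_α`. -/
structure IsVessiotGuldberg (X : ℝ → VField E M) (V : Submodule ℝ (VField E M)) : Prop where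
  lieAlgebra : IsLieAlgebraOfVF V
  finiteDimensional : FiniteDimensional ℝ V
  mem : ∀ t, X t ∈ V

/-- A `t`-dependent vector field is a Lie system if it admits a Vessiot--Guldberg Lie algebra. -/
def IsLieSystem (X : ℝ → VField E M) : Prop := ∃ V, IsVessiotGuldberg X V

/-- Joint smoothness of `X` as a map `ℝ × M → TM`. -/
def IsJointlySmooth (X : ℝ → VField E M) : Prop :=
  ContMDiff (𝓘(ℝ, ℝ).prod 𝓘(ℝ, E)) 𝓘(ℝ, E).tangent ∞
    (fun q : ℝ × M => (⟨q.2, X q.1 q.2⟩ : TangentBundle 𝓘(ℝ, E) M))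

/-- `R_1, …, R_k` are the Reeb vector fields of `η`: `ι_{R_α} η = e_α` and `ι_{R_α} dη = 0`. -/
structure IsReebFamily (η : DForm E M 1 k) (R : Fin k → VField E M) : Prop where
  smooth : ∀ α, IsSmoothVF (R α)
  apply : ∀ α x, η x ![R α x] = Pi.single α 1
  mem_ker : ∀ α x, R α x ∈ kerForm (dExt η) x

/-- `η`-Hamiltonian vector fields: Lie symmetries of the distribution `ker η`. -/
structure IsEtaHamiltonian (η : DForm E M 1 k) (Y : VField E M) : Prop where
  smooth : IsSmoothVF Y
  lie_symm : ∀ Z : VField E M, IsSmoothVF Z → (∀ x, Z x ∈ kerForm η x) →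
    ∀ x, VectorField.mlieBracket 𝓘(ℝ, E) Y Z x ∈ kerForm η x

/-- `(M, η, X)` is a `k`-contact Lie system. -/
structure IsKContactLieSystem (η : DForm E M 1 k) (X : ℝ → VField E M) : Prop where
  kcontact : IsKContactForm η
  lieSystem : IsLieSystem X
  hamiltonian : ∀ Y ∈ smallestLieAlgebra X, IsEtaHamiltonian η Y

/-- `(M, η, X)` is a projectable `k`-contact Lie system: the `η`-Hamiltonian `k`-functions of the
elements of `V^X` are first integrals of the Reeb vector fields. -/
structure IsProjectable (η : DForm E M 1 k) (X : ℝ → VField E M) : Prop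
    extends IsKContactLieSystem η X where
  first_integral : ∀ Y ∈ smallestLieAlgebra X, ∀ R : Fin k → VField E M, IsReebFamily η R →
    ∀ α x, mvfderiv 𝓘(ℝ, E) (hamFun η Y) x (R α x) = 0

/-- `Ω`-Hamiltonian vector fields: `ι_Y Ω = dg` for a smooth `k`-function `g`. -/
def IsOmegaHamiltonian (Ω : DForm E M 2 k) (Y : VField E M) : Prop :=
  IsSmoothVF Y ∧ ∃ g : M → (Fin k → ℝ), ContMDiff 𝓘(ℝ, E) 𝓘(ℝ, Fin k → ℝ) ∞ g ∧
    ∀ x v, Ω x ![Y x, v] = mvfderiv 𝓘(ℝ, E) g x v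

/-- `(M, Ω, X)` is a `k`-symplectic Lie system: `Ω` is `k`-symplectic and `X` is a Lie system
admitting a Vessiot--Guldberg Lie algebra of `Ω`-Hamiltonian vector fields. -/
structure IsKSymplecticLieSystem (Ω : DForm E M 2 k) (X : ℝ → VField E M) : Prop where
  ksymplectic : IsKSymplecticForm Ω
  hamiltonian : ∃ V, IsVessiotGuldberg X V ∧ ∀ Y ∈ V, IsOmegaHamiltonian Ω Y

end Systems

end KContact

end

/-! The heart of the matter is that the vertical vectors of the leaf projection are exactly the
vectors of `ker dη` (`IsKContactForm.mfd_leafProj_eq_zero_iff`). Restricted to `ker dη`, the form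
`η` is an isomorphism onto `ℝ^k`, and its inverse `w ↦ ∑ w_α R_α` is smooth. Cartan's formula and
`d² = 0` show that the Reeb fields commute, so Frobenius' theorem yields plaques: local maps from
`ℝ^k` to `M` with differential `w ↦ ∑ w_α R_α`. The projection is constant on plaques, hence `ker
dη` is vertical.

The converse needs a global argument, because the leaf space is only assumed to be a manifold with
submersive projection: its fibres could a priori be of dimension larger than `k`. But a leaf is
covered by countably many plaques, reached from one point by rational moves. Each is a `C^1` image
of a ball of `ℝ^k`, so an open piece of a fibre has Hausdorff dimension at most `k`
(`IsKContactForm.finrank_complement_le`), and a dimension count gives equality.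

Since `dη` is closed and annihilates vertical vectors, it is constant along the fibres in submersion
coordinates, and this propagates along tangent curves. So `dη` descends to a two-form `ω`;
smoothness follows with local sections, closedness with naturality of `d`, and nondegeneracy holds
because only vertical vectors were annihilated.

For the dynamics, let `Y` be Hamiltonian with function `h = -ι_Y η`. Cartan's formula gives `ι_Y dη
= dh` on `ker η`, and on Reeb vectors both sides vanish because `h` is a first integral
(`IsEtaHamiltonian.dExt_apply`). Hence `h` is constant on leaves and descends to a function `g`, and
`ω(Tp Y, ·) = dg` together with nondegeneracy forces `Tp Y` to depend on the leaf only. Projection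
of vector fields is linear and respects brackets, so the image of `V^X` is a Vessiot–Guldberg Lie
algebra of `ω`-Hamiltonian fields. -/

section

open Set Metric Filter Topology
open scoped NNReal

namespace KContact

/-! ### Frobenius' theorem for total differential equations `Dψ = A(ψ)` -/

section Frobenius

variable {E : Type*} [NormedAddCommGroup E] [NormedSpace ℝ E]
  {W : Type*} [NormedAddCommGroup W] [NormedSpace ℝ W]

/-- Picard–Lindelöf, with the information that the solution stays in the ball. -/
theorem exists_solution_mem_closedBall [CompleteSpace E] {f : ℝ → E → E} {tmin tmax : ℝ}
    {t₀ : Icc tmin tmax} {x₀ : E} {a L K : ℝ≥0} (hf : IsPicardLindelof f t₀ x₀ a 0 L K) :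
    ∃ α : ℝ → E, α t₀ = x₀ ∧ (∀ t, α t ∈ closedBall x₀ a) ∧
      ∀ t ∈ Icc tmin tmax, HasDerivWithinAt α (f t (α t)) (Icc tmin tmax) t := by
  have hx : x₀ ∈ closedBall x₀ ((0 : ℝ≥0) : ℝ) := by simp
  obtain ⟨α, hα⟩ := ODE.FunSpace.exists_isFixedPt_next hf hx
  refine ⟨α.compProj, by rw [ODE.FunSpace.compProj_val, ← hα, ODE.FunSpace.next_apply₀],
    fun t => α.compProj_mem_closedBall hf.mul_max_le, fun t ht ↦ ?_⟩
  apply ODE.hasDerivWithinAt_picard_Icc t₀.2 hf.continuousOn_uncurry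
    α.continuous_compProj.continuousOn (fun _ ht' ↦ α.compProj_mem_closedBall hf.mul_max_le)
    x₀ ht |>.congr_of_mem _ ht
  intro t' ht'
  nth_rw 1 [← hα]
  rw [ODE.FunSpace.compProj_of_mem ht', ODE.FunSpace.next_apply]

/-- Linearity in the error `ε` turns a defect of order `‖u‖²` in an approximate solution into a
distance of order `‖u‖²`. -/
theorem gronwallBound_zero_left_eq_mul (K ε x : ℝ) :
    gronwallBound 0 K ε x = ε * gronwallBound 0 K 1 x := by
  unfold gronwallBound
  split_ifs <;> ring

/-- Frobenius' theorem for total differential equations: if the integrability condition holds,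
`Dψ(w) = A(ψ(w))` has a local solution. -/
theorem exists_total_solution [CompleteSpace E] {A : E → W →L[ℝ] E} {x₀ : E}
    (hA : ContDiffAt ℝ 2 A x₀)
    (hsymm : ∀ᶠ y in 𝓝 x₀, ∀ u w, fderiv ℝ A y (A y w) u = fderiv ℝ A y (A y u) w) :
    ∃ r > 0, ∃ ψ : W → E, ψ 0 = x₀ ∧ ∀ w ∈ ball (0 : W) r, HasFDerivAt ψ (A (ψ w)) w := by
  have hA1 : ContDiffAt ℝ 1 A x₀ := hA.of_le (by norm_num)
  have hdA : ContDiffAt ℝ 1 (fderiv ℝ A) x₀ := hA.fderiv_right (by norm_num)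
  obtain ⟨K, s, hs, hK⟩ := hA1.exists_lipschitzOnWith
  obtain ⟨K₂, s₂, hs₂, hK₂⟩ := hdA.exists_lipschitzOnWith
  have hdiff : ∀ᶠ y in 𝓝 x₀, DifferentiableAt ℝ A y := by
    filter_upwards [hA1.eventually (by simp)] with y hy using hy.differentiableAt (by simp)
  obtain ⟨a₀, ha₀, hball⟩ := Metric.mem_nhds_iff.1
    (inter_mem (inter_mem hs hs₂) (inter_mem hdiff hsymm))
  obtain ⟨a, ha, haa⟩ : ∃ a : ℝ≥0, 0 < a ∧ (2 * a : ℝ) < a₀ :=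
    ⟨⟨a₀ / 4, by positivity⟩, NNReal.coe_lt_coe.1 (by show (0 : ℝ) < a₀ / 4; positivity), by
      show 2 * (a₀ / 4) < a₀; linarith⟩
  have haR : (0 : ℝ) < a := ha
  -- The radius is `2 * a` because exact solutions stay within `a` of `x₀` and the comparison curve
  -- `g` below deviates from one of them by at most another `a`.
  set S := closedBall x₀ (2 * a : ℝ) with hSdef
  have hSsub : S ⊆ ball x₀ a₀ := closedBall_subset_ball haa
  have hSK : LipschitzOnWith K A S := hK.mono fun y hy => (hball (hSsub hy)).1.1
  have hSK₂ : LipschitzOnWith K₂ (fderiv ℝ A) S := hK₂.mono fun y hy => (hball (hSsub hy)).1.2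
  have hSd : ∀ y ∈ S, DifferentiableAt ℝ A y := fun y hy => (hball (hSsub hy)).2.1
  have hSs : ∀ y ∈ S, ∀ u w, fderiv ℝ A y (A y w) u = fderiv ℝ A y (A y u) w :=
    fun y hy => (hball (hSsub hy)).2.2
  have hxS : x₀ ∈ S := mem_closedBall_self (by positivity)
  have hSconv : Convex ℝ S := convex_closedBall _ _
  -- bounds
  set L : ℝ := K * (2 * a) + ‖A x₀‖ + 1 with hL
  have hLpos : 0 < L := by positivity
  have hAL : ∀ y ∈ S, ‖A y‖ ≤ L := by
    intro y hy
    have h1 := hSK.dist_le_mul y hy x₀ hxS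
    rw [dist_eq_norm] at h1
    have h2 : dist y x₀ ≤ 2 * a := hy
    have h3 : ‖A y‖ ≤ ‖A y - A x₀‖ + ‖A x₀‖ := by simpa using norm_add_le (A y - A x₀) (A x₀)
    have h4 : K * dist y x₀ ≤ K * (2 * a) := by gcongr
    linarith
  set D : ℝ := K₂ * (2 * a) + ‖fderiv ℝ A x₀‖ with hD
  have hDpos : 0 ≤ D := by positivity
  have hAD : ∀ y ∈ S, ‖fderiv ℝ A y‖ ≤ D := by
    intro y hy
    have h1 := hSK₂.dist_le_mul y hy x₀ hxS
    rw [dist_eq_norm] at h1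
    have h2 : dist y x₀ ≤ 2 * a := hy
    have h3 : ‖fderiv ℝ A y‖ ≤ ‖fderiv ℝ A y - fderiv ℝ A x₀‖ + ‖fderiv ℝ A x₀‖ := by
      simpa using norm_add_le (fderiv ℝ A y - fderiv ℝ A x₀) (fderiv ℝ A x₀)
    have h4 : K₂ * dist y x₀ ≤ K₂ * (2 * a) := by gcongr
    linarith
  have htaylor : ∀ y ∈ S, ∀ z ∈ S,
      ‖A z - A y - fderiv ℝ A y (z - y)‖ ≤ K₂ * ‖z - y‖ * ‖z - y‖ := by
    intro y hy z hz
    have hseg : segment ℝ y z ⊆ S := hSconv.segment_subset hy hz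
    refine (convex_segment y z).norm_image_sub_le_of_norm_hasFDerivWithin_le'
      (f' := fun p => fderiv ℝ A p)
      (fun p hp => (hSd p (hseg hp)).hasFDerivAt.hasFDerivWithinAt) ?_
      (left_mem_segment ℝ y z) (right_mem_segment ℝ y z)
    intro p hp
    have := hSK₂.dist_le_mul p (hseg hp) y hy
    rw [dist_eq_norm, dist_eq_norm] at this
    refine this.trans ?_
    gcongr
    have := norm_sub_le_of_mem_segment hp
    simpa using this
  -- solutions along rays
  set r : ℝ := a / L with hr
  have hrpos : 0 < r := by positivity
  have hsol : ∀ w ∈ ball (0 : W) r, ∃ y : ℝ → E, y 0 = x₀ ∧ (∀ t, y t ∈ closedBall x₀ a) ∧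
      ∀ t ∈ Icc (0 : ℝ) 1, HasDerivWithinAt y (A (y t) w) (Icc 0 1) t := by
    intro w hw
    have hw' : ‖w‖ < r := by simpa using hw
    have hsub : closedBall x₀ (a : ℝ) ⊆ S := closedBall_subset_closedBall (by linarith)
    have hLw : ‖w‖ * L ≤ a := by
      have : ‖w‖ * L ≤ r * L := by gcongr
      rwa [hr, div_mul_cancel₀ _ hLpos.ne'] at this
    have hP : IsPicardLindelof (fun _ y => A y w) (tmin := 0) (tmax := 1) ⟨0, by simp⟩ x₀ a 0
        (⟨‖w‖ * L, by positivity⟩ : ℝ≥0) (K * ‖w‖₊) := by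
      refine IsPicardLindelof.of_time_independent ?_ ?_ ?_
      · intro y hy
        have := (A y).le_opNorm w
        have h2 := hAL y (hsub hy)
        show ‖A y w‖ ≤ ‖w‖ * L
        nlinarith [norm_nonneg w]
      · refine LipschitzOnWith.of_dist_le_mul fun y hy z hz => ?_
        have := hSK.dist_le_mul y (hsub hy) z (hsub hz)
        rw [dist_eq_norm] at this ⊢
        rw [← sub_apply]
        refine ((A y - A z).le_opNorm w).trans ?_
        push_cast
        nlinarith [norm_nonneg w]
      · show ‖w‖ * L * max (1 - 0) (0 - 0) ≤ (a : ℝ) - ((0 : ℝ≥0) : ℝ)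
        simpa using hLw
    exact exists_solution_mem_closedBall hP
  choose! y hy0 hymem hyder using hsol
  -- The candidate `ψ w` is the time-one value of the solution of `y' = A(y) w` starting at `x₀`. It
  -- remains to see that it is differentiable in `w`, with the right derivative.
  refine ⟨r, hrpos, fun w => y w 1, ?_, ?_⟩
  · have h0 : (0 : W) ∈ ball (0 : W) r := mem_ball_self hrpos
    have hc : ∀ t ∈ Icc (0 : ℝ) 1, y 0 t = y 0 0 := by
      refine constant_of_has_deriv_right_zero (fun t ht => (hyder 0 h0 t ht).continuousWithinAt) ?_
      intro t ht
      have := hyder 0 h0 t ⟨ht.1, ht.2.le⟩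
      rw [map_zero] at this
      exact this.mono_of_mem_nhdsWithin (Icc_mem_nhdsGE_of_mem ht)
    show y 0 1 = x₀
    rw [hc 1 (by simp), hy0 0 h0]
  · intro w hw
    have hw' : ‖w‖ < r := by simpa using hw
    have hsub : closedBall x₀ (a : ℝ) ⊆ S := closedBall_subset_closedBall (by linarith)
    set C : ℝ := (K₂ * L * L * r + D * L) * gronwallBound 0 (K * r) 1 1 with hC
    have key : ∀ u : W, ‖u‖ < min (r - ‖w‖) r →
        ‖y (w + u) 1 - y w 1 - A (y w 1) u‖ ≤ C * ‖u‖ ^ 2 := by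
      intro u hu
      have hu1 : ‖u‖ < r - ‖w‖ := hu.trans_le (min_le_left _ _)
      have hu2 : ‖u‖ < r := hu.trans_le (min_le_right _ _)
      have hwu : ‖w + u‖ < r := (norm_add_le w u).trans_lt (by linarith)
      have hwu' : w + u ∈ ball (0 : W) r := by simpa using hwu
      have hder := hyder w hw
      have hmem : ∀ t, y w t ∈ S := fun t => hsub (hymem w hw t)
      have hLu : L * ‖u‖ ≤ a := by
        have : L * ‖u‖ ≤ L * r := by gcongr
        rwa [hr, mul_div_cancel₀ _ hLpos.ne'] at this
      have hAu : ∀ t, ‖A (y w t) u‖ ≤ L * ‖u‖ := fun t =>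
        ((A (y w t)).le_opNorm u).trans (by gcongr; exact hAL _ (hmem t))
      have htAu : ∀ t ∈ Icc (0 : ℝ) 1, ‖t • A (y w t) u‖ ≤ L * ‖u‖ := by
        intro t ht
        rw [norm_smul, Real.norm_of_nonneg ht.1]
        calc t * ‖A (y w t) u‖ ≤ 1 * ‖A (y w t) u‖ := by gcongr; exact ht.2
          _ ≤ L * ‖u‖ := by simpa using hAu t
      -- This is the first-order guess for the solution with parameter `w + u`; it is what `ψ (t w +
      -- t u)` should be if `Dψ = A(ψ)`. It solves that equation up to a defect of order `‖u‖²`.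
      set g : ℝ → E := fun t => y w t + t • A (y w t) u with hg
      have hgmem : ∀ t ∈ Icc (0 : ℝ) 1, g t ∈ S := by
        intro t ht
        have h1 : dist (y w t) x₀ ≤ a := hymem w hw t
        rw [hSdef, mem_closedBall, dist_eq_norm]
        rw [dist_eq_norm] at h1
        have h2 : g t - x₀ = (y w t - x₀) + t • A (y w t) u := by
          simp only [hg]; abel
        rw [h2]
        refine (norm_add_le _ _).trans ?_
        linarith [htAu t ht]
      have hgder : ∀ t ∈ Icc (0 : ℝ) 1, HasDerivWithinAt g
          (A (y w t) w + (t • fderiv ℝ A (y w t) (A (y w t) w) u + (1 : ℝ) • A (y w t) u))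
          (Icc 0 1) t := by
        intro t ht
        have h1 : HasDerivWithinAt (fun t => A (y w t)) (fderiv ℝ A (y w t) (A (y w t) w))
            (Icc 0 1) t :=
          (hSd _ (hmem t)).hasFDerivAt.comp_hasDerivWithinAt t (hder t ht)
        have h2 : HasDerivWithinAt (fun t => A (y w t) u) (fderiv ℝ A (y w t) (A (y w t) w) u)
            (Icc 0 1) t := by
          simpa using h1.clm_apply (hasDerivWithinAt_const t (Icc (0 : ℝ) 1) u)
        exact (hder t ht).add ((hasDerivWithinAt_id t _).smul h2)
      have hgr := dist_le_of_approx_trajectories_ODE_of_mem (E := E) (a := 0) (b := 1)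
        (v := fun _ p => A p (w + u)) (K := K * ⟨r, hrpos.le⟩) (s := fun _ => S) (δ := 0)
        (f := y (w + u)) (f' := fun t => A (y (w + u) t) (w + u)) (g := g)
        (g' := fun t => A (y w t) w +
          (t • fderiv ℝ A (y w t) (A (y w t) w) u + (1 : ℝ) • A (y w t) u))
        (εf := 0) (εg := (K₂ * L * L * r + D * L) * ‖u‖ ^ 2)
        (fun t ht => ?_)
        (fun t ht => (hyder _ hwu' t ht).continuousWithinAt)
        (fun t ht => (hyder _ hwu' t ⟨ht.1, ht.2.le⟩).mono_of_mem_nhdsWithin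
          (Icc_mem_nhdsGE_of_mem ht))
        (fun t ht => by simp)
        (fun t ht => hsub (hymem _ hwu' t))
        (fun t ht => (hgder t ht).continuousWithinAt)
        (fun t ht => (hgder t ⟨ht.1, ht.2.le⟩).mono_of_mem_nhdsWithin (Icc_mem_nhdsGE_of_mem ht))
        (fun t ht => ?_)
        (fun t ht => hgmem t ⟨ht.1, ht.2.le⟩)
        (by simp [hg, hy0 w hw, hy0 _ hwu']) 1 (by simp)
      · rw [dist_eq_norm, gronwallBound_zero_left_eq_mul] at hgr
        have e1 : y (w + u) 1 - g 1 = y (w + u) 1 - y w 1 - A (y w 1) u := by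
          simp only [hg, one_smul]; abel
        rw [e1] at hgr
        refine hgr.trans (le_of_eq ?_)
        rw [hC, zero_add, sub_zero]
        show _ * gronwallBound 0 (K * r) 1 1 = _
        ring
      · refine LipschitzOnWith.of_dist_le_mul fun p hp q hq => ?_
        have := hSK.dist_le_mul p hp q hq
        rw [dist_eq_norm] at this ⊢
        rw [← sub_apply]
        refine ((A p - A q).le_opNorm (w + u)).trans ?_
        show _ ≤ K * r * dist p q
        calc ‖A p - A q‖ * ‖w + u‖ ≤ (K * dist p q) * r := by gcongr
          _ = _ := by ring
      · have ht' : t ∈ Icc (0 : ℝ) 1 := ⟨ht.1, ht.2.le⟩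
        have hgy : g t - y w t = t • A (y w t) u := by simp [hg]
        -- The integrability condition enters here: it replaces `DA(A w) u` by `DA(A u) w`, which
        -- cancels the linear term of `A (g t) w`. What is left is a Taylor remainder and a term
        -- quadratic in `u`.
        have e : A (y w t) w + (t • fderiv ℝ A (y w t) (A (y w t) w) u + (1 : ℝ) • A (y w t) u)
            - A (g t) (w + u) =
            - ((A (g t) - A (y w t) - fderiv ℝ A (y w t) (g t - y w t)) (w + u))
            - t • fderiv ℝ A (y w t) (A (y w t) u) u := by
          rw [hgy, hSs _ (hmem t) u w]
          simp only [map_add, map_smul, sub_apply, smul_apply, one_smul]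
          abel
        rw [dist_eq_norm, e]
        refine (norm_sub_le _ _).trans ?_
        rw [norm_neg]
        have h1 : ‖(A (g t) - A (y w t) - fderiv ℝ A (y w t) (g t - y w t)) (w + u)‖ ≤
            K₂ * (L * ‖u‖) * (L * ‖u‖) * r := by
          refine (ContinuousLinearMap.le_opNorm _ _).trans ?_
          have h2 := htaylor _ (hmem t) _ (hgmem t ht')
          rw [hgy] at h2
          have h3 := htAu t ht'
          rw [hgy]
          gcongr
          refine h2.trans ?_
          gcongr
        have h4 : ‖t • fderiv ℝ A (y w t) (A (y w t) u) u‖ ≤ D * (L * ‖u‖) * ‖u‖ := by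
          rw [norm_smul, Real.norm_of_nonneg ht.1]
          have h5 : ‖fderiv ℝ A (y w t) (A (y w t) u) u‖ ≤ D * (L * ‖u‖) * ‖u‖ := by
            refine (ContinuousLinearMap.le_opNorm _ _).trans ?_
            gcongr
            refine (ContinuousLinearMap.le_opNorm _ _).trans ?_
            gcongr
            · exact hAD _ (hmem t)
            · exact hAu t
          calc t * _ ≤ 1 * ‖fderiv ℝ A (y w t) (A (y w t) u) u‖ := by gcongr; exact ht.2.le
            _ ≤ _ := by simpa using h5
        calc _ ≤ K₂ * (L * ‖u‖) * (L * ‖u‖) * r + D * (L * ‖u‖) * ‖u‖ := add_le_add h1 h4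
          _ = _ := by ring
    have hO : (fun w' => y w' 1 - y w 1 - A (y w 1) (w' - w)) =O[𝓝 w]
        fun w' => ‖w' - w‖ ^ 2 := by
      refine Asymptotics.IsBigO.of_bound C ?_
      have : ball w (min (r - ‖w‖) r) ∈ 𝓝 w :=
        ball_mem_nhds _ (lt_min (by linarith) hrpos)
      filter_upwards [this] with w' hw''
      have := key (w' - w) (by simpa [dist_eq_norm] using hw'')
      simpa using this
    have h0 := hO.hasFDerivAt (𝕜 := ℝ) (by norm_num)
    have h1 : HasFDerivAt (fun w' => y w 1 + A (y w 1) (w' - w)) (A (y w 1)) w := by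
      simpa using ((A (y w 1)).hasFDerivAt.comp w ((hasFDerivAt_id w).sub_const w)).const_add (y w 1)
    have h2 := h0.add h1
    simp only [zero_add] at h2
    refine h2.congr_of_eventuallyEq (Eventually.of_forall fun w' => ?_)
    simp

/-- Local uniqueness for total differential equations. -/
theorem total_solution_unique {A : E → W →L[ℝ] E} {ψ₁ ψ₂ : W → E} {w₀ : W}
    (hA : ContDiffAt ℝ 1 A (ψ₁ w₀))
    (h₁ : ∀ᶠ w in 𝓝 w₀, HasFDerivAt ψ₁ (A (ψ₁ w)) w)
    (h₂ : ∀ᶠ w in 𝓝 w₀, HasFDerivAt ψ₂ (A (ψ₂ w)) w) (h : ψ₁ w₀ = ψ₂ w₀) :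
    ψ₁ =ᶠ[𝓝 w₀] ψ₂ := by
  obtain ⟨K, s, hs, hK⟩ := hA.exists_lipschitzOnWith
  have e₁ : ∀ᶠ w in 𝓝 w₀, ψ₁ w ∈ s := h₁.self_of_nhds.continuousAt hs
  have e₂ : ∀ᶠ w in 𝓝 w₀, ψ₂ w ∈ s := h₂.self_of_nhds.continuousAt (h ▸ hs)
  obtain ⟨δ, hδ, hball⟩ := Metric.mem_nhds_iff.1 (h₁.and (h₂.and (e₁.and e₂)))
  filter_upwards [ball_mem_nhds w₀ hδ] with w hw
  have hseg : ∀ t ∈ Icc (0 : ℝ) 1, w₀ + t • (w - w₀) ∈ ball w₀ δ := by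
    intro t ht
    have h1 : dist w w₀ < δ := hw
    rw [dist_eq_norm] at h1
    rw [mem_ball, dist_eq_norm, add_sub_cancel_left, norm_smul, Real.norm_of_nonneg ht.1]
    calc t * ‖w - w₀‖ ≤ 1 * ‖w - w₀‖ := by gcongr; exact ht.2
      _ < δ := by simpa using h1
  have hline : ∀ t : ℝ, HasDerivAt (fun t : ℝ => w₀ + t • (w - w₀)) (w - w₀) t := by
    intro t
    simpa using ((hasDerivAt_id t).smul_const (w - w₀)).const_add w₀
  have hd₁ : ∀ t ∈ Icc (0 : ℝ) 1, HasDerivAt (fun t : ℝ => ψ₁ (w₀ + t • (w - w₀)))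
      (A (ψ₁ (w₀ + t • (w - w₀))) (w - w₀)) t := fun t ht =>
    (hball (hseg t ht)).1.comp_hasDerivAt t (hline t)
  have hd₂ : ∀ t ∈ Icc (0 : ℝ) 1, HasDerivAt (fun t : ℝ => ψ₂ (w₀ + t • (w - w₀)))
      (A (ψ₂ (w₀ + t • (w - w₀))) (w - w₀)) t := fun t ht =>
    (hball (hseg t ht)).2.1.comp_hasDerivAt t (hline t)
  -- Along the segment from `w₀` to `w` both maps solve the same ordinary differential equation; its
  -- value at time `1` is the claim at `w`.
  have := ODE_solution_unique_of_mem_Icc_right (a := 0) (b := 1) (K := K * ‖w - w₀‖₊)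
    (v := fun _ p => A p (w - w₀)) (s := fun _ => s)
    (f := fun t : ℝ => ψ₁ (w₀ + t • (w - w₀))) (g := fun t : ℝ => ψ₂ (w₀ + t • (w - w₀)))
    (fun t ht => ?_)
    (fun t ht => (hd₁ t ht).continuousAt.continuousWithinAt)
    (fun t ht => (hd₁ t ⟨ht.1, ht.2.le⟩).hasDerivWithinAt)
    (fun t ht => (hball (hseg t ⟨ht.1, ht.2.le⟩)).2.2.1)
    (fun t ht => (hd₂ t ht).continuousAt.continuousWithinAt)
    (fun t ht => (hd₂ t ⟨ht.1, ht.2.le⟩).hasDerivWithinAt)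
    (fun t ht => (hball (hseg t ⟨ht.1, ht.2.le⟩)).2.2.2)
    (by simpa using h)
  · simpa using this (x := 1) (by simp)
  · refine LipschitzOnWith.of_dist_le_mul fun p hp q hq => ?_
    have := hK.dist_le_mul p hp q hq
    rw [dist_eq_norm] at this ⊢
    rw [← sub_apply]
    refine ((A p - A q).le_opNorm (w - w₀)).trans ?_
    push_cast
    nlinarith [norm_nonneg (w - w₀)]

/-- A curve whose velocity is `A(y) c(t)` follows a solution of the total differential equation
`Dψ = A(ψ)`. -/
theorem curve_eq_total_solution {A : E → W →L[ℝ] E} {ψ : W → E} {y : ℝ → E} {q c : ℝ → W} {t₀ : ℝ}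
    (hA : ContDiffAt ℝ 1 A (y t₀))
    (hy : ∀ᶠ t in 𝓝 t₀, HasDerivAt y (A (y t) (c t)) t)
    (hq : ∀ᶠ t in 𝓝 t₀, HasDerivAt q (c t) t) (hc : ContinuousAt c t₀)
    (hψ : ∀ᶠ w in 𝓝 (q t₀), HasFDerivAt ψ (A (ψ w)) w) (h : y t₀ = ψ (q t₀)) :
    y =ᶠ[𝓝 t₀] ψ ∘ q := by
  obtain ⟨K, s, hs, hK⟩ := hA.exists_lipschitzOnWith
  have hcb : ∀ᶠ t in 𝓝 t₀, ‖c t‖ < ‖c t₀‖ + 1 :=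
    hc.norm.eventually (gt_mem_nhds (by simp))
  have hqc : ContinuousAt q t₀ := hq.self_of_nhds.continuousAt
  have hψc : ContinuousAt (ψ ∘ q) t₀ := ContinuousAt.comp hψ.self_of_nhds.continuousAt hqc
  -- Since `q' = c`, the chain rule makes `ψ ∘ q` a solution of `p' = A(p) c(t)`, the equation that
  -- `y` satisfies.
  refine ODE_solution_unique_of_eventually (K := K * (‖c t₀‖₊ + 1)) (v := fun t p => A p (c t))
    (s := fun _ => s) ?_ ?_ ?_ h
  · filter_upwards [hcb] with t ht
    refine LipschitzOnWith.of_dist_le_mul fun p hp p' hp' => ?_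
    have := hK.dist_le_mul p hp p' hp'
    rw [dist_eq_norm] at this ⊢
    rw [← sub_apply]
    refine ((A p - A p').le_opNorm (c t)).trans ?_
    push_cast
    calc ‖A p - A p'‖ * ‖c t‖ ≤ (K * dist p p') * (‖c t₀‖ + 1) := by gcongr
      _ = _ := by ring
  · filter_upwards [hy, hy.self_of_nhds.continuousAt hs] with t h1 h2 using ⟨h1, h2⟩
  · have hs' : s ∈ 𝓝 ((ψ ∘ q) t₀) := by simpa [← h] using hs
    filter_upwards [hqc.eventually hψ, hq, hψc hs'] with t h1 h2 h3
    exact ⟨h1.comp_hasDerivAt t h2, h3⟩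

end Frobenius

/-! ### Commutation of the Reeb fields -/

section Integrability

variable {E : Type*} [NormedAddCommGroup E] [NormedSpace ℝ E]
  {W : Type*} [NormedAddCommGroup W] [NormedSpace ℝ W]

/-- Cartan's formula for the exterior derivative of a one-form. -/
theorem extDeriv_one_apply_vectorField {η : E → E [⋀^Fin 1]→L[ℝ] W} {Y Z : E → E} {x : E}
    (hη : DifferentiableAt ℝ η x) (hY : DifferentiableAt ℝ Y x) (hZ : DifferentiableAt ℝ Z x) :
    extDeriv η x ![Y x, Z x] = fderiv ℝ (fun y => η y ![Z y]) x (Y x)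
      - fderiv ℝ (fun y => η y ![Y y]) x (Z x) - η x ![VectorField.lieBracket ℝ Y Z x] := by
  have h := extDeriv_apply_vectorField (V := ![Y, Z]) hη (by
    intro i; fin_cases i <;> simpa)
  have e : ∀ y, (fun i => ![Y, Z] i y) = ![Y y, Z y] := fun y => by
    funext i; fin_cases i <;> rfl
  have e1 : ∀ a b : E, Fin.removeNth (1 : Fin (0 + 2)) ![a, b] = ![a] := fun a b => by
    funext i; fin_cases i; rfl
  simp only [e] at h
  simpa [Finset.sum_filter, e1, sub_eq_add_neg] using h

theorem contDiffAt_extDeriv {n : ℕ} {Ω : E → E [⋀^Fin n]→L[ℝ] W} {x : E}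
    {r m : WithTop ℕ∞} (h : ContDiffAt ℝ r Ω x) (hm : m + 1 ≤ r) :
    ContDiffAt ℝ m (extDeriv Ω) x :=
  ContDiffAt.comp (g := ContinuousAlternatingMap.alternatizeUncurryFinCLM ℝ E W (n := n)) x
    (ContinuousLinearMap.contDiff _).contDiffAt (h.fderiv_right hm)

/-- The asserted symmetry says that the fields `A · w` and `A · u` commute. Their bracket is
annihilated by `η`, by Cartan's formula for `dη` with `η(A w)` constant, and by `dη`, since in the
formula for `d(dη) = 0` every other term contains a contraction of `dη` with some `A w`. Hence it
vanishes by `hinj`. -/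
theorem fderiv_symm_of_reeb {η : E → E [⋀^Fin 1]→L[ℝ] W} {A : E → W →L[ℝ] E} {x : E}
    (hη : ContDiffAt ℝ 2 η x) (hA : DifferentiableAt ℝ A x)
    (h₁ : ∀ᶠ y in 𝓝 x, ∀ w, η y ![A y w] = w)
    (h₂ : ∀ᶠ y in 𝓝 x, ∀ w v, extDeriv η y ![A y w, v] = 0)
    (hinj : ∀ v, η x ![v] = 0 → (∀ v', extDeriv η x ![v, v'] = 0) → v = 0) (u w : W) :
    fderiv ℝ A x (A x w) u = fderiv ℝ A x (A x u) w := by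
  have hdη : DifferentiableAt ℝ (extDeriv η) x :=
    (contDiffAt_extDeriv (m := 1) hη (by norm_num)).differentiableAt
      (by simp)
  have hAd : ∀ w, DifferentiableAt ℝ (fun y => A y w) x := fun w => hA.clm_apply (by fun_prop)
  have h₂' : ∀ᶠ y in 𝓝 x, ∀ w v, extDeriv η y ![v, A y w] = 0 := by
    filter_upwards [h₂] with y hy w v
    have h := (extDeriv η y).toAlternatingMap.map_swap ![A y w, v] (i := 0) (j := 1) (by simp)
    have e : ![A y w, v] ∘ Equiv.swap (0 : Fin 2) 1 = ![v, A y w] := by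
      funext i; fin_cases i <;> simp
    rw [e] at h
    exact h.trans (by rw [neg_eq_zero]; exact hy w v)
  have hbr : VectorField.lieBracket ℝ (fun y => A y w) (fun y => A y u) x = 0 := by
    refine hinj _ ?_ ?_
    · have h := extDeriv_one_apply_vectorField (hη.differentiableAt (by simp)) (hAd w) (hAd u)
      have c : ∀ w, fderiv ℝ (fun y => η y ![A y w]) x = 0 := fun w => by
        have : (fun y => η y ![A y w]) =ᶠ[𝓝 x] fun _ => w := by
          filter_upwards [h₁] with y hy using hy w
        rw [this.fderiv_eq]; simp
      rw [h₂.self_of_nhds, c, c] at h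
      simpa using h.symm
    · intro z
      have h := extDeriv_apply_vectorField (V := ![fun y => A y w, fun y => A y u, fun _ => z])
        hdη (by intro i; fin_cases i; exacts [hAd w, hAd u, differentiableAt_const z])
      have e : ∀ y, (fun i => ![fun y => A y w, fun y => A y u, fun _ => z] i y) =
          ![A y w, A y u, z] := fun y => by
        funext i; fin_cases i <;> rfl
      have e1 : ∀ a b c : E, Fin.removeNth (1 : Fin (1 + 2)) ![a, b, c] = ![a, c] := fun a b c => by
        funext i; fin_cases i <;> rfl
      have e2 : ∀ a b c : E, Fin.removeNth (2 : Fin (1 + 2)) ![a, b, c] = ![a, b] := fun a b c => by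
        funext i; fin_cases i <;> rfl
      have e1' : ∀ a b : E, Fin.removeNth (1 : Fin (1 + 1)) ![a, b] = ![a] := fun a b => by
        funext i; fin_cases i; rfl
      have c1 : ∀ w z, fderiv ℝ (fun y => extDeriv η y ![A y w, z]) x = 0 := fun w z => by
        have : (fun y => extDeriv η y ![A y w, z]) =ᶠ[𝓝 x] fun _ => 0 := by
          filter_upwards [h₂] with y hy using hy w z
        rw [this.fderiv_eq]; simp
      have c2 : fderiv ℝ (fun y => extDeriv η y ![A y w, A y u]) x = 0 := by
        have : (fun y => extDeriv η y ![A y w, A y u]) =ᶠ[𝓝 x] fun _ => 0 := by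
          filter_upwards [h₂] with y hy using hy w _
        rw [this.fderiv_eq]; simp
      rw [extDeriv_extDeriv_apply hη (by simp)] at h
      simp only [e] at h
      have hI : Finset.Ici (1 : Fin (1 + 1)) = {1} := rfl
      simpa [Fin.sum_univ_succ, hI, e1, e2, e1', c1, c2, h₂'.self_of_nhds] using h
  have hf : ∀ w v, fderiv ℝ (fun y => A y w) x v = fderiv ℝ A x v w := fun w v => by
    rw [fderiv_clm_apply hA (by fun_prop)]; simp
  rw [VectorField.lieBracket, hf, hf, sub_eq_zero] at hbr
  exact hbr

end Integrability

/-! ### Smooth dependence of pullbacks of alternating maps -/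

section AlternatingCalculus

variable {E : Type*} [NormedAddCommGroup E] [NormedSpace ℝ E]
  {F : Type*} [NormedAddCommGroup F] [NormedSpace ℝ F]
  {G : Type*} [NormedAddCommGroup G] [NormedSpace ℝ G]
  {W : Type*} [NormedAddCommGroup W] [NormedSpace ℝ W] {n : ℕ}

/-- Alternatization of continuous multilinear maps, as a continuous linear map. -/
noncomputable def alternatizationL :
    ContinuousMultilinearMap ℝ (fun _ : Fin n => E) W →L[ℝ] E [⋀^Fin n]→L[ℝ] W :=
  LinearMap.mkContinuous
    { toFun := ContinuousMultilinearMap.alternatization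
      map_add' := map_add _
      map_smul' := fun c f => by
        ext v
        simp [ContinuousMultilinearMap.alternatization_apply_apply, Finset.smul_sum,
          smul_comm c] }
    (Fintype.card (Equiv.Perm (Fin n))) fun f => by
      refine ContinuousAlternatingMap.opNorm_le_bound _
        (mul_nonneg (Nat.cast_nonneg _) (norm_nonneg _)) fun v => ?_
      show ‖ContinuousMultilinearMap.alternatization f v‖ ≤ _
      rw [ContinuousMultilinearMap.alternatization_apply_apply]
      have : ∀ σ ∈ (Finset.univ : Finset (Equiv.Perm (Fin n))),
          ‖Equiv.Perm.sign σ • f (v ∘ σ)‖ ≤ ‖f‖ * ∏ i, ‖v i‖ := fun σ _ => by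
        have h1 : ‖Equiv.Perm.sign σ • f (v ∘ σ)‖ = ‖f (v ∘ σ)‖ := by
          rcases Int.units_eq_one_or (Equiv.Perm.sign σ) with h | h <;> simp [h]
        rw [h1, ← Equiv.prod_comp σ fun i => ‖v i‖]
        exact f.le_opNorm _
      refine (norm_sum_le_of_le _ this).trans (le_of_eq ?_)
      simp [Finset.card_univ, mul_assoc]

theorem alternatizationL_toContinuousMultilinearMap (f : E [⋀^Fin n]→L[ℝ] W) :
    alternatizationL f.toContinuousMultilinearMap = (Fintype.card (Equiv.Perm (Fin n)) : ℝ) • f := by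
  ext v
  show ContinuousMultilinearMap.alternatization f.toContinuousMultilinearMap v = _
  rw [ContinuousMultilinearMap.alternatization_apply_apply]
  have : ∀ σ : Equiv.Perm (Fin n),
      Equiv.Perm.sign σ • f.toContinuousMultilinearMap (v ∘ σ) = f v := fun σ => by
    have h := f.toAlternatingMap.map_perm v σ
    have h' : f.toContinuousMultilinearMap (v ∘ σ) = Equiv.Perm.sign σ • f v := h
    rw [h', smul_smul, Int.units_mul_self, one_smul]
  rw [Finset.sum_congr rfl fun σ _ => this σ, Finset.sum_const, Finset.card_univ,
    ← Nat.cast_smul_eq_nsmul ℝ]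
  rfl

/-- Composition is smooth jointly in both arguments for multilinear maps. Alternatization carries
this over: on a map that is already alternating it is multiplication by `n!`, which is then divided
out. -/
theorem contDiffAt_compContinuousLinearMap {Ω : G → F [⋀^Fin n]→L[ℝ] W} {g : G → E →L[ℝ] F}
    {x : G} {m : WithTop ℕ∞} (hΩ : ContDiffAt ℝ m Ω x) (hg : ContDiffAt ℝ m g x) :
    ContDiffAt ℝ m (fun y => (Ω y).compContinuousLinearMap (g y)) x := by
  have key : (fun y => (Ω y).compContinuousLinearMap (g y)) = fun y =>
      (Fintype.card (Equiv.Perm (Fin n)) : ℝ)⁻¹ • alternatizationL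
        (ContinuousMultilinearMap.compContinuousLinearMapContinuousMultilinear ℝ
          (fun _ : Fin n => E) (fun _ : Fin n => F) W (fun _ => g y)
          (ContinuousAlternatingMap.toContinuousMultilinearMapCLM ℝ (Ω y))) := by
    funext y
    have := alternatizationL_toContinuousMultilinearMap ((Ω y).compContinuousLinearMap (g y))
    rw [eq_inv_smul_iff₀ (by simp [Fintype.card_ne_zero]), ← this]
    rfl
  rw [key]
  refine ContDiffAt.const_smul _ (ContDiffAt.comp (g := alternatizationL) x
    (ContinuousLinearMap.contDiff _).contDiffAt ?_)
  refine ContDiffAt.clm_apply ?_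
    ((ContinuousLinearMap.contDiff _).contDiffAt.comp x hΩ)
  exact (ContinuousMultilinearMap.contDiff _).contDiffAt.comp x (contDiffAt_pi.2 fun _ => hg)

theorem minSmoothness_two_le_infty : minSmoothness ℝ 2 ≤ (∞ : WithTop ℕ∞) := by
  rw [minSmoothness_of_isRCLikeNormedField]
  exact WithTop.coe_le_coe.2 (le_top : (2 : ℕ∞) ≤ ⊤)

end AlternatingCalculus

/-! ### Pullbacks and exterior derivatives of forms on a manifold -/

section FormCalculus

variable {E : Type*} [NormedAddCommGroup E] [NormedSpace ℝ E]
  {M : Type*} [TopologicalSpace M] [ChartedSpace E M]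
  {E' : Type*} [NormedAddCommGroup E'] [NormedSpace ℝ E'] {n k : ℕ}

/-- The pullback of a form by a map from a vector space, with values in the plain space of
alternating maps. -/
noncomputable def pullE (f : E' → M) (Ω : DForm E M n k) (z : E') : E' [⋀^Fin n]→L[ℝ] (Fin k → ℝ) :=
  pullbackForm f Ω z

theorem form_congr_point (Ω : DForm E M n k) {x x' : M} (h : x = x') (v : Fin n → E) :
    (Ω x : E [⋀^Fin n]→L[ℝ] (Fin k → ℝ)) v = (Ω x' : E [⋀^Fin n]→L[ℝ] (Fin k → ℝ)) v := by
  subst h; rfl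

theorem IsSmoothForm.contDiffAt_localRep {Ω : DForm E M n k} (hΩ : IsSmoothForm Ω) {x₀ : M} {y : E}
    (hy : y ∈ (extChartAt 𝓘(ℝ, E) x₀).target) : ContDiffAt ℝ ∞ (localRep Ω x₀) y :=
  (hΩ x₀).contDiffAt ((isOpen_extChartAt_target x₀).mem_nhds hy)

variable [IsManifold 𝓘(ℝ, E) ∞ M]

theorem contMDiffAt_extChartAt_symm {x₀ : M} {y : E} (hy : y ∈ (extChartAt 𝓘(ℝ, E) x₀).target) :
    ContMDiffAt 𝓘(ℝ, E) 𝓘(ℝ, E) ∞ (extChartAt 𝓘(ℝ, E) x₀).symm y :=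
  (contMDiffOn_extChartAt_symm x₀).contMDiffAt ((isOpen_extChartAt_target x₀).mem_nhds hy)

theorem contMDiffAt_extChartAt_of_mem_source {x₀ x : M} (hx : x ∈ (extChartAt 𝓘(ℝ, E) x₀).source) :
    ContMDiffAt 𝓘(ℝ, E) 𝓘(ℝ, E) ∞ (extChartAt 𝓘(ℝ, E) x₀) x :=
  contMDiffAt_extChartAt' (by simpa using hx)

/-- Inserting a chart and its inverse into `f` reduces pullbacks from a manifold to pullbacks
between vector spaces, where the rules for `extDeriv` apply. -/
theorem pullbackForm_eq_localRep (Ω : DForm E M n k) {f : E' → M} {x₀ : M} {z : E'}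
    (hf : MDifferentiableAt 𝓘(ℝ, E') 𝓘(ℝ, E) f z) (hz : f z ∈ (extChartAt 𝓘(ℝ, E) x₀).source) :
    pullE f Ω z =
      (localRep Ω x₀ (extChartAt 𝓘(ℝ, E) x₀ (f z))).compContinuousLinearMap
        (fderiv ℝ (fun z => extChartAt 𝓘(ℝ, E) x₀ (f z)) z) := by
  set φ := extChartAt 𝓘(ℝ, E) x₀ with hφ
  have hinv : φ.symm (φ (f z)) = f z := φ.left_inv hz
  have hu : MDifferentiableAt 𝓘(ℝ, E') 𝓘(ℝ, E) (fun z => φ (f z)) z :=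
    ((contMDiffAt_extChartAt_of_mem_source hz).mdifferentiableAt (by simp)).comp z hf
  have hs : MDifferentiableAt 𝓘(ℝ, E) 𝓘(ℝ, E) φ.symm (φ (f z)) :=
    (contMDiffAt_extChartAt_symm (φ.map_source hz)).mdifferentiableAt (by simp)
  have heq : f =ᶠ[𝓝 z] fun z => φ.symm (φ (f z)) := by
    filter_upwards [hf.continuousAt ((isOpen_extChartAt_source x₀).mem_nhds hz)] with z' hz'
    exact (φ.left_inv hz').symm
  have hd : mfderiv 𝓘(ℝ, E') 𝓘(ℝ, E) f z =
      (mfderiv 𝓘(ℝ, E) 𝓘(ℝ, E) φ.symm (φ (f z))).comp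
        (mfderiv 𝓘(ℝ, E') 𝓘(ℝ, E) (fun z => φ (f z)) z) := by
    rw [heq.mfderiv_eq]
    exact mfderiv_comp z hs hu
  have hd' : ∀ v : E', (mfderiv 𝓘(ℝ, E') 𝓘(ℝ, E) f z v : E) =
      (mfderiv 𝓘(ℝ, E) 𝓘(ℝ, E) φ.symm (φ (f z)) (fderiv ℝ (fun z => φ (f z)) z v) : E) := by
    intro v
    have := DFunLike.congr_fun hd v
    rw [mfderiv_eq_fderiv] at this
    exact this
  ext1 v
  show (Ω (f z) : E [⋀^Fin n]→L[ℝ] (Fin k → ℝ)) (fun i => mfderiv 𝓘(ℝ, E') 𝓘(ℝ, E) f z (v i)) =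
    (Ω (φ.symm (φ (f z))) : E [⋀^Fin n]→L[ℝ] (Fin k → ℝ)) (fun i =>
      mfderiv 𝓘(ℝ, E) 𝓘(ℝ, E) φ.symm (φ (f z)) (fderiv ℝ (fun z => φ (f z)) z (v i)))
  refine Eq.trans ?_ (form_congr_point Ω hinv _).symm
  exact congrArg (Ω (f z)) (funext fun i => hd' (v i))

theorem pullbackForm_eventuallyEq (Ω : DForm E M n k) {f : E' → M} {y : E'}
    (hf : ContMDiffAt 𝓘(ℝ, E') 𝓘(ℝ, E) ∞ f y) :
    (pullE f Ω) =ᶠ[𝓝 y] fun z =>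
      (localRep Ω (f y) (extChartAt 𝓘(ℝ, E) (f y) (f z))).compContinuousLinearMap
        (fderiv ℝ (fun z => extChartAt 𝓘(ℝ, E) (f y) (f z)) z) := by
  filter_upwards [hf.continuousAt (extChartAt_source_mem_nhds (I := 𝓘(ℝ, E)) (f y)),
    (contMDiffAt_iff_contMDiffAt_nhds (by simp)).1 (hf.of_le (m := 1) (by simp))] with z h1 h2
  exact pullbackForm_eq_localRep Ω (h2.mdifferentiableAt (by simp)) h1

theorem contDiffAt_extChartAt_comp {f : E' → M} {y : E'}
    (hf : ContMDiffAt 𝓘(ℝ, E') 𝓘(ℝ, E) ∞ f y) :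
    ContDiffAt ℝ ∞ (fun z => extChartAt 𝓘(ℝ, E) (f y) (f z)) y :=
  ((contMDiffAt_extChartAt_of_mem_source (mem_extChartAt_source (f y))).comp y hf).contDiffAt

/-- The pullback of a smooth form by a smooth map from a vector space is smooth. -/
theorem IsSmoothForm.contDiffAt_pullbackForm {Ω : DForm E M n k} (hΩ : IsSmoothForm Ω)
    {f : E' → M} {y : E'} (hf : ContMDiffAt 𝓘(ℝ, E') 𝓘(ℝ, E) ∞ f y) :
    ContDiffAt ℝ ∞ (pullE f Ω) y := by
  have hu := contDiffAt_extChartAt_comp hf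
  refine ContDiffAt.congr_of_eventuallyEq ?_ (pullbackForm_eventuallyEq Ω hf)
  refine contDiffAt_compContinuousLinearMap ?_ (hu.fderiv_right (by simp))
  exact ContDiffAt.comp y (hΩ.contDiffAt_localRep (mem_extChartAt_target (f y))) hu

/-- The exterior derivative commutes with pullbacks. -/
theorem IsSmoothForm.extDeriv_pullbackForm {Ω : DForm E M n k} (hΩ : IsSmoothForm Ω)
    {f : E' → M} {y : E'} (hf : ContMDiffAt 𝓘(ℝ, E') 𝓘(ℝ, E) ∞ f y) :
    extDeriv (pullE f Ω) y =
      pullE f (dExt Ω) y := by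
  have hu := contDiffAt_extChartAt_comp hf
  rw [(pullbackForm_eventuallyEq Ω hf).extDeriv_eq,
    extDeriv_pullback (f := fun z => extChartAt 𝓘(ℝ, E) (f y) (f z))
      ((hΩ.contDiffAt_localRep (mem_extChartAt_target (f y))).differentiableAt (by simp)) hu
      minSmoothness_two_le_infty]
  have hd : mfderiv 𝓘(ℝ, E') 𝓘(ℝ, E) (fun z => extChartAt 𝓘(ℝ, E) (f y) (f z)) y =
      (mfderiv 𝓘(ℝ, E) 𝓘(ℝ, E) (extChartAt 𝓘(ℝ, E) (f y)) (f y)).comp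
        (mfderiv 𝓘(ℝ, E') 𝓘(ℝ, E) f y) :=
    mfderiv_comp y ((contMDiffAt_extChartAt_of_mem_source
      (mem_extChartAt_source (f y))).mdifferentiableAt (by simp)) (hf.mdifferentiableAt (by simp))
  rw [mfderiv_eq_fderiv] at hd
  ext1 v
  show extDeriv (localRep Ω (f y)) (extChartAt 𝓘(ℝ, E) (f y) (f y))
    (fun i => fderiv ℝ (fun z => extChartAt 𝓘(ℝ, E) (f y) (f z)) y (v i)) =
    extDeriv (localRep Ω (f y)) (extChartAt 𝓘(ℝ, E) (f y) (f y))
    (fun i => mfderiv 𝓘(ℝ, E) 𝓘(ℝ, E) (extChartAt 𝓘(ℝ, E) (f y)) (f y)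
      (mfderiv 𝓘(ℝ, E') 𝓘(ℝ, E) f y (v i)))
  congr 1
  funext i
  exact DFunLike.congr_fun hd (v i)

/-- Naturality of `d` for the inverse chart. It frees `dExt` from its definition, which uses a
different chart at each point: one fixed chart computes it on its whole domain. -/
theorem IsSmoothForm.localRep_dExt {Ω : DForm E M n k} (hΩ : IsSmoothForm Ω) {x₀ : M} {y : E}
    (hy : y ∈ (extChartAt 𝓘(ℝ, E) x₀).target) :
    localRep (dExt Ω) x₀ y = extDeriv (localRep Ω x₀) y :=
  (hΩ.extDeriv_pullbackForm (contMDiffAt_extChartAt_symm hy)).symm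

theorem IsSmoothForm.dExt {Ω : DForm E M n k} (hΩ : IsSmoothForm Ω) :
    IsSmoothForm (KContact.dExt Ω) := fun x₀ => by
  have : ContDiffOn ℝ ∞ (extDeriv (localRep Ω x₀)) (extChartAt 𝓘(ℝ, E) x₀).target :=
    fun y hy => (contDiffAt_extDeriv (hΩ.contDiffAt_localRep hy) (by simp)).contDiffWithinAt
  exact this.congr fun y hy => hΩ.localRep_dExt hy

theorem IsSmoothForm.dExt_dExt {Ω : DForm E M n k} (hΩ : IsSmoothForm Ω) :
    KContact.dExt (KContact.dExt Ω) = 0 := by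
  funext x
  have hx := mem_extChartAt_target (I := 𝓘(ℝ, E)) x
  have h : localRep (KContact.dExt Ω) x =ᶠ[𝓝 (extChartAt 𝓘(ℝ, E) x x)]
      extDeriv (localRep Ω x) := by
    filter_upwards [(isOpen_extChartAt_target x).mem_nhds hx] with y hy
    exact hΩ.localRep_dExt hy
  have h0 : extDeriv (localRep (KContact.dExt Ω) x) (extChartAt 𝓘(ℝ, E) x x) = 0 := by
    rw [h.extDeriv_eq]
    exact extDeriv_extDeriv_apply (hΩ.contDiffAt_localRep hx) minSmoothness_two_le_infty
  ext1 v
  show extDeriv (localRep (KContact.dExt Ω) x) (extChartAt 𝓘(ℝ, E) x x) _ = 0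
  rw [h0]; rfl

end FormCalculus

/-! ### Linear algebra of the pair `(η, dη)` -/

section ReebLinear

variable {E : Type*} [NormedAddCommGroup E] [NormedSpace ℝ E]
  {W : Type*} [NormedAddCommGroup W] [NormedSpace ℝ W]

/-- A one-form as a continuous linear map. -/
noncomputable def oneFormL : (E [⋀^Fin 1]→L[ℝ] W) →L[ℝ] E →L[ℝ] W :=
  (ContinuousAlternatingMap.ofSubsingletonLIE (𝕜 := ℝ) (E := E) (F := W)
    (0 : Fin 1)).symm.toContinuousLinearEquiv.toContinuousLinearMap

theorem oneFormL_apply (f : E [⋀^Fin 1]→L[ℝ] W) (v : E) : oneFormL f v = f ![v] := by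
  have : f = ContinuousAlternatingMap.ofSubsingletonLIE (𝕜 := ℝ) (E := E) (F := W) (0 : Fin 1) (oneFormL f) := by
    simp [oneFormL]
  conv_rhs => rw [this]
  rfl

/-- A two-form as a continuous bilinear map. -/
noncomputable def twoFormL : (E [⋀^Fin 2]→L[ℝ] W) →L[ℝ] E →L[ℝ] E →L[ℝ] W :=
  (ContinuousLinearMap.compL ℝ E (E [⋀^Fin 1]→L[ℝ] W) (E →L[ℝ] W) oneFormL).comp
    (ContinuousAlternatingMap.curryLeftLI (n := 1)).toContinuousLinearMap

theorem twoFormL_apply (f : E [⋀^Fin 2]→L[ℝ] W) (v w : E) : twoFormL f v w = f ![v, w] := by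
  show oneFormL (f.curryLeft v) w = _
  rw [oneFormL_apply]
  rfl

theorem map_vec_swap (f : E [⋀^Fin 2]→L[ℝ] W) (v w : E) : f ![v, w] = - f ![w, v] := by
  have h := f.toAlternatingMap.map_swap ![w, v] (i := 0) (j := 1) (by simp)
  have e : ![w, v] ∘ Equiv.swap (0 : Fin 2) 1 = ![v, w] := by
    funext i; fin_cases i <;> simp
  rw [e] at h
  exact h

variable [FiniteDimensional ℝ E] [FiniteDimensional ℝ W]

/-- Vectors determined by the values of a one-form and a two-form depend smoothly on these. -/
theorem contDiffAt_of_apply_eq {a : E → E [⋀^Fin 1]→L[ℝ] W} {b : E → E [⋀^Fin 2]→L[ℝ] W}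
    {x : E} {m : WithTop ℕ∞} (ha : ContDiffAt ℝ m a x) (hb : ContDiffAt ℝ m b x)
    (hinj : ∀ v, a x ![v] = 0 → (∀ v', b x ![v, v'] = 0) → v = 0) {r : E → E} {w : W}
    (h₁ : ∀ᶠ y in 𝓝 x, a y ![r y] = w) (h₂ : ∀ᶠ y in 𝓝 x, ∀ v, b y ![r y, v] = 0) :
    ContDiffAt ℝ m r x := by
  let T : E → E →L[ℝ] W × (E →L[ℝ] W) := fun y => (oneFormL (a y)).prod (twoFormL (b y))
  have hT : ∀ y v, T y v = (a y ![v], twoFormL (b y) v) := fun y v => by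
    simp [T, oneFormL_apply]
  have hTx : LinearMap.ker (T x : E →ₗ[ℝ] W × (E →L[ℝ] W)) = ⊥ := by
    rw [LinearMap.ker_eq_bot']
    intro v hv
    have hv' : T x v = 0 := hv
    rw [hT, Prod.mk_eq_zero] at hv'
    refine hinj v hv'.1 fun v' => ?_
    rw [← twoFormL_apply, hv'.2]; rfl
  -- A left inverse `L` of the injective map `T x` makes `L ∘ T y` invertible for `y` near `x`. Then
  -- `r y = (L ∘ T y)⁻¹ (L (w, 0))`, which is smooth because inversion is.
  obtain ⟨L₀, hL₀⟩ := LinearMap.exists_leftInverse_of_injective _ hTx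
  let L : W × (E →L[ℝ] W) →L[ℝ] E := LinearMap.toContinuousLinearMap L₀
  have hB : ContDiffAt ℝ m (fun y => L.comp (T y)) x := by
    have hTs : ContDiffAt ℝ m T x := by
      have h1 : ContDiffAt ℝ m (fun y => oneFormL (a y)) x :=
        ContDiffAt.comp (g := oneFormL) x (ContinuousLinearMap.contDiff _).contDiffAt ha
      have h2 : ContDiffAt ℝ m (fun y => twoFormL (b y)) x :=
        ContDiffAt.comp (g := twoFormL) x (ContinuousLinearMap.contDiff _).contDiffAt hb
      exact ContDiffAt.comp
        (g := (ContinuousLinearMap.prodₗᵢ ℝ :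
          (E →L[ℝ] W) × (E →L[ℝ] E →L[ℝ] W) ≃ₗᵢ[ℝ] E →L[ℝ] W × (E →L[ℝ] W)))
        x (LinearIsometryEquiv.contDiff _).contDiffAt (h1.prodMk h2)
    exact contDiffAt_const.clm_comp hTs
  have hBx : L.comp (T x) = (ContinuousLinearEquiv.refl ℝ E : E →L[ℝ] E) := by
    ext v
    exact DFunLike.congr_fun hL₀ v
  have hinv : ContDiffAt ℝ m (fun y => (L.comp (T y)).inverse (L (w, 0))) x := by
    refine ContDiffAt.clm_apply ?_ contDiffAt_const
    refine ContDiffAt.comp (g := ContinuousLinearMap.inverse) x ?_ hB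
    rw [hBx]
    exact contDiffAt_map_inverse _
  refine hinv.congr_of_eventuallyEq ?_
  have hopen : ∀ᶠ y in 𝓝 x, (L.comp (T y)).IsInvertible := by
    have := ContinuousLinearEquiv.nhds (ContinuousLinearEquiv.refl ℝ E)
    rw [← hBx] at this
    filter_upwards [hB.continuousAt this] with y hy
    exact hy
  filter_upwards [hopen, h₁, h₂] with y h3 h4 h5
  have h6 : T y (r y) = (w, 0) := by
    rw [hT, h4]
    congr 1
    ext1 v
    rw [twoFormL_apply, h5]; rfl
  have h7 : L (w, 0) = L.comp (T y) (r y) := by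
    rw [ContinuousLinearMap.comp_apply, h6]
  obtain ⟨e, he⟩ := h3
  rw [h7, ← he]
  simp

end ReebLinear

/-! ### Differentials as linear maps between the model spaces -/

section PlainDerivative

variable (E : Type*) [NormedAddCommGroup E] [NormedSpace ℝ E]
  {M : Type*} [TopologicalSpace M] [ChartedSpace E M]
  (E' : Type*) [NormedAddCommGroup E'] [NormedSpace ℝ E']
  {N : Type*} [TopologicalSpace N] [ChartedSpace E' N]
  {E'' : Type*} [NormedAddCommGroup E''] [NormedSpace ℝ E'']
  {P : Type*} [TopologicalSpace P] [ChartedSpace E'' P]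

/-- The differential of a map between manifolds, as a linear map between the model spaces. -/
noncomputable def mfd (f : M → N) (x : M) : E →L[ℝ] E' := mfderiv 𝓘(ℝ, E) 𝓘(ℝ, E') f x

variable {E E'}

theorem mfd_comp {g : N → P} {f : M → N} {x : M}
    (hg : MDifferentiableAt 𝓘(ℝ, E') 𝓘(ℝ, E'') g (f x))
    (hf : MDifferentiableAt 𝓘(ℝ, E) 𝓘(ℝ, E') f x) :
    mfd E E'' (fun z => g (f z)) x = (mfd E' E'' g (f x)).comp (mfd E E' f x) :=
  mfderiv_comp x hg hf

theorem mfd_comp_apply {g : N → P} {f : M → N} {x : M}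
    (hg : MDifferentiableAt 𝓘(ℝ, E') 𝓘(ℝ, E'') g (f x))
    (hf : MDifferentiableAt 𝓘(ℝ, E) 𝓘(ℝ, E') f x) (v : E) :
    mfd E E'' (fun z => g (f z)) x v = mfd E' E'' g (f x) (mfd E E' f x v) := by
  rw [mfd_comp hg hf]; rfl

theorem mfd_eq_fderiv {f : E → E'} {x : E} : mfd E E' f x = fderiv ℝ f x := mfderiv_eq_fderiv

theorem mfd_congr {f g : M → N} {x : M} (h : f =ᶠ[𝓝 x] g) : mfd E E' f x = mfd E E' g x := h.mfderiv_eq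

theorem mfd_id {x : M} : mfd E E (fun z : M => z) x = ContinuousLinearMap.id ℝ E := mfderiv_id

end PlainDerivative

/-! ### Vector fields in charts -/

section Hat

variable {E : Type*} [NormedAddCommGroup E] [NormedSpace ℝ E]
  {M : Type*} [TopologicalSpace M] [ChartedSpace E M]

/-- The coordinate expression of a vector field in the preferred chart at `x₀`. -/
noncomputable def hat (Y : VField E M) (x₀ : M) (y : E) : E :=
  (mfd E E (extChartAt 𝓘(ℝ, E) x₀).symm y).inverse (Y ((extChartAt 𝓘(ℝ, E) x₀).symm y))

variable [IsManifold 𝓘(ℝ, E) ∞ M]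

theorem isInvertible_mfd_extChartAt_symm {x₀ : M} {y : E}
    (hy : y ∈ (extChartAt 𝓘(ℝ, E) x₀).target) :
    (mfd E E (extChartAt 𝓘(ℝ, E) x₀).symm y).IsInvertible := by
  have : IsManifold 𝓘(ℝ, E) 1 M := IsManifold.of_le (n := ∞) (by simp)
  have := isInvertible_mfderivWithin_extChartAt_symm (I := 𝓘(ℝ, E)) hy
  rwa [modelWithCornersSelf_coe, range_id, mfderivWithin_univ] at this

theorem mfd_extChartAt_symm_hat (Y : VField E M) {x₀ : M} {y : E}
    (hy : y ∈ (extChartAt 𝓘(ℝ, E) x₀).target) :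
    mfd E E (extChartAt 𝓘(ℝ, E) x₀).symm y (hat Y x₀ y) =
      Y ((extChartAt 𝓘(ℝ, E) x₀).symm y) := by
  obtain ⟨e, he⟩ := isInvertible_mfd_extChartAt_symm hy
  rw [hat, ← he, ContinuousLinearMap.inverse_equiv]
  exact e.apply_symm_apply _

theorem mfd_extChartAt_mfd_symm {x₀ : M} {y : E}
    (hy : y ∈ (extChartAt 𝓘(ℝ, E) x₀).target) (v : E) :
    mfd E E (extChartAt 𝓘(ℝ, E) x₀) ((extChartAt 𝓘(ℝ, E) x₀).symm y)
      (mfd E E (extChartAt 𝓘(ℝ, E) x₀).symm y v) = v := by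
  have : IsManifold 𝓘(ℝ, E) 1 M := IsManifold.of_le (n := ∞) (by simp)
  have := mfderiv_extChartAt_comp_mfderivWithin_extChartAt_symm (I := 𝓘(ℝ, E)) hy
  rw [modelWithCornersSelf_coe, range_id, mfderivWithin_univ] at this
  exact DFunLike.congr_fun this v

theorem mfd_symm_mfd_extChartAt {x₀ x : M} (hx : x ∈ (extChartAt 𝓘(ℝ, E) x₀).source) (v : E) :
    mfd E E (extChartAt 𝓘(ℝ, E) x₀).symm (extChartAt 𝓘(ℝ, E) x₀ x)
      (mfd E E (extChartAt 𝓘(ℝ, E) x₀) x v) = v := by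
  have : IsManifold 𝓘(ℝ, E) 1 M := IsManifold.of_le (n := ∞) (by simp)
  have := mfderivWithin_extChartAt_symm_comp_mfderiv_extChartAt' (I := 𝓘(ℝ, E)) hx
  rw [modelWithCornersSelf_coe, range_id, mfderivWithin_univ] at this
  exact DFunLike.congr_fun this v

theorem mfd_extChartAt_self (x : M) :
    mfd E E (extChartAt 𝓘(ℝ, E) x) x = ContinuousLinearMap.id ℝ E := by
  have : IsManifold 𝓘(ℝ, E) 1 M := IsManifold.of_le (n := ∞) (by simp)
  exact mfderiv_extChartAt_self

theorem mfd_extChartAt_apply_eq_hat (Y : VField E M) {x₀ x : M}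
    (hx : x ∈ (extChartAt 𝓘(ℝ, E) x₀).source) :
    mfd E E (extChartAt 𝓘(ℝ, E) x₀) x (Y x : E) = hat Y x₀ (extChartAt 𝓘(ℝ, E) x₀ x) := by
  have h := mfd_extChartAt_symm_hat Y ((extChartAt 𝓘(ℝ, E) x₀).map_source hx)
  have h' := mfd_extChartAt_mfd_symm ((extChartAt 𝓘(ℝ, E) x₀).map_source hx)
    (hat Y x₀ (extChartAt 𝓘(ℝ, E) x₀ x))
  rw [h, (extChartAt 𝓘(ℝ, E) x₀).left_inv hx] at h'
  exact h'

/-- The trivialization of the tangent bundle at `x₀` is the differential of the preferred chart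
there, so it reads the section `Y` as `hat Y x₀`. -/
theorem contMDiffAt_vfield_iff {Y : VField E M} {x₀ : M} {m : WithTop ℕ∞} :
    ContMDiffAt 𝓘(ℝ, E) 𝓘(ℝ, E).tangent m
      (fun x => (⟨x, Y x⟩ : TangentBundle 𝓘(ℝ, E) M)) x₀ ↔
    ContMDiffAt 𝓘(ℝ, E) 𝓘(ℝ, E) m (fun x => hat Y x₀ (extChartAt 𝓘(ℝ, E) x₀ x)) x₀ := by
  have : IsManifold 𝓘(ℝ, E) 1 M := IsManifold.of_le (n := ∞) (by simp)
  refine (Bundle.contMDiffAt_section (IB := 𝓘(ℝ, E)) (F := E)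
    (E := fun x : M => TangentSpace 𝓘(ℝ, E) x) (s := Y) x₀).trans ?_
  refine Filter.EventuallyEq.contMDiffAt_iff ?_
  filter_upwards [extChartAt_source_mem_nhds (I := 𝓘(ℝ, E)) x₀] with x hx
  have hx' : x ∈ (chartAt E x₀).source := by simpa using hx
  have h := TangentBundle.continuousLinearMapAt_trivializationAt (I := 𝓘(ℝ, E)) hx'
  have h2 := mfd_extChartAt_apply_eq_hat Y hx
  refine Eq.trans ?_ ((DFunLike.congr_fun h (Y x)).trans h2)
  have hb : x ∈ (trivializationAt E (TangentSpace 𝓘(ℝ, E)) x₀).baseSet := by simpa using hx'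
  exact (congrFun (Bundle.Trivialization.coe_linearMapAt_of_mem (R := ℝ) _ hb) (Y x)).symm

theorem IsSmoothVF.contDiffAt_hat [CompleteSpace E] {Y : VField E M} (hY : IsSmoothVF Y) {x₀ : M}
    {y : E} (hy : y ∈ (extChartAt 𝓘(ℝ, E) x₀).target) : ContDiffAt ℝ ∞ (hat Y x₀) y := by
  have : IsManifold 𝓘(ℝ, E) (∞ + 1) M := by simpa
  have h := ContMDiffAt.mpullback_vectorField_preimage (m := ∞) (n := ∞) (I := 𝓘(ℝ, E))
    (I' := 𝓘(ℝ, E)) (f := (extChartAt 𝓘(ℝ, E) x₀).symm) (V := Y) (x₀ := y)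
    (hY _) (contMDiffAt_extChartAt_symm hy)
    (isInvertible_mfd_extChartAt_symm (E := E) hy) (by simp)
  exact contMDiffAt_vectorSpace_iff_contDiffAt.1 h

/-- The manifold bracket is the bracket in the chart, pulled back by the differential of the chart;
at the centre of the preferred chart this differential is the identity. -/
theorem mlieBracket_eq_lieBracket_hat (Y Z : VField E M) (x : M) :
    VectorField.mlieBracket 𝓘(ℝ, E) Y Z x =
      VectorField.lieBracket ℝ (hat Y x) (hat Z x) (extChartAt 𝓘(ℝ, E) x x) := by
  rw [← VectorField.mlieBracketWithin_univ, VectorField.mlieBracketWithin_apply]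
  simp only [modelWithCornersSelf_coe, range_id, preimage_univ, inter_univ,
    VectorField.mpullbackWithin_univ]
  have h : ∀ v, (mfd E E (extChartAt 𝓘(ℝ, E) x) x).inverse v = v := fun v => by
    rw [mfd_extChartAt_self, ContinuousLinearMap.inverse_id]; rfl
  refine (h _).trans ?_
  exact congrFun VectorField.lieBracketWithin_univ _

end Hat

/-! ### The Reeb vector fields: existence, smoothness, integrability -/

section Reeb

variable {E : Type*} [NormedAddCommGroup E] [NormedSpace ℝ E]
  {M : Type*} [TopologicalSpace M] [ChartedSpace E M] {n k : ℕ}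

/-- The value of a form at a point, as an alternating map on the model space. -/
def formAt (Ω : DForm E M n k) (x : M) : E [⋀^Fin n]→L[ℝ] (Fin k → ℝ) := Ω x

theorem localRep_apply_one (η : DForm E M 1 k) (x₀ : M) (y v : E) :
    localRep η x₀ y ![v] = formAt η ((extChartAt 𝓘(ℝ, E) x₀).symm y)
      ![mfd E E (extChartAt 𝓘(ℝ, E) x₀).symm y v] := by
  show formAt η _ (fun i => mfd E E (extChartAt 𝓘(ℝ, E) x₀).symm y (![v] i)) = _
  congr 1
  funext i; fin_cases i; rfl

theorem localRep_apply_two (Ω : DForm E M 2 k) (x₀ : M) (y v v' : E) :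
    localRep Ω x₀ y ![v, v'] = formAt Ω ((extChartAt 𝓘(ℝ, E) x₀).symm y)
      ![mfd E E (extChartAt 𝓘(ℝ, E) x₀).symm y v,
        mfd E E (extChartAt 𝓘(ℝ, E) x₀).symm y v'] := by
  show formAt Ω _ (fun i => mfd E E (extChartAt 𝓘(ℝ, E) x₀).symm y (![v, v'] i)) = _
  congr 1
  funext i; fin_cases i <;> rfl

theorem mem_kerForm_one {η : DForm E M 1 k} {x : M} {v : E} :
    v ∈ kerForm η x ↔ formAt η x ![v] = 0 := by
  constructor
  · intro h
    have := h ![]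
    exact this
  · intro h w
    rw [Subsingleton.elim w ![]]
    exact h

theorem mem_kerForm_two {Ω : DForm E M 2 k} {x : M} {v : E} :
    v ∈ kerForm Ω x ↔ ∀ v' : E, formAt Ω x ![v, v'] = 0 := by
  constructor
  · intro h v'
    have := h ![v']
    exact this
  · intro h w
    have : w = ![w 0] := by funext i; fin_cases i; rfl
    rw [this]
    exact h (w 0)

theorem IsKContactForm.eq_zero {η : DForm E M 1 k} (hη : IsKContactForm η) {x : M} {v : E}
    (h₁ : formAt η x ![v] = 0) (h₂ : ∀ v', formAt (dExt η) x ![v, v'] = 0) : v = 0 := by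
  have h := hη.inf_eq_bot x
  have hv : v ∈ kerForm η x ⊓ kerForm (dExt η) x := ⟨mem_kerForm_one.2 h₁, mem_kerForm_two.2 h₂⟩
  rw [h] at hv
  exact hv

/-- On `ker dη` the form `η` is injective, as the two kernels meet in zero, and both `ker dη` and
`ℝ^k` have dimension `k`. The map `r` is the inverse of this isomorphism. -/
theorem IsKContactForm.exists_reeb {η : DForm E M 1 k} (hη : IsKContactForm η) (x : M) :
    ∃ r : (Fin k → ℝ) →L[ℝ] E, ∀ w, formAt η x ![r w] = w ∧
      ∀ v, formAt (dExt η) x ![r w, v] = 0 := by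
  let S : Submodule ℝ E := kerForm (dExt η) x
  let T : S →ₗ[ℝ] (Fin k → ℝ) := (oneFormL (formAt η x)).toLinearMap.domRestrict S
  have hT : Function.Injective T := by
    rw [← LinearMap.ker_eq_bot, LinearMap.ker_eq_bot']
    intro v hv
    have hv1 : oneFormL (formAt η x) (v : E) = 0 := hv
    rw [oneFormL_apply] at hv1
    exact Subtype.ext (hη.eq_zero hv1 (mem_kerForm_two.1 v.2))
  have hfr : Module.finrank ℝ S = Module.finrank ℝ (Fin k → ℝ) := by
    rw [Module.finrank_fin_fun]
    exact hη.rank_ker_d x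
  let e := LinearEquiv.ofInjectiveOfFinrankEq T hT hfr
  refine ⟨LinearMap.toContinuousLinearMap (S.subtype ∘ₗ e.symm.toLinearMap), fun w => ⟨?_, ?_⟩⟩
  · rw [← oneFormL_apply]
    have : T (e.symm w) = w := e.apply_symm_apply w
    exact this
  · exact mem_kerForm_two.1 (e.symm w).2

/-- The tangent vector `∑ w_α R_α(x)`, as a function of `w`. -/
noncomputable def IsKContactForm.reeb {η : DForm E M 1 k} (hη : IsKContactForm η) (x : M) :
    (Fin k → ℝ) →L[ℝ] E := (hη.exists_reeb x).choose

variable {η : DForm E M 1 k} (hη : IsKContactForm η)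
include hη

theorem IsKContactForm.apply_reeb (x : M) (w : Fin k → ℝ) : formAt η x ![hη.reeb x w] = w :=
  ((hη.exists_reeb x).choose_spec w).1

theorem IsKContactForm.dExt_reeb (x : M) (w : Fin k → ℝ) (v : E) :
    formAt (dExt η) x ![hη.reeb x w, v] = 0 :=
  ((hη.exists_reeb x).choose_spec w).2 v

/-- Both sides lie in `ker dη` and have the same value under `η`. Thus `η` gives the coefficients of
a vector of the Reeb distribution. -/
theorem IsKContactForm.eq_reeb {x : M} {v : E} (h : ∀ v', formAt (dExt η) x ![v, v'] = 0) :
    v = hη.reeb x (formAt η x ![v]) := by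
  rw [← sub_eq_zero]
  refine hη.eq_zero (x := x) ?_ fun v' => ?_
  · rw [← oneFormL_apply, map_sub, oneFormL_apply, oneFormL_apply, hη.apply_reeb, sub_self]
  · rw [← twoFormL_apply, map_sub, sub_apply, twoFormL_apply, twoFormL_apply,
      hη.dExt_reeb, h, sub_self]

theorem IsKContactForm.eq_zero_localRep [IsManifold 𝓘(ℝ, E) ∞ M] {x₀ : M} {y : E}
    (hy : y ∈ (extChartAt 𝓘(ℝ, E) x₀).target) {v : E}
    (h₁ : localRep η x₀ y ![v] = 0) (h₂ : ∀ v', localRep (dExt η) x₀ y ![v, v'] = 0) : v = 0 := by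
  rw [localRep_apply_one] at h₁
  have h3 : mfd E E (extChartAt 𝓘(ℝ, E) x₀).symm y v = 0 := by
    refine hη.eq_zero h₁ fun v' => ?_
    have := h₂ (mfd E E (extChartAt 𝓘(ℝ, E) x₀) ((extChartAt 𝓘(ℝ, E) x₀).symm y) v')
    rw [localRep_apply_two] at this
    have h4 := mfd_symm_mfd_extChartAt ((extChartAt 𝓘(ℝ, E) x₀).map_target hy) v'
    rw [(extChartAt 𝓘(ℝ, E) x₀).right_inv hy] at h4
    rwa [h4] at this
  have := mfd_extChartAt_mfd_symm hy v
  rw [h3, map_zero] at this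
  exact this.symm

/-- The coordinate expression of `w ↦ ∑ w_α R_α` in the preferred chart at `x₀`. -/
noncomputable def IsKContactForm.reebHat (x₀ : M) (y : E) : (Fin k → ℝ) →L[ℝ] E :=
  (mfd E E (extChartAt 𝓘(ℝ, E) x₀).symm y).inverse.comp
    (hη.reeb ((extChartAt 𝓘(ℝ, E) x₀).symm y))

variable [IsManifold 𝓘(ℝ, E) ∞ M]

theorem IsKContactForm.mfd_symm_reebHat {x₀ : M} {y : E}
    (hy : y ∈ (extChartAt 𝓘(ℝ, E) x₀).target) (w : Fin k → ℝ) :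
    mfd E E (extChartAt 𝓘(ℝ, E) x₀).symm y (hη.reebHat x₀ y w) =
      hη.reeb ((extChartAt 𝓘(ℝ, E) x₀).symm y) w :=
  mfd_extChartAt_symm_hat (fun x => hη.reeb x w) hy

theorem IsKContactForm.mfd_extChartAt_reeb {x₀ x : M}
    (hx : x ∈ (extChartAt 𝓘(ℝ, E) x₀).source) (w : Fin k → ℝ) :
    mfd E E (extChartAt 𝓘(ℝ, E) x₀) x (hη.reeb x w) =
      hη.reebHat x₀ (extChartAt 𝓘(ℝ, E) x₀ x) w :=
  mfd_extChartAt_apply_eq_hat (fun x => hη.reeb x w) hx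

theorem IsKContactForm.localRep_reebHat {x₀ : M} {y : E}
    (hy : y ∈ (extChartAt 𝓘(ℝ, E) x₀).target) (w : Fin k → ℝ) :
    localRep η x₀ y ![hη.reebHat x₀ y w] = w := by
  rw [localRep_apply_one, hη.mfd_symm_reebHat hy, hη.apply_reeb]

theorem IsKContactForm.localRep_dExt_reebHat {x₀ : M} {y : E}
    (hy : y ∈ (extChartAt 𝓘(ℝ, E) x₀).target) (w : Fin k → ℝ) (v : E) :
    localRep (dExt η) x₀ y ![hη.reebHat x₀ y w, v] = 0 := by
  rw [localRep_apply_two, hη.mfd_symm_reebHat hy, hη.dExt_reeb]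

variable [FiniteDimensional ℝ E]

/-- The pointwise choice behind `reeb` is no obstacle: its values are pinned down by linear
conditions with smooth coefficients. -/
theorem IsKContactForm.contDiffAt_reebHat {x₀ : M} {y : E}
    (hy : y ∈ (extChartAt 𝓘(ℝ, E) x₀).target) : ContDiffAt ℝ ∞ (hη.reebHat x₀) y := by
  suffices ContDiffOn ℝ ∞ (hη.reebHat x₀) (extChartAt 𝓘(ℝ, E) x₀).target from
    this.contDiffAt ((isOpen_extChartAt_target x₀).mem_nhds hy)
  rw [contDiffOn_clm_apply]
  intro w y hy
  have hn : ∀ᶠ y' in 𝓝 y, y' ∈ (extChartAt 𝓘(ℝ, E) x₀).target :=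
    (isOpen_extChartAt_target x₀).mem_nhds hy
  exact (contDiffAt_of_apply_eq (hη.smooth.contDiffAt_localRep hy)
    (hη.smooth.dExt.contDiffAt_localRep hy) (fun v h₁ h₂ => hη.eq_zero_localRep hy h₁ h₂) (w := w)
    (hn.mono fun y' hy' => hη.localRep_reebHat hy' w)
    (hn.mono fun y' hy' => hη.localRep_dExt_reebHat hy' w)).contDiffWithinAt

theorem IsKContactForm.fderiv_reebHat_symm {x₀ : M} {y : E}
    (hy : y ∈ (extChartAt 𝓘(ℝ, E) x₀).target) (u w : Fin k → ℝ) :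
    fderiv ℝ (hη.reebHat x₀) y (hη.reebHat x₀ y w) u =
      fderiv ℝ (hη.reebHat x₀) y (hη.reebHat x₀ y u) w := by
  have hn : ∀ᶠ y' in 𝓝 y, y' ∈ (extChartAt 𝓘(ℝ, E) x₀).target :=
    (isOpen_extChartAt_target x₀).mem_nhds hy
  refine fderiv_symm_of_reeb ((hη.smooth.contDiffAt_localRep hy).of_le (WithTop.coe_le_coe.2 (le_top : (2 : ℕ∞) ≤ ⊤)))
    ((hη.contDiffAt_reebHat hy).differentiableAt (by simp))
    (hn.mono fun y' hy' => hη.localRep_reebHat hy') (hn.mono fun y' hy' w v => ?_)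
    (fun v h₁ h₂ => hη.eq_zero_localRep hy h₁ fun v' => ?_) u w
  · rw [← hη.smooth.localRep_dExt hy']
    exact hη.localRep_dExt_reebHat hy' w v
  · rw [hη.smooth.localRep_dExt hy]
    exact h₂ v'

theorem IsKContactForm.isSmoothVF_reeb (w : Fin k → ℝ) : IsSmoothVF (fun x => hη.reeb x w) := by
  intro x₀
  refine contMDiffAt_vfield_iff.2 ?_
  have h : ContDiffAt ℝ ∞ (hat (fun x => hη.reeb x w) x₀) (extChartAt 𝓘(ℝ, E) x₀ x₀) :=
    (hη.contDiffAt_reebHat (mem_extChartAt_target x₀)).clm_apply contDiffAt_const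
  exact h.contMDiffAt.comp x₀ (contMDiffAt_extChartAt_of_mem_source (mem_extChartAt_source x₀))

/-- This is the family to which the first-integral hypothesis on Hamiltonian functions is applied.
-/
theorem IsKContactForm.isReebFamily : IsReebFamily η fun α x => hη.reeb x (Pi.single α 1) where
  smooth _ := hη.isSmoothVF_reeb _
  apply _ x := hη.apply_reeb x _
  mem_ker _ x := (mem_kerForm_two (E := E)).2 (hη.dExt_reeb x _)

end Reeb

/-! ### Plaques: existence, uniqueness, and tangent curves -/

section Plaques

variable {E : Type*} [NormedAddCommGroup E] [NormedSpace ℝ E]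
  {M : Type*} [TopologicalSpace M] [ChartedSpace E M] {k : ℕ}
  {η : DForm E M 1 k} (hη : IsKContactForm η)

/-- `ψ` is an integral map of the Reeb distribution at `w`: its differential there is
`u ↦ ∑ u_α R_α`. -/
def IsKContactForm.PlaqueAt (ψ : (Fin k → ℝ) → M) (w : Fin k → ℝ) : Prop :=
  HasMFDerivAt 𝓘(ℝ, Fin k → ℝ) 𝓘(ℝ, E) ψ w (hη.reeb (ψ w))

include hη

/-- The equation for plaques does not involve the parameter explicitly, so a plaque can be recentred
at any of its points by translation. -/
theorem IsKContactForm.PlaqueAt.comp_add_const {ψ : (Fin k → ℝ) → M} {w a : Fin k → ℝ}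
    (h : hη.PlaqueAt ψ (w + a)) : hη.PlaqueAt (fun u => ψ (u + a)) w := by
  have h1 : HasMFDerivAt 𝓘(ℝ, Fin k → ℝ) 𝓘(ℝ, Fin k → ℝ) (fun u : Fin k → ℝ => u + a) w
      (ContinuousLinearMap.id ℝ (Fin k → ℝ)) :=
    (hasFDerivAt_id w |>.add_const a).hasMFDerivAt
  have h2 := HasMFDerivAt.comp (f := fun u : Fin k → ℝ => u + a) (g := ψ) w h h1
  exact h2

variable [IsManifold 𝓘(ℝ, E) ∞ M]

theorem IsKContactForm.PlaqueAt.hasFDerivAt {ψ : (Fin k → ℝ) → M} {w : Fin k → ℝ}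
    (h : hη.PlaqueAt ψ w) {x₀ : M} (hx : ψ w ∈ (extChartAt 𝓘(ℝ, E) x₀).source) :
    HasFDerivAt (fun u => extChartAt 𝓘(ℝ, E) x₀ (ψ u))
      (hη.reebHat x₀ (extChartAt 𝓘(ℝ, E) x₀ (ψ w))) w := by
  have h1 := ((contMDiffAt_extChartAt_of_mem_source hx).mdifferentiableAt (by simp)).hasMFDerivAt
  have h2 := HasMFDerivAt.comp w h1 h
  have h3 := hasMFDerivAt_iff_hasFDerivAt.1 h2
  refine h3.congr_fderiv ?_
  ext1 u
  exact hη.mfd_extChartAt_reeb hx u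

theorem IsKContactForm.plaqueAt_of_hasFDerivAt {ψ : (Fin k → ℝ) → E} {w : Fin k → ℝ} {x₀ : M}
    (h : HasFDerivAt ψ (hη.reebHat x₀ (ψ w)) w) (hx : ψ w ∈ (extChartAt 𝓘(ℝ, E) x₀).target) :
    hη.PlaqueAt (fun u => (extChartAt 𝓘(ℝ, E) x₀).symm (ψ u)) w := by
  have h1 := ((contMDiffAt_extChartAt_symm hx).mdifferentiableAt (by simp)).hasMFDerivAt
  have h2 := HasMFDerivAt.comp w h1 h.hasMFDerivAt
  have h3 : (mfd E E (extChartAt 𝓘(ℝ, E) x₀).symm (ψ w)).comp (hη.reebHat x₀ (ψ w)) =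
      hη.reeb ((extChartAt 𝓘(ℝ, E) x₀).symm (ψ w)) := by
    ext1 u
    exact hη.mfd_symm_reebHat hx u
  show HasMFDerivAt _ _ _ _ (hη.reeb ((extChartAt 𝓘(ℝ, E) x₀).symm (ψ w)))
  rw [← h3]
  exact h2

variable [FiniteDimensional ℝ E]

theorem IsKContactForm.exists_plaque (x₀ : M) :
    ∃ r > 0, ∃ ψ : (Fin k → ℝ) → M, ψ 0 = x₀ ∧ ∀ w ∈ ball 0 r, hη.PlaqueAt ψ w := by
  have hx := mem_extChartAt_target (I := 𝓘(ℝ, E)) x₀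
  have hn := (isOpen_extChartAt_target (I := 𝓘(ℝ, E)) x₀).mem_nhds hx
  obtain ⟨r, hr, ψ, h0, hψ⟩ := exists_total_solution
    ((hη.contDiffAt_reebHat hx).of_le (WithTop.coe_le_coe.2 (le_top : (2 : ℕ∞) ≤ ⊤)))
    (Filter.mem_of_superset hn fun y hy => hη.fderiv_reebHat_symm hy)
  have hc : ContinuousAt ψ 0 := (hψ 0 (mem_ball_self hr)).continuousAt
  obtain ⟨s, hs, hs'⟩ := Metric.mem_nhds_iff.1 (hc (h0.symm ▸ hn))
  refine ⟨min r s, lt_min hr hs, fun u => (extChartAt 𝓘(ℝ, E) x₀).symm (ψ u), ?_, fun w hw => ?_⟩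
  · show (extChartAt 𝓘(ℝ, E) x₀).symm (ψ 0) = x₀
    rw [h0]; exact extChartAt_to_inv x₀
  · exact hη.plaqueAt_of_hasFDerivAt (hψ w (ball_subset_ball (min_le_left _ _) hw))
      (hs' (ball_subset_ball (min_le_right _ _) hw))

theorem IsKContactForm.plaque_eventuallyEq {ψ₁ ψ₂ : (Fin k → ℝ) → M} {w : Fin k → ℝ}
    (h₁ : ∀ᶠ u in 𝓝 w, hη.PlaqueAt ψ₁ u) (h₂ : ∀ᶠ u in 𝓝 w, hη.PlaqueAt ψ₂ u)
    (h : ψ₁ w = ψ₂ w) : ψ₁ =ᶠ[𝓝 w] ψ₂ := by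
  set φ := extChartAt 𝓘(ℝ, E) (ψ₁ w) with hφ
  have hn := extChartAt_source_mem_nhds (I := 𝓘(ℝ, E)) (ψ₁ w)
  have e₁ : ∀ᶠ u in 𝓝 w, ψ₁ u ∈ φ.source := h₁.self_of_nhds.continuousAt hn
  have e₂ : ∀ᶠ u in 𝓝 w, ψ₂ u ∈ φ.source := h₂.self_of_nhds.continuousAt (by rwa [← h])
  have := total_solution_unique (A := hη.reebHat (ψ₁ w)) (ψ₁ := fun u => φ (ψ₁ u))
    (ψ₂ := fun u => φ (ψ₂ u)) (w₀ := w)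
    ((hη.contDiffAt_reebHat (mem_extChartAt_target (ψ₁ w))).of_le (by simp))
    (by filter_upwards [h₁, e₁] with u hu hu' using hu.hasFDerivAt hη hu')
    (by filter_upwards [h₂, e₂] with u hu hu' using hu.hasFDerivAt hη hu') (by simp [h])
  filter_upwards [this, e₁, e₂] with u hu h1 h2
  exact φ.injOn h1 h2 hu

/-- The set where the two maps agree near the point is open, nonempty, and relatively closed in `B`:
values at limit points agree because `M` is Hausdorff, and local uniqueness then applies there. -/
theorem IsKContactForm.plaque_eqOn [T2Space M] {ψ₁ ψ₂ : (Fin k → ℝ) → M} {B : Set (Fin k → ℝ)}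
    (hB : IsOpen B) (hBc : IsPreconnected B) (h₁ : ∀ w ∈ B, hη.PlaqueAt ψ₁ w)
    (h₂ : ∀ w ∈ B, hη.PlaqueAt ψ₂ w) {w : Fin k → ℝ} (hw : w ∈ B) (h : ψ₁ w = ψ₂ w) :
    EqOn ψ₁ ψ₂ B := by
  have ev : ∀ w ∈ B, ψ₁ w = ψ₂ w → ψ₁ =ᶠ[𝓝 w] ψ₂ := fun w hw h =>
    hη.plaque_eventuallyEq (Filter.mem_of_superset (hB.mem_nhds hw) h₁)
      (Filter.mem_of_superset (hB.mem_nhds hw) h₂) h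
  have := hBc.subset_of_closure_inter_subset (u := {w | ψ₁ =ᶠ[𝓝 w] ψ₂})
    isOpen_setOfPred_eventually_nhds ⟨w, hw, ev w hw h⟩ (by
      rintro u ⟨hu, huB⟩
      refine ev u huB ?_
      have : (𝓝[{w | ψ₁ =ᶠ[𝓝 w] ψ₂}] u).NeBot := mem_closure_iff_nhdsWithin_neBot.1 hu
      refine tendsto_nhds_unique (l := 𝓝[{w | ψ₁ =ᶠ[𝓝 w] ψ₂}] u) ((h₁ u huB).continuousAt.mono_left nhdsWithin_le_nhds)
        (((h₂ u huB).continuousAt.mono_left nhdsWithin_le_nhds).congr' ?_)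
      filter_upwards [self_mem_nhdsWithin] with z hz using (Filter.EventuallyEq.eq_of_nhds hz).symm)
  exact fun u hu => (this hu).eq_of_nhds

/-- A `C^1` curve tangent to `ker dη` locally factors through each plaque that it meets. -/
theorem IsKContactForm.curve_eventuallyEq_plaque {γ : ℝ → M}
    (hγ : ContMDiff 𝓘(ℝ, ℝ) 𝓘(ℝ, E) 1 γ)
    (ht : ∀ t : ℝ, mfderiv 𝓘(ℝ, ℝ) 𝓘(ℝ, E) γ t (1 : ℝ) ∈ kerForm (dExt η) (γ t))
    {ψ : (Fin k → ℝ) → M} {w₀ : Fin k → ℝ} (hψ : ∀ᶠ w in 𝓝 w₀, hη.PlaqueAt ψ w) {t₀ : ℝ}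
    (h : γ t₀ = ψ w₀) :
    ∃ q : ℝ → Fin k → ℝ, Tendsto q (𝓝 t₀) (𝓝 w₀) ∧ γ =ᶠ[𝓝 t₀] ψ ∘ q := by
  -- The coefficients of the velocity in the Reeb frame. Continuity of `c` is where `γ` being `C^1`
  -- is used; a primitive `q` of `c` is then the curve in the parameter space of the plaque.
  let c : ℝ → Fin k → ℝ := fun t => formAt η (γ t) ![mfd ℝ E γ t 1]
  have hvel : ∀ t, mfd ℝ E γ t 1 = hη.reeb (γ t) (c t) := fun t =>
    hη.eq_reeb (mem_kerForm_two.1 (ht t))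
  have hd : ∀ x₀ t, γ t ∈ (extChartAt 𝓘(ℝ, E) x₀).source →
      HasDerivAt (fun s => extChartAt 𝓘(ℝ, E) x₀ (γ s))
        (hη.reebHat x₀ (extChartAt 𝓘(ℝ, E) x₀ (γ t)) (c t)) t := by
    intro x₀ t hx
    have h1 := ((contMDiffAt_extChartAt_of_mem_source hx).mdifferentiableAt (by simp)).hasMFDerivAt
    have h2 := HasMFDerivAt.comp t h1 ((hγ t).mdifferentiableAt (by simp)).hasMFDerivAt
    have h3 : HasFDerivAt (fun s => extChartAt 𝓘(ℝ, E) x₀ (γ s))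
        ((mfd E E (extChartAt 𝓘(ℝ, E) x₀) (γ t)).comp (mfd ℝ E γ t)) t :=
      hasMFDerivAt_iff_hasFDerivAt.1 h2
    refine h3.hasDerivAt.congr_deriv ?_
    refine Eq.trans ?_ (hη.mfd_extChartAt_reeb hx (c t))
    rw [← hvel]
    rfl
  have hcc : Continuous c := by
    rw [continuous_iff_continuousAt]
    intro t
    set φ := extChartAt 𝓘(ℝ, E) (γ t) with hφ
    have hs : ∀ᶠ s in 𝓝 t, γ s ∈ φ.source :=
      (hγ t).continuousAt (extChartAt_source_mem_nhds (γ t))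
    have hy : ContDiffAt ℝ 1 (fun s => φ (γ s)) t :=
      (((contMDiffAt_extChartAt_of_mem_source (mem_extChartAt_source (γ t))).of_le
        (by simp)).comp t (hγ t)).contDiffAt
    have hdc : ContinuousAt (deriv fun s => φ (γ s)) t := by
      have : ContDiffAt ℝ 0 (fderiv ℝ fun s => φ (γ s)) t := hy.fderiv_right (by simp)
      exact this.continuousAt.clm_apply continuousAt_const
    have hl : ContinuousAt (fun s => localRep η (γ t) (φ (γ s))) t :=
      ContinuousAt.comp (g := localRep η (γ t))
        (hη.smooth.contDiffAt_localRep (mem_extChartAt_target (γ t))).continuousAt hy.continuousAt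
    have hl2 : ContinuousAt (fun s => oneFormL (localRep η (γ t) (φ (γ s)))
        (deriv (fun s => φ (γ s)) s)) t :=
      (ContinuousAt.comp (g := oneFormL) oneFormL.continuous.continuousAt hl).clm_apply hdc
    refine hl2.congr ?_
    filter_upwards [hs] with s hs
    rw [oneFormL_apply, (hd (γ t) s hs).deriv, hη.localRep_reebHat (φ.map_source hs)]
  let q : ℝ → Fin k → ℝ := fun t => w₀ + ∫ s in t₀..t, c s
  have hq : ∀ t, HasDerivAt q (c t) t := fun t =>
    (hcc.integral_hasStrictDerivAt t₀ t).hasDerivAt.const_add w₀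
  have hq0 : q t₀ = w₀ := by simp [q]
  refine ⟨q, hq0 ▸ (hq t₀).continuousAt, ?_⟩
  set φ := extChartAt 𝓘(ℝ, E) (γ t₀) with hφ
  have hn := extChartAt_source_mem_nhds (I := 𝓘(ℝ, E)) (γ t₀)
  have e₁ : ∀ᶠ t in 𝓝 t₀, γ t ∈ φ.source := (hγ t₀).continuousAt hn
  have e₂ : ∀ᶠ w in 𝓝 w₀, ψ w ∈ φ.source := hψ.self_of_nhds.continuousAt (by rwa [← h])
  have := curve_eq_total_solution (A := hη.reebHat (γ t₀)) (ψ := fun w => φ (ψ w))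
    (y := fun t => φ (γ t)) (q := q) (c := c) (t₀ := t₀)
    ((hη.contDiffAt_reebHat (mem_extChartAt_target (γ t₀))).of_le (by simp))
    (e₁.mono fun t => hd (γ t₀) t) (Eventually.of_forall hq) hcc.continuousAt
    (by
      rw [hq0]
      filter_upwards [hψ, e₂] with w hw hw'
      exact hw.hasFDerivAt hη hw') (by simp [hq0, h])
  have e₃ : ∀ᶠ t in 𝓝 t₀, ψ (q t) ∈ φ.source := (hq t₀).continuousAt (by rw [hq0]; exact e₂)
  filter_upwards [this, e₁, e₃] with t h1 h2 h3
  exact φ.injOn h2 h3 h1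

end Plaques

/-! ### A leaf is covered by countably many plaques -/

section LeafCover

variable {E : Type*} [NormedAddCommGroup E] [NormedSpace ℝ E]
  {M : Type*} [TopologicalSpace M] [ChartedSpace E M] {k : ℕ}
  {η : DForm E M 1 k} (hη : IsKContactForm η)

/-- There is a plaque centred at `c`, defined on the ball of radius `1 / (n + 1)`. -/
def IsKContactForm.HasPlaque (c : M) (n : ℕ) : Prop :=
  ∃ ψ : (Fin k → ℝ) → M, ψ 0 = c ∧ ∀ w ∈ ball 0 (1 / ((n : ℝ) + 1)), hη.PlaqueAt ψ w

open Classical in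
/-- A plaque centred at `c`, defined on the ball of radius `1 / (n + 1)` if there is one. -/
noncomputable def IsKContactForm.plaque (c : M) (n : ℕ) : (Fin k → ℝ) → M :=
  if h : hη.HasPlaque c n then h.choose else fun _ => c

/-- The point reached from `x₀` by following successively rational vectors inside plaques. -/
noncomputable def IsKContactForm.follow (x₀ : M) (l : List (ℕ × (Fin k → ℚ))) : M :=
  l.foldl (fun c a => hη.plaque c a.1 fun i => (a.2 i : ℝ)) x₀

/-- The union of the plaques centred at the points reached from `x₀` by rational moves. -/
def IsKContactForm.plaqueUnion (x₀ : M) : Set M :=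
  {y | ∃ l n, hη.HasPlaque (hη.follow x₀ l) n ∧
    ∃ w ∈ ball (0 : Fin k → ℝ) (1 / ((n : ℝ) + 1)), y = hη.plaque (hη.follow x₀ l) n w}

include hη

theorem IsKContactForm.HasPlaque.plaque_zero {c : M} {n : ℕ} (h : hη.HasPlaque c n) :
    hη.plaque c n 0 = c := by
  rw [IsKContactForm.plaque, dif_pos h]
  exact h.choose_spec.1

theorem IsKContactForm.HasPlaque.plaqueAt {c : M} {n : ℕ} (h : hη.HasPlaque c n)
    {w : Fin k → ℝ} (hw : w ∈ ball 0 (1 / ((n : ℝ) + 1))) : hη.PlaqueAt (hη.plaque c n) w := by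
  rw [IsKContactForm.plaque, dif_pos h]
  exact h.choose_spec.2 w hw

variable [IsManifold 𝓘(ℝ, E) ∞ M] [FiniteDimensional ℝ E]

theorem IsKContactForm.mem_plaqueUnion_self (x₀ : M) : x₀ ∈ hη.plaqueUnion x₀ := by
  obtain ⟨r, hr, ψ, h0, hψ⟩ := hη.exists_plaque x₀
  obtain ⟨n, hn⟩ := exists_nat_one_div_lt hr
  have h : hη.HasPlaque (hη.follow x₀ []) n :=
    ⟨ψ, h0, fun w hw => hψ w (ball_subset_ball hn.le hw)⟩
  exact ⟨[], n, h, 0, mem_ball_self (by positivity), (h.plaque_zero hη).symm⟩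

/-- Openness half of the connectedness argument: near a time at which it lies on a plaque, a tangent
curve moves inside that plaque. -/
theorem IsKContactForm.eventually_mem_plaqueUnion {x₀ : M} {γ : ℝ → M}
    (hγ : ContMDiff 𝓘(ℝ, ℝ) 𝓘(ℝ, E) 1 γ)
    (ht : ∀ t : ℝ, mfderiv 𝓘(ℝ, ℝ) 𝓘(ℝ, E) γ t (1 : ℝ) ∈ kerForm (dExt η) (γ t)) {t₀ : ℝ}
    (h : γ t₀ ∈ hη.plaqueUnion x₀) : ∀ᶠ t in 𝓝 t₀, γ t ∈ hη.plaqueUnion x₀ := by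
  obtain ⟨l, n, hc, w, hw, e⟩ := h
  obtain ⟨q, hq, hγq⟩ := hη.curve_eventuallyEq_plaque hγ ht
    (Filter.mem_of_superset (isOpen_ball.mem_nhds hw) fun u hu => hc.plaqueAt hη hu) e
  filter_upwards [hq (isOpen_ball.mem_nhds hw), hγq] with t h1 h2
  exact ⟨l, n, hc, q t, h1, h2⟩

/-- Closedness half. A plaque `ψ` around the limit point `γ t₀` overlaps one of the listed plaques.
By uniqueness the two differ by a translation near a common point, so a rational move inside the
listed plaque reaches a point close to `γ t₀` on `ψ`, and the plaque centred there contains `γ t₀`.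
-/
theorem IsKContactForm.mem_plaqueUnion_of_frequently [T2Space M] {x₀ : M} {γ : ℝ → M}
    (hγ : ContMDiff 𝓘(ℝ, ℝ) 𝓘(ℝ, E) 1 γ)
    (ht : ∀ t : ℝ, mfderiv 𝓘(ℝ, ℝ) 𝓘(ℝ, E) γ t (1 : ℝ) ∈ kerForm (dExt η) (γ t)) {t₀ : ℝ}
    (h : ∃ᶠ t in 𝓝 t₀, γ t ∈ hη.plaqueUnion x₀) : γ t₀ ∈ hη.plaqueUnion x₀ := by
  obtain ⟨r, hr, ψ, h0, hψ⟩ := hη.exists_plaque (γ t₀)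
  -- Half of `r`, so that a ball of radius `ρ` around a parameter of norm less than `ρ` still lies
  -- in the domain of `ψ`.
  obtain ⟨n, hn⟩ := exists_nat_one_div_lt (half_pos hr)
  set ρ : ℝ := 1 / ((n : ℝ) + 1) with hρ
  have hρ0 : 0 < ρ := by positivity
  obtain ⟨q, hq, hγq⟩ := hη.curve_eventuallyEq_plaque hγ ht
    (Filter.mem_of_superset (ball_mem_nhds 0 hr) hψ) h0.symm
  obtain ⟨t, ⟨l, m, hc, w, hw, e⟩, hqt, hγt⟩ :=
    (h.and_eventually ((hq.eventually_mem (ball_mem_nhds 0 (half_pos hρ0))).and hγq)).exists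
  have hqt' : ‖q t‖ < ρ / 2 := by simpa using hqt
  have hnear : ∀ᶠ u in 𝓝 w, hη.PlaqueAt (fun u => ψ (u + (q t - w))) u := by
    have hcont : ContinuousAt (fun u => u + (q t - w)) w := by fun_prop
    have : ∀ᶠ u in 𝓝 w, u + (q t - w) ∈ ball (0 : Fin k → ℝ) r := by
      refine hcont (isOpen_ball.mem_nhds ?_)
      simp only [add_sub_cancel, mem_ball, dist_zero_right]
      linarith
    filter_upwards [this] with u hu
    exact (hψ _ hu).comp_add_const hη
  have hP := hη.plaque_eventuallyEq
    (Filter.mem_of_superset (isOpen_ball.mem_nhds hw) fun u hu => hc.plaqueAt hη hu) hnear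
    (by
      show hη.plaque (hη.follow x₀ l) m w = ψ (w + (q t - w))
      rw [← e, add_sub_cancel]
      exact hγt)
  have hdense : DenseRange (fun (u : Fin k → ℚ) (i : Fin k) => (u i : ℝ)) :=
    DenseRange.piMap fun _ => Rat.denseRange_cast
  -- The rational parameter replaces `w`: it is close enough to `w` for the translated plaques to
  -- agree there and for its image in the parameters of `ψ` to have norm less than `ρ`.
  obtain ⟨_, ⟨hu1, hu2⟩, u, rfl⟩ := mem_closure_iff_nhds.1 (hdense w) _
    (Filter.inter_mem hP (ball_mem_nhds w (half_pos hρ0)))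
  set v : Fin k → ℝ := fun i => (u i : ℝ) with hv
  have hu2' : ‖v - w‖ < ρ / 2 := by simpa [dist_eq_norm] using hu2
  set a := v + (q t - w) with ha
  have han : ‖a‖ < ρ := by
    have : a = (v - w) + q t := by rw [ha]; abel
    rw [this]
    exact (norm_add_le _ _).trans_lt (by linarith)
  have hf : hη.follow x₀ (l ++ [(m, u)]) = ψ a := by
    have : hη.follow x₀ (l ++ [(m, u)]) = hη.plaque (hη.follow x₀ l) m v := by
      simp [IsKContactForm.follow, hv]
    rw [this]
    exact hu1
  have hpl : ∀ z ∈ ball (0 : Fin k → ℝ) ρ, hη.PlaqueAt (fun z => ψ (z + a)) z := fun z hz => by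
    refine (hψ _ ?_).comp_add_const hη
    have : ‖z‖ < ρ := by simpa using hz
    have := norm_add_le z a
    simp only [mem_ball, dist_zero_right]
    linarith
  have hc' : hη.HasPlaque (hη.follow x₀ (l ++ [(m, u)])) n :=
    ⟨fun z => ψ (z + a), by rw [hf]; exact congrArg ψ (zero_add a), hpl⟩
  have hm : -a ∈ ball (0 : Fin k → ℝ) ρ := by simpa using han
  -- The recentred plaque is `z ↦ ψ (z + a)`, so the parameter `-a` gives `ψ 0 = γ t₀`.
  refine ⟨l ++ [(m, u)], n, hc', -a, hm, ?_⟩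
  have := hη.plaque_eqOn isOpen_ball (convex_ball (0 : Fin k → ℝ) ρ).isPreconnected
    (fun z hz => hc'.plaqueAt hη hz) hpl (mem_ball_self hρ0)
    (by rw [hc'.plaque_zero hη, hf]; exact (congrArg ψ (zero_add a)).symm) hm
  rw [this, ← h0]
  simp

theorem IsKContactForm.plaqueUnion_of_tangentlyJoined [T2Space M] {x₀ x y : M}
    (h : TangentlyJoined η x y) : x ∈ hη.plaqueUnion x₀ ↔ y ∈ hη.plaqueUnion x₀ := by
  obtain ⟨γ, hγ, ht, rfl, rfl⟩ := h
  have hclopen : IsClopen {t | γ t ∈ hη.plaqueUnion x₀} := by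
    refine ⟨isClosed_iff_frequently.2 fun t h => hη.mem_plaqueUnion_of_frequently hγ ht h,
      isOpen_iff_eventually.2 fun t h => hη.eventually_mem_plaqueUnion hγ ht h⟩
  rcases isClopen_iff.1 hclopen with h | h
  · have h' : ∀ t, γ t ∉ hη.plaqueUnion x₀ := fun t ht => by
      have : t ∈ {t | γ t ∈ hη.plaqueUnion x₀} := ht
      rw [h] at this; exact this
    simp [h']
  · have h' : ∀ t, γ t ∈ hη.plaqueUnion x₀ := fun t => by
      have : t ∈ {t | γ t ∈ hη.plaqueUnion x₀} := by rw [h]; trivial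
      exact this
    simp [h']

/-- Membership in the union is preserved by tangent curves, hence by the relation they generate.
Only this inclusion matters: moves by rational vectors outside a plaque's ball have no geometric
meaning, but they add only countably many plaques. -/
theorem IsKContactForm.mem_plaqueUnion_of_leafProj_eq [T2Space M] {x₀ x : M}
    (h : leafProj η x = leafProj η x₀) : x ∈ hη.plaqueUnion x₀ := by
  have h' : Relation.EqvGen (TangentlyJoined η) x x₀ := Quotient.exact h
  have : ∀ a b, Relation.EqvGen (TangentlyJoined η) a b →
      (a ∈ hη.plaqueUnion x₀ ↔ b ∈ hη.plaqueUnion x₀) := by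
    intro a b hab
    induction hab with
    | rel a b h => exact hη.plaqueUnion_of_tangentlyJoined h
    | refl a => exact Iff.rfl
    | symm a b _ ih => exact ih.symm
    | trans a b c _ _ ih₁ ih₂ => exact ih₁.trans ih₂
  exact (this x x₀ h').2 (hη.mem_plaqueUnion_self x₀)

omit [FiniteDimensional ℝ E] [IsManifold 𝓘(ℝ, E) ∞ M] hη in
theorem TangentlyJoined.leafProj_eq {x y : M} (h : TangentlyJoined η x y) :
    leafProj η x = leafProj η y :=
  Quotient.sound (Relation.EqvGen.rel _ _ h)

theorem IsKContactForm.contMDiffAt_of_plaqueAt {ψ : (Fin k → ℝ) → M} {w : Fin k → ℝ}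
    (h : ∀ᶠ u in 𝓝 w, hη.PlaqueAt ψ u) : ContMDiffAt 𝓘(ℝ, Fin k → ℝ) 𝓘(ℝ, E) 1 ψ w := by
  set φ := extChartAt 𝓘(ℝ, E) (ψ w) with hφ
  have e : ∀ᶠ u in 𝓝 w, ψ u ∈ φ.source :=
    h.self_of_nhds.continuousAt (extChartAt_source_mem_nhds (I := 𝓘(ℝ, E)) (ψ w))
  have h1 : ContDiffAt ℝ 1 (fun u => φ (ψ u)) w := by
    refine contDiffAt_one_iff.2 ⟨fun u => hη.reebHat (ψ w) (φ (ψ u)), _, h.and e, ?_, ?_⟩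
    · rintro u ⟨h1, h2⟩
      refine ContinuousAt.continuousWithinAt ?_
      exact ContinuousAt.comp (g := hη.reebHat (ψ w))
        (hη.contDiffAt_reebHat (φ.map_source h2)).continuousAt
        (h1.hasFDerivAt hη h2).continuousAt
    · rintro u ⟨h1, h2⟩
      exact h1.hasFDerivAt hη h2
  have h2 : ContMDiffAt 𝓘(ℝ, Fin k → ℝ) 𝓘(ℝ, E) 1 (fun u => φ.symm (φ (ψ u))) w :=
    ContMDiffAt.comp (g := φ.symm) w
      ((contMDiffAt_extChartAt_symm (mem_extChartAt_target (ψ w))).of_le (by simp))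
      h1.contMDiffAt
  refine h2.congr_of_eventuallyEq ?_
  filter_upwards [e] with u hu using (φ.left_inv hu).symm

/-- The leaf projection is constant on a plaque. -/
theorem IsKContactForm.leafProj_plaque {ψ : (Fin k → ℝ) → M} {r : ℝ}
    (hψ : ∀ w ∈ ball 0 r, hη.PlaqueAt ψ w) {w : Fin k → ℝ} (hw : w ∈ ball 0 r) :
    leafProj η (ψ w) = leafProj η (ψ 0) := by
  -- Curves in `TangentlyJoined` are defined on all of `ℝ`. The sine keeps the parameter in the ball
  -- for all times while passing from `0` at time `0` to `w` at time `1`.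
  let f : ℝ → Fin k → ℝ := fun t => Real.sin (Real.pi / 2 * t) • w
  have hfs : ContDiff ℝ 1 f := by fun_prop
  have hfm : ∀ t, f t ∈ ball (0 : Fin k → ℝ) r := fun t => by
    have h1 : ‖w‖ < r := by simpa using hw
    have h2 : ‖f t‖ ≤ ‖w‖ := by
      rw [norm_smul]
      exact mul_le_of_le_one_left (norm_nonneg _) (Real.abs_sin_le_one _)
    simpa using h2.trans_lt h1
  have hnear : ∀ t, ∀ᶠ u in 𝓝 (f t), hη.PlaqueAt ψ u := fun t =>
    Filter.mem_of_superset (isOpen_ball.mem_nhds (hfm t)) hψ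
  refine (TangentlyJoined.leafProj_eq ⟨fun t => ψ (f t), fun t => ?_, fun t => ?_, ?_, ?_⟩).symm
  · exact (hη.contMDiffAt_of_plaqueAt (hnear t)).comp t hfs.contDiffAt.contMDiffAt
  · have h1 : HasMFDerivAt 𝓘(ℝ, ℝ) 𝓘(ℝ, Fin k → ℝ) f t (fderiv ℝ f t) :=
      (hfs.differentiable (by simp) t).hasFDerivAt.hasMFDerivAt
    have h2 := (HasMFDerivAt.comp t (hψ _ (hfm t)) h1).mfderiv
    have h3 : mfd ℝ E (fun t => ψ (f t)) t 1 = hη.reeb (ψ (f t)) (fderiv ℝ f t 1) :=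
      DFunLike.congr_fun h2 1
    refine (mem_kerForm_two (E := E)).2 fun v => ?_
    refine Eq.trans ?_ (hη.dExt_reeb (ψ (f t)) (fderiv ℝ f t 1) v)
    rw [← h3]
    rfl
  · simp [f]
  · simp [f]

end LeafCover

/-! ### Submersion coordinates and local sections -/

section Boxes

variable {E : Type*} [NormedAddCommGroup E] [NormedSpace ℝ E]
  {M : Type*} [TopologicalSpace M] [ChartedSpace E M]
  {F : Type*} [NormedAddCommGroup F] [NormedSpace ℝ F]
  {N : Type*} [TopologicalSpace N] [ChartedSpace F N]

/-- Local coordinates in which the map `p` is the projection `F × K → F`. -/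
structure Box (E F : Type*) [NormedAddCommGroup E] [NormedSpace ℝ E]
    [NormedAddCommGroup F] [NormedSpace ℝ F] {M N : Type*} [TopologicalSpace M] [ChartedSpace E M]
    [TopologicalSpace N] [ChartedSpace F N] (K : Type*) [NormedAddCommGroup K] [NormedSpace ℝ K]
    (p : M → N) where
  /-- the domain of the coordinates upstairs -/
  U : Set M
  /-- the range of the coordinates upstairs -/
  T : Set (F × K)
  /-- the domain of the coordinates downstairs -/
  O : Set N
  /-- the coordinates upstairs -/
  g : M → F × K
  /-- the inverse of the coordinates upstairs -/
  e : F × K → M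
  /-- the coordinates downstairs -/
  c : N → F
  /-- the inverse of the coordinates downstairs -/
  σ : F → N
  isOpen_U : IsOpen U
  isOpen_T : IsOpen T
  isOpen_O : IsOpen O
  map_g : ∀ {x}, x ∈ U → g x ∈ T
  map_e : ∀ {z}, z ∈ T → e z ∈ U
  map_p : ∀ {x}, x ∈ U → p x ∈ O
  e_g : ∀ {x}, x ∈ U → e (g x) = x
  g_e : ∀ {z}, z ∈ T → g (e z) = z
  σ_c : ∀ {b}, b ∈ O → σ (c b) = b
  c_p : ∀ {x}, x ∈ U → c (p x) = (g x).1
  smooth_g : ∀ {x}, x ∈ U → ContMDiffAt 𝓘(ℝ, E) 𝓘(ℝ, F × K) ∞ g x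
  smooth_e : ∀ {z}, z ∈ T → ContMDiffAt 𝓘(ℝ, F × K) 𝓘(ℝ, E) ∞ e z
  smooth_c : ∀ {b}, b ∈ O → ContMDiffAt 𝓘(ℝ, F) 𝓘(ℝ, F) ∞ c b
  smooth_σ : ∀ {b}, b ∈ O → ContMDiffAt 𝓘(ℝ, F) 𝓘(ℝ, F) ∞ σ (c b)

variable {K : Type*} [NormedAddCommGroup K] [NormedSpace ℝ K] {p : M → N}

/-- The adapted charts in the definition of a submersion, with the model space upstairs split as `F
× K`. -/
theorem exists_box {x₀ : M}
    (h : Manifold.IsSubmersionAtOfComplement K 𝓘(ℝ, E) 𝓘(ℝ, F) ∞ p x₀) :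
    ∃ b : Box E F K p, x₀ ∈ b.U := by
  have hdt : ∀ {y}, y ∈ h.domChart.target →
      ContMDiffAt 𝓘(ℝ, E) 𝓘(ℝ, E) ∞ h.domChart.symm y := fun hy =>
    contMDiffAt_symm_of_mem_maximalAtlas h.domChart_mem_maximalAtlas hy
  have hcp : ∀ {x}, x ∈ h.domChart.source →
      h.codChart (p x) = (h.equiv (h.domChart x)).1 := fun {x} hx => by
    have hx' : h.domChart x ∈ (h.domChart.extend 𝓘(ℝ, E)).target := by
      simpa using h.domChart.map_source hx
    have := h.writtenInCharts hx'
    simpa [h.domChart.left_inv hx] using this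
  refine ⟨{ U := h.domChart.source
            T := h.equiv.symm ⁻¹' h.domChart.target
            O := h.codChart.source
            g := fun x => h.equiv (h.domChart x)
            e := fun z => h.domChart.symm (h.equiv.symm z)
            c := h.codChart
            σ := h.codChart.symm
            isOpen_U := h.domChart.open_source
            isOpen_T := h.domChart.open_target.preimage h.equiv.symm.continuous
            isOpen_O := h.codChart.open_source
            map_g := fun hx => by simpa using h.domChart.map_source hx
            map_e := fun hz => h.domChart.map_target hz
            map_p := fun hx => h.source_subset_preimage_source hx
            e_g := fun hx => by simpa using h.domChart.left_inv hx
            g_e := fun {z} hz => by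
              have := h.domChart.right_inv hz
              simp [this]
            σ_c := fun hb => h.codChart.left_inv hb
            c_p := hcp
            smooth_g := fun hx => h.equiv.contDiff.contMDiff.contMDiffAt.comp _
              (contMDiffAt_of_mem_maximalAtlas h.domChart_mem_maximalAtlas hx)
            smooth_e := fun {z} hz => ContMDiffAt.comp (g := h.domChart.symm) z (hdt hz)
              h.equiv.symm.contDiff.contMDiff.contMDiffAt
            smooth_c := fun hb => contMDiffAt_of_mem_maximalAtlas h.codChart_mem_maximalAtlas hb
            smooth_σ := fun hb => contMDiffAt_symm_of_mem_maximalAtlas h.codChart_mem_maximalAtlas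
              (h.codChart.map_source hb) }, h.mem_domChart_source⟩

theorem mdifferentiableAt_fst_space {z : F × K} :
    MDifferentiableAt 𝓘(ℝ, F × K) 𝓘(ℝ, F) (fun z : F × K => z.1) z :=
  (differentiableAt_fst (𝕜 := ℝ)).mdifferentiableAt

namespace Box

variable (b : Box E F K p)

theorem p_e {z : F × K} (hz : z ∈ b.T) : p (b.e z) = b.σ z.1 := by
  have h := b.c_p (b.map_e hz)
  rw [b.g_e hz] at h
  rw [← h, b.σ_c (b.map_p (b.map_e hz))]

theorem eventually_c_p {x : M} (hx : x ∈ b.U) :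
    (fun y => b.c (p y)) =ᶠ[𝓝 x] fun y => (b.g y).1 := by
  filter_upwards [b.isOpen_U.mem_nhds hx] with y hy using b.c_p hy

theorem mdifferentiableAt_p {x : M} (hx : x ∈ b.U) : MDifferentiableAt 𝓘(ℝ, E) 𝓘(ℝ, F) p x := by
  have h : p =ᶠ[𝓝 x] fun y => b.σ (b.g y).1 := by
    filter_upwards [b.isOpen_U.mem_nhds hx] with y hy
    rw [← b.c_p hy, b.σ_c (b.map_p hy)]
  refine MDifferentiableAt.congr_of_eventuallyEq ?_ h
  refine MDifferentiableAt.comp (I' := 𝓘(ℝ, F)) (g := b.σ) (f := fun y => (b.g y).1) x ?_ ?_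
  · rw [← b.c_p hx]
    exact (b.smooth_σ (b.map_p hx)).mdifferentiableAt (by simp)
  · exact MDifferentiableAt.comp (I' := 𝓘(ℝ, F × K)) (g := fun z : F × K => z.1) (f := b.g) x
      mdifferentiableAt_fst_space ((b.smooth_g hx).mdifferentiableAt (by simp))

theorem mfd_σ_mfd_c {y : N} (hy : y ∈ b.O) (u : F) :
    mfd F F b.σ (b.c y) (mfd F F b.c y u) = u := by
  rw [← mfd_comp_apply ((b.smooth_σ hy).mdifferentiableAt (by simp))
    ((b.smooth_c hy).mdifferentiableAt (by simp))]
  have : (fun z => b.σ (b.c z)) =ᶠ[𝓝 y] fun z => z := by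
    filter_upwards [b.isOpen_O.mem_nhds hy] with z hz using b.σ_c hz
  rw [mfd_congr this, mfd_id]
  rfl

theorem mfd_c_mfd_p {x : M} (hx : x ∈ b.U) (v : E) :
    mfd F F b.c (p x) (mfd E F p x v) = (mfd E (F × K) b.g x v).1 := by
  rw [← mfd_comp_apply ((b.smooth_c (b.map_p hx)).mdifferentiableAt (by simp))
    (b.mdifferentiableAt_p hx), mfd_congr (b.eventually_c_p hx),
    mfd_comp_apply (g := fun z : F × K => z.1) (f := b.g) (E' := F × K)
      mdifferentiableAt_fst_space
      ((b.smooth_g hx).mdifferentiableAt (by simp)), mfd_eq_fderiv, fderiv_fst]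
  rfl

theorem mfd_e_mfd_g {x : M} (hx : x ∈ b.U) (v : E) :
    mfd (F × K) E b.e (b.g x) (mfd E (F × K) b.g x v) = v := by
  rw [← mfd_comp_apply ((b.smooth_e (b.map_g hx)).mdifferentiableAt (by simp))
    ((b.smooth_g hx).mdifferentiableAt (by simp))]
  have : (fun z => b.e (b.g z)) =ᶠ[𝓝 x] fun z => z := by
    filter_upwards [b.isOpen_U.mem_nhds hx] with z hz using b.e_g hz
  rw [mfd_congr this, mfd_id]
  rfl

theorem mfd_g_mfd_e {z : F × K} (hz : z ∈ b.T) (v : F × K) :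
    mfd E (F × K) b.g (b.e z) (mfd (F × K) E b.e z v) = v := by
  rw [← mfd_comp_apply (E := F × K) ((b.smooth_g (b.map_e hz)).mdifferentiableAt (by simp))
    ((b.smooth_e hz).mdifferentiableAt (by simp))]
  have : (fun z => b.g (b.e z)) =ᶠ[𝓝 z] fun z => z := by
    filter_upwards [b.isOpen_T.mem_nhds hz] with z hz using b.g_e hz
  rw [mfd_congr this, mfd_id]
  rfl

theorem mfd_p_eq_zero_iff {x : M} (hx : x ∈ b.U) {v : E} :
    mfd E F p x v = 0 ↔ (mfd E (F × K) b.g x v).1 = 0 := by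
  constructor
  · intro h
    rw [← b.mfd_c_mfd_p hx, h, map_zero]
  · intro h
    have := b.mfd_σ_mfd_c (b.map_p hx) (mfd E F p x v)
    rw [b.mfd_c_mfd_p hx, h, map_zero] at this
    exact this.symm

theorem surjective_mfd_p {x : M} (hx : x ∈ b.U) : Function.Surjective (mfd E F p x) := by
  intro u
  refine ⟨mfd (F × K) E b.e (b.g x) (mfd F F b.c (p x) u, 0), ?_⟩
  have h1 := b.mfd_c_mfd_p hx (mfd (F × K) E b.e (b.g x) (mfd F F b.c (p x) u, 0))
  have h2 := b.mfd_g_mfd_e (b.map_g hx) (mfd F F b.c (p x) u, 0)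
  rw [b.e_g hx] at h2
  rw [h2] at h1
  rw [← b.mfd_σ_mfd_c (b.map_p hx) (mfd E F p x _), h1, b.mfd_σ_mfd_c (b.map_p hx)]

/-- The local section of `p` through `x₀` given by a box. -/
def sec (x₀ : M) (y : N) : M := b.e (b.c y, (b.g x₀).2)

theorem sec_self {x₀ : M} (hx : x₀ ∈ b.U) : b.sec x₀ (p x₀) = x₀ := by
  rw [sec, b.c_p hx]
  exact b.e_g hx

theorem eventually_sec {x₀ : M} (hx : x₀ ∈ b.U) :
    ∀ᶠ y in 𝓝 (p x₀), y ∈ b.O ∧ (b.c y, (b.g x₀).2) ∈ b.T := by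
  refine Filter.Eventually.and (b.isOpen_O.mem_nhds (b.map_p hx)) ?_
  have hc : ContinuousAt (fun y => (b.c y, (b.g x₀).2)) (p x₀) :=
    (b.smooth_c (b.map_p hx)).continuousAt.prodMk continuousAt_const
  refine hc.eventually_mem (b.isOpen_T.mem_nhds ?_)
  rw [b.c_p hx]
  exact b.map_g hx

theorem p_sec {x₀ : M} {y : N} (hy : y ∈ b.O) (hy' : (b.c y, (b.g x₀).2) ∈ b.T) :
    p (b.sec x₀ y) = y := by
  rw [sec, b.p_e hy', b.σ_c hy]

theorem contMDiffAt_sec {x₀ : M} {y : N} (hy : y ∈ b.O) (hy' : (b.c y, (b.g x₀).2) ∈ b.T) :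
    ContMDiffAt 𝓘(ℝ, F) 𝓘(ℝ, E) ∞ (b.sec x₀) y := by
  refine ContMDiffAt.comp (g := b.e) (f := fun y => (b.c y, (b.g x₀).2)) y (b.smooth_e hy') ?_
  exact (b.smooth_c hy).prodMk_space contMDiffAt_const

end Box

/-- A submersion has smooth local sections through each point. -/
theorem exists_local_section
    (hp : Manifold.IsSubmersion 𝓘(ℝ, E) 𝓘(ℝ, F) ∞ p) (x₀ : M) :
    ∃ s : N → M, s (p x₀) = x₀ ∧ ∀ᶠ y in 𝓝 (p x₀), p (s y) = y ∧
      ContMDiffAt 𝓘(ℝ, F) 𝓘(ℝ, E) ∞ s y := by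
  obtain ⟨b, hb⟩ := exists_box (hp.isSubmersionOfComplement_complement x₀)
  refine ⟨b.sec x₀, b.sec_self hb, ?_⟩
  filter_upwards [b.eventually_sec hb] with y hy
  exact ⟨b.p_sec hy.1 hy.2, b.contMDiffAt_sec hy.1 hy.2⟩

theorem surjective_mfd_of_isSubmersion
    (hp : Manifold.IsSubmersion 𝓘(ℝ, E) 𝓘(ℝ, F) ∞ p) (x : M) :
    Function.Surjective (mfd E F p x) := by
  obtain ⟨b, hb⟩ := exists_box (hp.isSubmersionOfComplement_complement x)
  exact b.surjective_mfd_p hb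

end Boxes

/-! ### Vertical vectors of the leaf projection -/

section LeafKernel

variable {E : Type*} [NormedAddCommGroup E] [NormedSpace ℝ E]
  {M : Type*} [TopologicalSpace M] [ChartedSpace E M] [IsManifold 𝓘(ℝ, E) ∞ M] {k : ℕ}
  {η : DForm E M 1 k} (hη : IsKContactForm η)
  {F : Type*} [NormedAddCommGroup F] [NormedSpace ℝ F] [ChartedSpace F (LeafSpace η)]
  {K : Type*} [NormedAddCommGroup K] [NormedSpace ℝ K]
  [FiniteDimensional ℝ E]
include hη

theorem IsKContactForm.mfd_leafProj_reeb {x : M}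
    (hp : MDifferentiableAt 𝓘(ℝ, E) 𝓘(ℝ, F) (leafProj η) x) (w : Fin k → ℝ) :
    mfd E F (leafProj η) x (hη.reeb x w) = 0 := by
  obtain ⟨r, hr, ψ, h0, hψ⟩ := hη.exists_plaque x
  subst h0
  have h1 : HasMFDerivAt 𝓘(ℝ, Fin k → ℝ) 𝓘(ℝ, E) ψ 0 (hη.reeb (ψ 0)) := hψ 0 (mem_ball_self hr)
  have h2 := (HasMFDerivAt.comp 0 hp.hasMFDerivAt h1).mfderiv
  have h3 : (leafProj η ∘ ψ) =ᶠ[𝓝 0] fun _ => leafProj η (ψ 0) := by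
    filter_upwards [ball_mem_nhds 0 hr] with w hw using hη.leafProj_plaque hψ hw
  rw [h3.mfderiv_eq, mfderiv_const] at h2
  exact (DFunLike.congr_fun h2 w).symm

/-- The fibres of the leaf projection have dimension at most `k`: they are covered by countably
many plaques. -/
theorem IsKContactForm.finrank_complement_le [T2Space M] [FiniteDimensional ℝ K]
    (b : Box E F K (leafProj η)) {x₀ : M} (hx₀ : x₀ ∈ b.U) : Module.finrank ℝ K ≤ k := by
  let a := (b.g x₀).1
  -- The slice of the box over the leaf of `x₀`: an open subset of `K`, all of whose points project
  -- to the same leaf.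
  let Z : Set K := {z | (a, z) ∈ b.T}
  have hZo : IsOpen Z := b.isOpen_T.preimage (by fun_prop)
  have hZ : Z ∈ 𝓝 (b.g x₀).2 := hZo.mem_nhds (b.map_g hx₀)
  let G : List (ℕ × (Fin k → ℚ)) × ℕ → (Fin k → ℝ) → K := fun i w =>
    (b.g (hη.plaque (hη.follow x₀ i.1) i.2 w)).2
  let D : List (ℕ × (Fin k → ℚ)) × ℕ → Set (Fin k → ℝ) := fun i =>
    {w | hη.HasPlaque (hη.follow x₀ i.1) i.2 ∧ w ∈ ball (0 : Fin k → ℝ) (1 / ((i.2 : ℝ) + 1)) ∧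
      hη.plaque (hη.follow x₀ i.1) i.2 w ∈ b.U}
  have hcover : Z ⊆ ⋃ i, G i '' D i := by
    intro z hz
    have h1 : leafProj η (b.e (a, z)) = leafProj η x₀ := by
      have hx : (a, (b.g x₀).2) ∈ b.T := b.map_g hx₀
      rw [b.p_e hz, ← b.p_e hx]
      exact congrArg _ (b.e_g hx₀)
    obtain ⟨l, n, hc, w, hw, e⟩ := hη.mem_plaqueUnion_of_leafProj_eq h1
    refine mem_iUnion.2 ⟨(l, n), w, ⟨hc, hw, ?_⟩, ?_⟩
    · rw [← e]; exact b.map_e hz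
    · show (b.g (hη.plaque (hη.follow x₀ l) n w)).2 = z
      rw [← e, b.g_e hz]
  -- Plaques are `C^1`, so `G i` is locally Lipschitz and cannot raise the Hausdorff dimension above
  -- that of `ℝ^k`.
  have hdim : ∀ i, dimH (G i '' D i) ≤ k := by
    intro i
    have hL : ∀ w ∈ D i, ∃ C : ℝ≥0, ∃ t ∈ 𝓝[D i] w, LipschitzOnWith C (G i) t := by
      rintro w ⟨hc, hw, hU⟩
      have h1 : ContMDiffAt 𝓘(ℝ, Fin k → ℝ) 𝓘(ℝ, E) 1 (hη.plaque (hη.follow x₀ i.1) i.2) w :=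
        hη.contMDiffAt_of_plaqueAt
          (Filter.mem_of_superset (isOpen_ball.mem_nhds hw) fun u hu => hc.plaqueAt hη hu)
      have h2 : ContDiffAt ℝ 1 (fun w => b.g (hη.plaque (hη.follow x₀ i.1) i.2 w)) w :=
        (ContMDiffAt.comp w ((b.smooth_g hU).of_le (by simp)) h1).contDiffAt
      obtain ⟨C, t, ht, hC⟩ := h2.snd.exists_lipschitzOnWith
      exact ⟨C, t, mem_nhdsWithin_of_mem_nhds ht, hC⟩
    calc dimH (G i '' D i) ≤ dimH (D i) := dimH_image_le_of_locally_lipschitzOn hL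
      _ ≤ dimH (univ : Set (Fin k → ℝ)) := dimH_mono (subset_univ _)
      _ = k := by rw [Real.dimH_univ_eq_finrank]; simp
  have hle : dimH Z ≤ k := by
    refine (dimH_mono hcover).trans ?_
    rw [dimH_iUnion]
    exact iSup_le hdim
  -- A countable union does not raise the dimension either, whereas a neighbourhood in `K` has the
  -- full dimension of `K`.
  rw [Real.dimH_of_mem_nhds hZ] at hle
  exact_mod_cast hle

/-- The vertical vectors of the leaf projection are the vectors of the Reeb distribution. -/
theorem IsKContactForm.mfd_leafProj_eq_zero_iff [T2Space M] [FiniteDimensional ℝ F]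
    (hp : Manifold.IsSubmersion 𝓘(ℝ, E) 𝓘(ℝ, F) ∞ (leafProj η)) {x : M} {v : E} :
    mfd E F (leafProj η) x v = 0 ↔ ∀ v', formAt (dExt η) x ![v, v'] = 0 := by
  have h := hp.isSubmersionOfComplement_complement x
  obtain ⟨b, hb⟩ := exists_box h
  have : FiniteDimensional ℝ (F × hp.complement) := h.equiv.toLinearEquiv.finiteDimensional
  have : FiniteDimensional ℝ hp.complement :=
    FiniteDimensional.of_surjective (LinearMap.snd ℝ F hp.complement) LinearMap.snd_surjective
  have hK := hη.finrank_complement_le b hb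
  have hE := h.equiv.toLinearEquiv.finrank_eq
  rw [Module.finrank_prod] at hE
  have hpd := b.mdifferentiableAt_p hb
  let P : E →ₗ[ℝ] F := mfd E F (leafProj η) x
  let S : Submodule ℝ E := kerForm (dExt η) x
  have hsub : S ≤ LinearMap.ker P := by
    intro v hv
    have h1 := hη.eq_reeb (mem_kerForm_two.1 hv)
    have h2 := hη.mfd_leafProj_reeb hpd (formAt η x ![v])
    rw [← h1] at h2
    exact h2
  have hrank : Module.finrank ℝ (LinearMap.ker P) ≤ k := by
    have h1 := LinearMap.finrank_range_add_finrank_ker P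
    have h2 : LinearMap.range P = ⊤ := LinearMap.range_eq_top.2 (b.surjective_mfd_p hb)
    rw [h2, finrank_top] at h1
    omega
  -- The kernel has dimension `dim E - dim F = dim K ≤ k` and contains `ker dη`, which has dimension
  -- `k`.
  have heq : S = LinearMap.ker P :=
    Submodule.eq_of_le_of_finrank_le hsub (hrank.trans (hη.rank_ker_d x).ge)
  rw [← mem_kerForm_two (E := E)]
  exact (SetLike.ext_iff.1 heq v).symm

end LeafKernel

/-! ### Closed two-forms and the directions they annihilate -/

section BasicForms

variable {E : Type*} [NormedAddCommGroup E] [NormedSpace ℝ E]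
  {W : Type*} [NormedAddCommGroup W] [NormedSpace ℝ W]

/-- A closed two-form is constant in the directions that it annihilates. -/
theorem fderiv_apply_eq_zero_of_extDeriv_eq_zero {Ω : E → E [⋀^Fin 2]→L[ℝ] W} {x u : E}
    (hΩ : DifferentiableAt ℝ Ω x) (hd : extDeriv Ω x = 0)
    (hu : ∀ᶠ y in 𝓝 x, ∀ v, Ω y ![u, v] = 0) (v w : E) :
    fderiv ℝ (fun y => Ω y ![v, w]) x u = 0 := by
  have h := extDeriv_apply hΩ ![u, v, w]
  have e0 : Fin.removeNth (0 : Fin 3) ![u, v, w] = ![v, w] := by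
    funext i; fin_cases i <;> rfl
  have e1 : Fin.removeNth (1 : Fin 3) ![u, v, w] = ![u, w] := by
    funext i; fin_cases i <;> rfl
  have e2 : Fin.removeNth (2 : Fin 3) ![u, v, w] = ![u, v] := by
    funext i; fin_cases i <;> rfl
  have hz : ∀ v', fderiv ℝ (fun y => Ω y ![u, v']) x = 0 := fun v' => by
    have : (fun y => Ω y ![u, v']) =ᶠ[𝓝 x] fun _ => 0 := hu.mono fun y hy => hy v'
    rw [this.fderiv_eq]
    simp
  rw [hd, Fin.sum_univ_three, e0, e1, e2, hz, hz] at h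
  simpa using h.symm

theorem differentiableAt_two_apply {Ω : E → E [⋀^Fin 2]→L[ℝ] W} {x : E}
    (hΩ : DifferentiableAt ℝ Ω x) (u v : E) : DifferentiableAt ℝ (fun y => Ω y ![u, v]) x := by
  have h1 : DifferentiableAt ℝ (fun y => twoFormL (Ω y)) x :=
    DifferentiableAt.comp (g := twoFormL) x
      ((ContinuousLinearMap.contDiff (n := 1) _).contDiffAt.differentiableAt (by simp)) hΩ
  have h2 : DifferentiableAt ℝ (fun y => twoFormL (Ω y) u v) x :=
    (h1.clm_apply (differentiableAt_const u)).clm_apply (differentiableAt_const v)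
  simpa only [twoFormL_apply] using h2

theorem map_vec_congr_of_sub {f : E [⋀^Fin 2]→L[ℝ] W} {v v' w w' : E}
    (h₁ : ∀ z, f ![v - v', z] = 0) (h₂ : ∀ z, f ![w - w', z] = 0) : f ![v, w] = f ![v', w'] := by
  have a : f ![v, w] = f ![v', w] := by
    have := h₁ w
    rwa [← twoFormL_apply, map_sub, sub_apply, sub_eq_zero, twoFormL_apply, twoFormL_apply] at this
  have b : f ![w, v'] = f ![w', v'] := by
    have := h₂ v'
    rwa [← twoFormL_apply, map_sub, sub_apply, sub_eq_zero, twoFormL_apply, twoFormL_apply] at this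
  rw [a, map_vec_swap, b, ← map_vec_swap]

end BasicForms

/-! ### Constancy of a basic two-form along the fibres of a submersion -/

section Descent

variable {E : Type*} [NormedAddCommGroup E] [NormedSpace ℝ E]
  {M : Type*} [TopologicalSpace M] [ChartedSpace E M]
  {F : Type*} [NormedAddCommGroup F] [NormedSpace ℝ F]
  {N : Type*} [TopologicalSpace N] [ChartedSpace F N]
  {K : Type*} [NormedAddCommGroup K] [NormedSpace ℝ K] {p : M → N} {k : ℕ}

theorem pullE_apply_two (f : F → M) (Ω : DForm E M 2 k) (z v w : F) :
    pullE f Ω z ![v, w] = formAt Ω (f z) ![mfd F E f z v, mfd F E f z w] := by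
  show formAt Ω _ (fun i => mfd F E f z (![v, w] i)) = _
  congr 1
  funext i; fin_cases i <;> rfl

/-- A two-form takes the same values at `x` and `y` on vectors with the same image under `p`. -/
def SameValues (F : Type*) [NormedAddCommGroup F] [NormedSpace ℝ F] [ChartedSpace F N]
    (p : M → N) (Ω : DForm E M 2 k) (x y : M) : Prop :=
  ∀ v v' w w' : E, mfd E F p x v = mfd E F p y v' → mfd E F p x w = mfd E F p y w' →
    formAt Ω x ![v, w] = formAt Ω y ![v', w']

/-- In box coordinates the form annihilates the constant vertical fields, so being closed it has
zero derivative in the `K` directions. It is thus constant on each slice of the convex set `C` over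
a point of `F`. Vectors with equal image under `p` have equal `F` components there, and the vertical
difference does not contribute. -/
theorem Box.sameValues [IsManifold 𝓘(ℝ, E) ∞ M] (b : Box E F K p) {Ω : DForm E M 2 k}
    (hΩ : IsSmoothForm Ω) (hd : dExt Ω = 0)
    (hker : ∀ x v, mfd E F p x v = 0 → ∀ v', formAt Ω x ![v, v'] = 0) {x y : M} (hx : x ∈ b.U)
    (hy : y ∈ b.U) (hxy : p x = p y) {C : Set (F × K)} (hC : Convex ℝ C) (hCo : IsOpen C)
    (hCT : C ⊆ b.T) (hxC : b.g x ∈ C) (hyC : b.g y ∈ C) : SameValues F p Ω x y := by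
  intro v v' w w' hv hw
  have hg1 : (b.g x).1 = (b.g y).1 := by rw [← b.c_p hx, ← b.c_p hy, hxy]
  have hpull : ∀ {q} (hq : q ∈ b.U) (v w : E), formAt Ω q ![v, w] =
      pullE b.e Ω (b.g q) ![mfd E (F × K) b.g q v, mfd E (F × K) b.g q w] := by
    intro q hq v w
    rw [pullE_apply_two, b.e_g hq, b.mfd_e_mfd_g hq, b.mfd_e_mfd_g hq]
  have hvert : ∀ z ∈ b.T, ∀ (κ : K) (v' : F × K), pullE b.e Ω z ![(0, κ), v'] = 0 := by
    intro z hz κ v'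
    rw [pullE_apply_two]
    refine hker _ _ ?_ _
    rw [b.mfd_p_eq_zero_iff (b.map_e hz), b.mfd_g_mfd_e hz]
  have hconst : ∀ u u' : F × K, pullE b.e Ω (b.g x) ![u, u'] = pullE b.e Ω (b.g y) ![u, u'] := by
    intro u u'
    let f : K → (Fin k → ℝ) := fun κ => pullE b.e Ω ((b.g x).1, κ) ![u, u']
    let ι : K → F × K := fun κ => ((b.g x).1, κ)
    let S : Set K := ι ⁻¹' C
    have hSo : IsOpen S := hCo.preimage (by fun_prop)
    have hSc : Convex ℝ S := by
      intro κ hκ κ' hκ' s t hs ht hst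
      have := hC hκ hκ' hs ht hst
      have e : ι (s • κ + t • κ') = s • ι κ + t • ι κ' := by
        simp [ι, ← add_smul, hst]
      show ι _ ∈ C
      rwa [e]
    have hder : ∀ κ ∈ S, HasFDerivAt f (0 : K →L[ℝ] Fin k → ℝ) κ := by
      intro κ hκ
      have hT := hCT hκ
      have hs := hΩ.contDiffAt_pullbackForm (b.smooth_e hT)
      have hdiff : DifferentiableAt ℝ (pullE b.e Ω) (ι κ) := hs.differentiableAt (by simp)
      have h0 : extDeriv (pullE b.e Ω) (ι κ) = 0 := by
        rw [hΩ.extDeriv_pullbackForm (b.smooth_e hT), hd]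
        rfl
      have h1 := fun κ' : K => fderiv_apply_eq_zero_of_extDeriv_eq_zero (u := (0, κ')) hdiff h0
        (Filter.mem_of_superset (b.isOpen_T.mem_nhds hT) fun z hz => hvert z hz κ') u u'
      have h2 : DifferentiableAt ℝ (fun z => pullE b.e Ω z ![u, u']) (ι κ) :=
        differentiableAt_two_apply hdiff u u'
      have h3 : HasFDerivAt ι (ContinuousLinearMap.inr ℝ F K) κ :=
        (hasFDerivAt_const (b.g x).1 κ).prodMk (hasFDerivAt_id κ)
      refine (HasFDerivAt.comp κ h2.hasFDerivAt h3).congr_fderiv ?_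
      ext1 κ'
      exact h1 κ'
    have := hSo.is_const_of_fderiv_eq_zero hSc.isPreconnected
      (fun κ hκ => (hder κ hκ).differentiableAt.differentiableWithinAt)
      (fun κ hκ => (hder κ hκ).fderiv) (x := (b.g x).2) (y := (b.g y).2) hxC
      (show ((b.g x).1, (b.g y).2) ∈ C by rw [hg1]; exact hyC)
    refine this.trans ?_
    show pullE b.e Ω ((b.g x).1, (b.g y).2) ![u, u'] = _
    rw [hg1]
  have hfst : ∀ v v' : E, mfd E F p x v = mfd E F p y v' →
      (mfd E (F × K) b.g x v).1 = (mfd E (F × K) b.g y v').1 := fun v v' h => by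
    rw [← b.mfd_c_mfd_p hx, ← b.mfd_c_mfd_p hy, h, hxy]
  have hcong : ∀ u u' : F × K, u.1 = u'.1 → ∀ z, pullE b.e Ω (b.g y) ![u - u', z] = 0 := by
    intro u u' h z
    have : u - u' = (0, u.2 - u'.2) := by
      ext <;> simp [h]
    rw [this]
    exact hvert _ (b.map_g hy) _ _
  rw [hpull hx, hpull hy, hconst]
  exact map_vec_congr_of_sub (hcong _ _ (hfst v v' hv)) (hcong _ _ (hfst w w' hw))

theorem SameValues.symm {Ω : DForm E M 2 k} {x y : M} (h : SameValues F p Ω x y) :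
    SameValues F p Ω y x := fun v v' w w' hv hw => (h v' v w' w hv.symm hw.symm).symm

/-- Surjectivity at the middle point supplies vectors there through which the two comparisons can be
chained. -/
theorem SameValues.trans {Ω : DForm E M 2 k} {x y z : M} (h : SameValues F p Ω x y)
    (h' : SameValues F p Ω y z) (hs : Function.Surjective (mfd E F p y)) :
    SameValues F p Ω x z := fun v v' w w' hv hw => by
  obtain ⟨a, ha⟩ := hs (mfd E F p x v)
  obtain ⟨c, hc⟩ := hs (mfd E F p x w)
  exact (h v a w c ha.symm hc.symm).trans (h' a v' c w' (ha.trans hv) (hc.trans hw))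

end Descent

/-! ### Constancy of `dη` along whole leaves -/

section LeafDescent

variable {E : Type*} [NormedAddCommGroup E] [NormedSpace ℝ E]
  {M : Type*} [TopologicalSpace M] [ChartedSpace E M] {k : ℕ} {η : DForm E M 1 k}

/-- The points of a tangent curve lie on one leaf. -/
theorem leafProj_curve {γ : ℝ → M} (hγ : ContMDiff 𝓘(ℝ, ℝ) 𝓘(ℝ, E) 1 γ)
    (ht : ∀ t : ℝ, mfderiv 𝓘(ℝ, ℝ) 𝓘(ℝ, E) γ t (1 : ℝ) ∈ kerForm (dExt η) (γ t)) (t : ℝ) :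
    leafProj η (γ t) = leafProj η (γ 0) := by
  have hm : ContMDiff 𝓘(ℝ, ℝ) 𝓘(ℝ, ℝ) 1 (fun s : ℝ => t * s) :=
    (contDiff_const.mul contDiff_id).contMDiff
  refine (TangentlyJoined.leafProj_eq ⟨fun s => γ (t * s), hγ.comp hm, fun s => ?_, by simp,
    by simp⟩).symm
  have h1 : mfd ℝ E (fun s => γ (t * s)) s 1 = t • mfd ℝ E γ (t * s) 1 := by
    rw [mfd_comp_apply (E' := ℝ) (g := γ) (f := fun s => t * s)
      ((hγ _).mdifferentiableAt (by simp)) ((hm s).mdifferentiableAt (by simp)), mfd_eq_fderiv,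
      ← map_smul]
    congr 1
    simp
  have h2 := (kerForm (dExt η) (γ (t * s))).smul_mem t (ht (t * s))
  refine (mem_kerForm_two (E := E)).2 fun v => ?_
  refine Eq.trans ?_ ((mem_kerForm_two (E := E)).1 h2 v)
  exact congrArg (fun u => formAt (dExt η) (γ (t * s)) ![u, v]) h1

variable [IsManifold 𝓘(ℝ, E) ∞ M] (hη : IsKContactForm η)
  {F : Type*} [NormedAddCommGroup F] [NormedSpace ℝ F] [ChartedSpace F (LeafSpace η)]
  [FiniteDimensional ℝ E] [FiniteDimensional ℝ F] [T2Space M]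
  (hp : Manifold.IsSubmersion 𝓘(ℝ, E) 𝓘(ℝ, F) ∞ (leafProj η))
include hη hp

/-- `dη` takes the same values along each leaf. -/
theorem IsKContactForm.sameValues_dExt {x y : M} (h : leafProj η x = leafProj η y) :
    SameValues F (leafProj η) (dExt η) x y := by
  have hs := surjective_mfd_of_isSubmersion hp
  have hrefl : ∀ x, SameValues F (leafProj η) (dExt η) x x := fun x v v' w w' hv hw => by
    refine map_vec_congr_of_sub ?_ ?_
    · rw [← hη.mfd_leafProj_eq_zero_iff hp, map_sub, hv, sub_self]
    · rw [← hη.mfd_leafProj_eq_zero_iff hp, map_sub, hw, sub_self]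
  have hcurve : ∀ x y, TangentlyJoined η x y → SameValues F (leafProj η) (dExt η) x y := by
    rintro _ _ ⟨γ, hγ, ht, rfl, rfl⟩
    -- A symmetric transitive relation on the times of the curve that holds locally around each time
    -- holds for all pairs. Locally it comes from a box, with a ball as convex set.
    refine isPreconnected_univ.induction₂
      (fun s t => SameValues F (leafProj η) (dExt η) (γ s) (γ t)) (fun t _ => ?_)
      (fun a b c _ _ _ h h' => h.trans h' (hs _)) (fun a b _ _ h => h.symm) (mem_univ 0)
      (mem_univ 1)
    rw [nhdsWithin_univ]
    obtain ⟨b, hb⟩ := exists_box (hp.isSubmersionOfComplement_complement (γ t))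
    obtain ⟨r, hr, hrT⟩ := Metric.isOpen_iff.1 b.isOpen_T _ (b.map_g hb)
    have h1 : ∀ᶠ s in 𝓝 t, γ s ∈ b.U := (hγ t).continuousAt (b.isOpen_U.mem_nhds hb)
    have h2 : ContinuousAt (fun s => b.g (γ s)) t :=
      ContinuousAt.comp (g := b.g) (b.smooth_g hb).continuousAt (hγ t).continuousAt
    filter_upwards [h1, h2 (ball_mem_nhds _ hr)] with s h3 h4
    exact b.sameValues hη.smooth.dExt hη.smooth.dExt_dExt
      (fun x v h => (hη.mfd_leafProj_eq_zero_iff hp).1 h) hb h3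
      (by rw [leafProj_curve hγ ht, leafProj_curve hγ ht s]) (convex_ball _ r) isOpen_ball hrT
      (mem_ball_self hr) h4
  have h' : Relation.EqvGen (TangentlyJoined η) x y := Quotient.exact h
  clear h
  induction h' with
  | rel a b h => exact hcurve a b h
  | refl a => exact hrefl a
  | symm a b _ ih => exact ih.symm
  | trans a b c _ _ ih₁ ih₂ => exact ih₁.trans ih₂ (hs b)

end LeafDescent

/-! ### Descent of two-forms along surjective submersions -/

section Quotients

variable {E : Type*} [NormedAddCommGroup E] [NormedSpace ℝ E]
  {M : Type*} [TopologicalSpace M] [ChartedSpace E M]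
  {F : Type*} [NormedAddCommGroup F] [NormedSpace ℝ F]
  {N : Type*} [TopologicalSpace N] [ChartedSpace F N] {p : M → N} {k : ℕ}
  {Ω : DForm F N 2 k} {Θ : DForm E M 2 k}

theorem pullbackForm_eq_iff : pullbackForm p Ω = Θ ↔ ∀ x v w,
    formAt Ω (p x) ![mfd E F p x v, mfd E F p x w] = formAt Θ x ![v, w] := by
  have key : ∀ x v w, formAt (pullbackForm p Ω) x ![v, w] =
      formAt Ω (p x) ![mfd E F p x v, mfd E F p x w] := fun x v w => by
    show formAt Ω _ (fun i => mfd E F p x (![v, w] i)) = _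
    congr 1
    funext i; fin_cases i <;> rfl
  constructor
  · rintro rfl x v w
    exact (key x v w).symm
  · intro h
    funext x
    have : formAt (pullbackForm p Ω) x = formAt Θ x := by
      ext1 v
      have : v = ![v 0, v 1] := by funext i; fin_cases i <;> rfl
      rw [this, key, h]
    exact this

theorem pullbackForm_unique (hps : Function.Surjective p)
    (hds : ∀ x, Function.Surjective (mfd E F p x)) {Ω' : DForm F N 2 k}
    (h : pullbackForm p Ω = Θ) (h' : pullbackForm p Ω' = Θ) : Ω' = Ω := by
  funext y
  obtain ⟨x, rfl⟩ := hps y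
  have : formAt Ω' (p x) = formAt Ω (p x) := by
    ext1 u
    have e : u = ![u 0, u 1] := by funext i; fin_cases i <;> rfl
    obtain ⟨v, hv⟩ := hds x (u 0)
    obtain ⟨w, hw⟩ := hds x (u 1)
    rw [e, ← hv, ← hw, pullbackForm_eq_iff.1 h, pullbackForm_eq_iff.1 h']
  exact this

/-- The form is evaluated by lifting the point and the vectors arbitrarily; `SameValues` is the
independence of these lifts. -/
theorem exists_pullbackForm_eq [FiniteDimensional ℝ F] (hps : Function.Surjective p)
    (hds : ∀ x, Function.Surjective (mfd E F p x))
    (hs : ∀ x y, p x = p y → SameValues F p Θ x y) :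
    ∃ Ω : DForm F N 2 k, pullbackForm p Ω = Θ := by
  have hr : ∀ x, ∃ r : F →L[ℝ] E, ∀ u, mfd E F p x (r u) = u := fun x => by
    obtain ⟨r, hr⟩ := LinearMap.exists_rightInverse_of_surjective
      (mfd E F p x : E →ₗ[ℝ] F) (LinearMap.range_eq_top.2 (hds x))
    exact ⟨LinearMap.toContinuousLinearMap r, fun u => DFunLike.congr_fun hr u⟩
  choose r hr using hr
  choose s hps using hps
  let Ω₀ : N → F [⋀^Fin 2]→L[ℝ] (Fin k → ℝ) := fun y =>
    (formAt Θ (s y)).compContinuousLinearMap (r (s y))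
  refine ⟨Ω₀, pullbackForm_eq_iff.2 fun x v w => ?_⟩
  have : formAt Ω₀ (p x) ![mfd E F p x v, mfd E F p x w] =
      formAt Θ (s (p x)) ![r (s (p x)) (mfd E F p x v), r (s (p x)) (mfd E F p x w)] := by
    show formAt Θ (s (p x)) (fun i => r (s (p x)) (![mfd E F p x v, mfd E F p x w] i)) = _
    congr 1
    funext i; fin_cases i <;> rfl
  rw [this]
  exact hs _ _ (hps _) _ _ _ _ (hr _ _) (hr _ _)

variable [IsManifold 𝓘(ℝ, E) ∞ M] [IsManifold 𝓘(ℝ, F) ∞ N]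

/-- If `s` is a local section of `p`, then `Ω = s^* Θ` near the point, so coordinate expressions of
`Ω` are pullbacks of `Θ` by smooth maps. -/
theorem isSmoothForm_of_pullbackForm (hp : Manifold.IsSubmersion 𝓘(ℝ, E) 𝓘(ℝ, F) ∞ p)
    (hps : Function.Surjective p) (hΘ : IsSmoothForm Θ) (h : pullbackForm p Ω = Θ) :
    IsSmoothForm Ω := by
  intro y₀ z hz
  refine ContDiffAt.contDiffWithinAt ?_
  set φ := extChartAt 𝓘(ℝ, F) y₀ with hφ
  obtain ⟨x, hx⟩ := hps (φ.symm z)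
  obtain ⟨s, hs0, hs⟩ := exists_local_section hp x
  rw [hx] at hs
  have hsym := contMDiffAt_extChartAt_symm (E := F) hz
  have hs' : ∀ᶠ z' in 𝓝 z, p (s (φ.symm z')) = φ.symm z' ∧
      ContMDiffAt 𝓘(ℝ, F) 𝓘(ℝ, E) ∞ s (φ.symm z') := hsym.continuousAt.eventually hs
  have hsm : ContMDiffAt 𝓘(ℝ, F) 𝓘(ℝ, E) ∞ (fun z' => s (φ.symm z')) z :=
    ContMDiffAt.comp (g := s) z hs'.self_of_nhds.2 hsym
  refine (hΘ.contDiffAt_pullbackForm hsm).congr_of_eventuallyEq ?_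
  have hs'' := eventually_eventually_nhds.2 hs'
  filter_upwards [hs'', (isOpen_extChartAt_target (I := 𝓘(ℝ, F)) y₀).mem_nhds hz] with z' h1 h2
  have hsym' := (contMDiffAt_extChartAt_symm (E := F) h2).mdifferentiableAt (by simp)
  have hsd : MDifferentiableAt 𝓘(ℝ, F) 𝓘(ℝ, E) (fun z' => s (φ.symm z')) z' :=
    MDifferentiableAt.comp (g := s) z' (h1.self_of_nhds.2.mdifferentiableAt (by simp)) hsym'
  have hd : ∀ u, mfd E F p (s (φ.symm z')) (mfd F E (fun z' => s (φ.symm z')) z' u) =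
      mfd F F φ.symm z' u := fun u => by
    rw [← mfd_comp_apply (g := p) (f := fun z' => s (φ.symm z'))
      ((hp.contMDiff _).mdifferentiableAt (by simp)) hsd]
    have : (fun z' => p (s (φ.symm z'))) =ᶠ[𝓝 z'] φ.symm := h1.mono fun _ h => h.1
    rw [mfd_congr this]
  ext1 u
  have e : u = ![u 0, u 1] := by funext i; fin_cases i <;> rfl
  rw [e, pullE_apply_two, ← pullbackForm_eq_iff.1 h, hd, hd, localRep_apply_two,
    h1.self_of_nhds.1]

/-- With `φ` a chart upstairs, the pullback of `dΩ` by `p ∘ φ⁻¹` is the pullback of `dΘ = 0` by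
`φ⁻¹`. As the differential of `p ∘ φ⁻¹` is onto, `dΩ` itself vanishes. -/
theorem dExt_eq_zero_of_pullbackForm (hp : Manifold.IsSubmersion 𝓘(ℝ, E) 𝓘(ℝ, F) ∞ p)
    (hps : Function.Surjective p) (hΘ : IsSmoothForm Θ) (hdΘ : dExt Θ = 0)
    (h : pullbackForm p Ω = Θ) : dExt Ω = 0 := by
  have hΩ := isSmoothForm_of_pullbackForm hp hps hΘ h
  funext y
  obtain ⟨x, rfl⟩ := hps y
  set φ := extChartAt 𝓘(ℝ, E) x with hφ
  have hx := mem_extChartAt_target (I := 𝓘(ℝ, E)) x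
  have hsym := contMDiffAt_extChartAt_symm hx
  have hf : ContMDiffAt 𝓘(ℝ, E) 𝓘(ℝ, F) ∞ (fun z => p (φ.symm z)) (φ x) :=
    ContMDiffAt.comp (g := p) (φ x) (hp.contMDiff _) hsym
  have heq : pullE (fun z => p (φ.symm z)) Ω =ᶠ[𝓝 (φ x)] pullE φ.symm Θ := by
    filter_upwards [(isOpen_extChartAt_target (I := 𝓘(ℝ, E)) x).mem_nhds hx] with z hz
    ext1 u
    have e : u = ![u 0, u 1] := by funext i; fin_cases i <;> rfl
    have hd : ∀ u, mfd E F (fun z => p (φ.symm z)) z u =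
        mfd E F p (φ.symm z) (mfd E E φ.symm z u) := fun u =>
      mfd_comp_apply (g := p) (f := φ.symm) ((hp.contMDiff _).mdifferentiableAt (by simp))
        ((contMDiffAt_extChartAt_symm hz).mdifferentiableAt (by simp)) u
    rw [e, pullE_apply_two, pullE_apply_two, hd, hd, pullbackForm_eq_iff.1 h]
  have h0 : pullE (fun z => p (φ.symm z)) (dExt Ω) (φ x) = 0 := by
    rw [← hΩ.extDeriv_pullbackForm hf, heq.extDeriv_eq, hΘ.extDeriv_pullbackForm hsym, hdΘ]
    rfl
  have hsurj : ∀ u : F, ∃ v : E, mfd E F (fun z => p (φ.symm z)) (φ x) v = u := fun u => by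
    have hxx : φ.symm (φ x) = x := extChartAt_to_inv x
    obtain ⟨v, hv⟩ := surjective_mfd_of_isSubmersion hp x u
    refine ⟨mfd E E φ x v, ?_⟩
    rw [mfd_comp_apply (g := p) (f := φ.symm) ((hp.contMDiff _).mdifferentiableAt (by simp))
      (hsym.mdifferentiableAt (by simp)), mfd_symm_mfd_extChartAt (mem_extChartAt_source x), hxx,
      hv]
  have hxx : p (φ.symm (φ x)) = p x := congrArg p (extChartAt_to_inv x)
  have : formAt (dExt Ω) (p x) = 0 := by
    ext1 u
    choose v hv using fun i => hsurj (u i)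
    have h1 := DFunLike.congr_fun h0 v
    have h2 : formAt (dExt Ω) (p (φ.symm (φ x)))
        (fun i => mfd E F (fun z => p (φ.symm z)) (φ x) (v i)) = 0 := h1
    simp only [hv, hxx] at h2
    exact h2
  exact this

end Quotients

/-! ### The `k`-symplectic form on the leaf space -/

section LeafForm

variable {E : Type*} [NormedAddCommGroup E] [NormedSpace ℝ E] [FiniteDimensional ℝ E]
  {M : Type*} [TopologicalSpace M] [ChartedSpace E M] [IsManifold 𝓘(ℝ, E) ∞ M] [T2Space M] {k : ℕ}
  {η : DForm E M 1 k} (hη : IsKContactForm η)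
  {F : Type*} [NormedAddCommGroup F] [NormedSpace ℝ F] [FiniteDimensional ℝ F]
  [ChartedSpace F (LeafSpace η)] [IsManifold 𝓘(ℝ, F) ∞ (LeafSpace η)]
  (hp : Manifold.IsSubmersion 𝓘(ℝ, E) 𝓘(ℝ, F) ∞ (leafProj η))

omit [FiniteDimensional ℝ E] [IsManifold 𝓘(ℝ, E) ∞ M] [T2Space M] in
theorem leafProj_surjective (η : DForm E M 1 k) : Function.Surjective (leafProj η) :=
  Quotient.mk_surjective

include hη hp

theorem IsKContactForm.isKSymplecticForm {Ω : DForm F (LeafSpace η) 2 k}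
    (h : pullbackForm (leafProj η) Ω = dExt η) : IsKSymplecticForm Ω where
  smooth := isSmoothForm_of_pullbackForm hp (leafProj_surjective η) hη.smooth.dExt h
  closed := dExt_eq_zero_of_pullbackForm hp (leafProj_surjective η) hη.smooth.dExt
    hη.smooth.dExt_dExt h
  nondegenerate := by
    intro y
    obtain ⟨x, rfl⟩ := leafProj_surjective η y
    refine (Submodule.eq_bot_iff _).2 fun u hu => ?_
    obtain ⟨v, hv⟩ := surjective_mfd_of_isSubmersion hp x u
    have hu' := (mem_kerForm_two (E := F)).1 hu
    -- A lift `v` of a vector annihilated by `Ω` is annihilated by `dη`, hence is vertical.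
    refine hv.symm.trans ((hη.mfd_leafProj_eq_zero_iff hp).2 fun v' => ?_)
    rw [← pullbackForm_eq_iff.1 h, hv]
    exact hu' _

end LeafForm

/-! ### Extending vectors to global fields -/

section Extension

variable {E : Type*} [NormedAddCommGroup E] [NormedSpace ℝ E] [FiniteDimensional ℝ E]
  {M : Type*} [TopologicalSpace M] [ChartedSpace E M] [IsManifold 𝓘(ℝ, E) ∞ M] {k : ℕ}

/-- Each tangent vector is the value of a global smooth vector field. -/
theorem exists_isSmoothVF_apply_eq [T2Space M] (x : M) (v : E) :
    ∃ V : VField E M, IsSmoothVF V ∧ V x = v := by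
  have : IsManifold 𝓘(ℝ, E) (∞ + 1) M := by simpa
  have : IsManifold 𝓘(ℝ, E) 1 M := IsManifold.of_le (n := ∞) (by simp)
  obtain ⟨f⟩ : Nonempty (SmoothBumpFunction 𝓘(ℝ, E) x) := inferInstance
  let V : VField E M := VectorField.mpullback 𝓘(ℝ, E) 𝓘(ℝ, E) (extChartAt 𝓘(ℝ, E) x)
    (fun _ => (v : E))
  have hconst : ∀ z : E, ContMDiffAt 𝓘(ℝ, E) 𝓘(ℝ, E).tangent ∞
      (fun z : E => (⟨z, v⟩ : TangentBundle 𝓘(ℝ, E) E)) z := fun z =>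
    contMDiffAt_vectorSpace_iff_contDiffAt.2 contDiffAt_const
  have hV : ∀ y ∈ (extChartAt 𝓘(ℝ, E) x).source, ContMDiffAt 𝓘(ℝ, E) 𝓘(ℝ, E).tangent ∞
      (fun y => (⟨y, V y⟩ : TangentBundle 𝓘(ℝ, E) M)) y := fun y hy =>
    ContMDiffAt.mpullback_vectorField_preimage (m := ∞) (n := ∞) (I := 𝓘(ℝ, E))
      (I' := 𝓘(ℝ, E)) (f := extChartAt 𝓘(ℝ, E) x) (V := fun _ => (v : E)) (x₀ := y)
      (hconst _) (contMDiffAt_extChartAt_of_mem_source hy)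
      (isInvertible_mfderiv_extChartAt hy) (by simp)
  refine ⟨(f : M → ℝ) • V, ?_, ?_⟩
  · exact ContMDiffOn.smul_section_of_tsupport (u := (extChartAt 𝓘(ℝ, E) x).source)
      f.contMDiff.contMDiffOn (isOpen_extChartAt_source x)
      f.tsupport_subset_extChartAt_source (fun y hy => (hV y hy).contMDiffWithinAt)
  · show f x • V x = v
    rw [f.eq_one, one_smul]
    show (mfd E E (extChartAt 𝓘(ℝ, E) x) x).inverse v = v
    rw [mfd_extChartAt_self, ContinuousLinearMap.inverse_id]
    rfl

omit [FiniteDimensional ℝ E] in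
theorem hat_self (Y : VField E M) (x : M) : hat Y x (extChartAt 𝓘(ℝ, E) x x) = Y x := by
  rw [← mfd_extChartAt_apply_eq_hat Y (mem_extChartAt_source x), mfd_extChartAt_self]
  rfl

omit [FiniteDimensional ℝ E] in
theorem mfd_extChartAt_symm_self (x : M) (v : E) :
    mfd E E (extChartAt 𝓘(ℝ, E) x).symm (extChartAt 𝓘(ℝ, E) x x) v = v := by
  have := mfd_symm_mfd_extChartAt (mem_extChartAt_source (I := 𝓘(ℝ, E)) x) v
  rwa [mfd_extChartAt_self] at this

omit [FiniteDimensional ℝ E] in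
theorem localRep_self_one (η : DForm E M 1 k) (x : M) (v : E) :
    localRep η x (extChartAt 𝓘(ℝ, E) x x) ![v] = formAt η x ![v] := by
  rw [localRep_apply_one, mfd_extChartAt_symm_self, extChartAt_to_inv]

omit [FiniteDimensional ℝ E] in
theorem localRep_self_two (Ω : DForm E M 2 k) (x : M) (v w : E) :
    localRep Ω x (extChartAt 𝓘(ℝ, E) x x) ![v, w] = formAt Ω x ![v, w] := by
  rw [localRep_apply_two, mfd_extChartAt_symm_self, mfd_extChartAt_symm_self, extChartAt_to_inv]

omit [FiniteDimensional ℝ E] in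
theorem localRep_hat (η : DForm E M 1 k) (Y : VField E M) {x₀ : M} {y : E}
    (hy : y ∈ (extChartAt 𝓘(ℝ, E) x₀).target) :
    localRep η x₀ y ![hat Y x₀ y] = formAt η ((extChartAt 𝓘(ℝ, E) x₀).symm y)
      ![Y ((extChartAt 𝓘(ℝ, E) x₀).symm y)] := by
  rw [localRep_apply_one, mfd_extChartAt_symm_hat Y hy]

theorem contDiffAt_localRep_hat {η : DForm E M 1 k} (hη : IsSmoothForm η) {Y : VField E M}
    (hY : IsSmoothVF Y) {x₀ : M} {y : E} (hy : y ∈ (extChartAt 𝓘(ℝ, E) x₀).target) :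
    ContDiffAt ℝ ∞ (fun y => localRep η x₀ y ![hat Y x₀ y]) y := by
  have h1 : ContDiffAt ℝ ∞ (fun y => oneFormL (localRep η x₀ y)) y :=
    ContDiffAt.comp (g := oneFormL) y (ContinuousLinearMap.contDiff _).contDiffAt
      (hη.contDiffAt_localRep hy)
  have h2 := h1.clm_apply (hY.contDiffAt_hat hy)
  simpa only [oneFormL_apply] using h2

theorem contMDiff_formAt_apply {η : DForm E M 1 k} (hη : IsSmoothForm η) {Y : VField E M}
    (hY : IsSmoothVF Y) :
    ContMDiff 𝓘(ℝ, E) 𝓘(ℝ, Fin k → ℝ) ∞ (fun x => formAt η x ![Y x]) := by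
  intro x
  have h := (contDiffAt_localRep_hat hη hY (mem_extChartAt_target (I := 𝓘(ℝ, E)) x)).contMDiffAt
  refine (h.comp x (contMDiffAt_extChartAt_of_mem_source
    (mem_extChartAt_source x))).congr_of_eventuallyEq ?_
  filter_upwards [extChartAt_source_mem_nhds (I := 𝓘(ℝ, E)) x] with y hy
  show _ = localRep η x (extChartAt 𝓘(ℝ, E) x y) ![hat Y x (extChartAt 𝓘(ℝ, E) x y)]
  rw [localRep_hat η Y ((extChartAt 𝓘(ℝ, E) x).map_source hy),
    (extChartAt 𝓘(ℝ, E) x).left_inv hy]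

theorem IsKContactForm.isSmoothVF_reeb_comp {η : DForm E M 1 k} (hη : IsKContactForm η)
    {w : M → Fin k → ℝ} (hw : ContMDiff 𝓘(ℝ, E) 𝓘(ℝ, Fin k → ℝ) ∞ w) :
    IsSmoothVF (fun x => hη.reeb x (w x)) := by
  intro x₀
  refine contMDiffAt_vfield_iff.2 ?_
  have h1 : ContMDiffAt 𝓘(ℝ, E) 𝓘(ℝ, (Fin k → ℝ) →L[ℝ] E) ∞
      (fun x => hη.reebHat x₀ (extChartAt 𝓘(ℝ, E) x₀ x)) x₀ :=
    (hη.contDiffAt_reebHat (mem_extChartAt_target x₀)).contMDiffAt.comp x₀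
      (contMDiffAt_extChartAt_of_mem_source (mem_extChartAt_source x₀))
  refine (h1.clm_apply (hw x₀)).congr_of_eventuallyEq ?_
  filter_upwards [extChartAt_source_mem_nhds (I := 𝓘(ℝ, E)) x₀] with x hx
  exact (mfd_extChartAt_apply_eq_hat (fun x => hη.reeb x (w x)) hx).symm.trans
    (hη.mfd_extChartAt_reeb hx (w x))

/-- Each vector in `ker η` is the value of a global smooth section of `ker η`. -/
theorem IsKContactForm.exists_section_ker [T2Space M] {η : DForm E M 1 k} (hη : IsKContactForm η)
    {x : M} {v : E} (hv : formAt η x ![v] = 0) :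
    ∃ Z : VField E M, IsSmoothVF Z ∧ (∀ y, formAt η y ![Z y] = 0) ∧ Z x = v := by
  obtain ⟨V, hV, hVx⟩ := exists_isSmoothVF_apply_eq x v
  let V₀ : M → E := V
  have hR := hη.isSmoothVF_reeb_comp (contMDiff_formAt_apply hη.smooth hV)
  -- Subtracting its Reeb component projects an arbitrary extension to `ker η`, without changing its
  -- value at `x`.
  refine ⟨fun y => V₀ y - hη.reeb y (formAt η y ![V₀ y]), ?_, fun y => ?_, ?_⟩
  · have : IsManifold 𝓘(ℝ, E) (∞ + 1) M := by simpa
    exact ContMDiff.sub_section hV hR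
  · show formAt η y ![V₀ y - hη.reeb y (formAt η y ![V₀ y])] = 0
    rw [← oneFormL_apply, map_sub, oneFormL_apply, oneFormL_apply, hη.apply_reeb, sub_self]
  · have h1 : V₀ x = v := hVx
    show V₀ x - hη.reeb x (formAt η x ![V₀ x]) = v
    rw [h1, hv, map_zero, sub_zero]

end Extension

/-! ### Hamiltonian functions: `ι_Y dη = dh`, and constancy on leaves -/

section Hamiltonian

variable {E : Type*} [NormedAddCommGroup E] [NormedSpace ℝ E] [FiniteDimensional ℝ E]
  {M : Type*} [TopologicalSpace M] [ChartedSpace E M] [IsManifold 𝓘(ℝ, E) ∞ M] {k : ℕ}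
  {η : DForm E M 1 k}

/-- The value of a vector field at a point, as an element of the model space. -/
def vecAt (Y : VField E M) (x : M) : E := Y x

theorem contMDiff_hamFun (hη : IsSmoothForm η) {Y : VField E M} (hY : IsSmoothVF Y) :
    ContMDiff 𝓘(ℝ, E) 𝓘(ℝ, Fin k → ℝ) ∞ (hamFun η Y) :=
  (contMDiff_formAt_apply hη hY).neg

theorem mfd_hamFun (hη : IsSmoothForm η) {Y : VField E M} (hY : IsSmoothVF Y) (x : M) (v : E) :
    mfd E (Fin k → ℝ) (hamFun η Y) x v =
      - fderiv ℝ (fun y => localRep η x y ![hat Y x y]) (extChartAt 𝓘(ℝ, E) x x) v := by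
  set φ := extChartAt 𝓘(ℝ, E) x with hφ
  have hd : ContDiffAt ℝ ∞ (fun y => localRep η x y ![hat Y x y]) (φ x) :=
    contDiffAt_localRep_hat hη hY (mem_extChartAt_target x)
  have heq : hamFun η Y =ᶠ[𝓝 x] fun z => (fun y => -(localRep η x y ![hat Y x y])) (φ z) := by
    filter_upwards [extChartAt_source_mem_nhds (I := 𝓘(ℝ, E)) x] with z hz
    show -(formAt η z ![Y z]) = -(localRep η x (φ z) ![hat Y x (φ z)])
    rw [localRep_hat η Y (φ.map_source hz), φ.left_inv hz]
  rw [mfd_congr heq, mfd_comp_apply (E' := E) (hd.neg.contMDiffAt.mdifferentiableAt (by simp))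
    ((contMDiffAt_extChartAt_of_mem_source (mem_extChartAt_source x)).mdifferentiableAt (by simp)),
    mfd_extChartAt_self, mfd_eq_fderiv, fderiv_fun_neg]
  rfl

/-- The contraction of `dη` with a Hamiltonian vector field is the differential of its Hamiltonian
function on `ker η`. -/
theorem IsEtaHamiltonian.dExt_apply_of_mem_ker [T2Space M] (hη : IsKContactForm η)
    {Y : VField E M} (hY : IsEtaHamiltonian η Y) {x : M} {v : E} (hv : formAt η x ![v] = 0) :
    formAt (dExt η) x ![vecAt Y x, v] = mfd E (Fin k → ℝ) (hamFun η Y) x v := by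
  obtain ⟨Z, hZ, hZη, hZx⟩ := hη.exists_section_ker hv
  set φ := extChartAt 𝓘(ℝ, E) x with hφ
  have hx : φ x ∈ φ.target := mem_extChartAt_target x
  have h1 := extDeriv_one_apply_vectorField (η := localRep η x) (Y := hat Y x) (Z := hat Z x)
    (x := φ x) ((hη.smooth.contDiffAt_localRep hx).differentiableAt (by simp))
    ((hY.smooth.contDiffAt_hat hx).differentiableAt (by simp))
    ((hZ.contDiffAt_hat hx).differentiableAt (by simp))
  have h2 : (fun y => localRep η x y ![hat Z x y]) =ᶠ[𝓝 (φ x)] fun _ => 0 := by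
    filter_upwards [(isOpen_extChartAt_target (I := 𝓘(ℝ, E)) x).mem_nhds hx] with y hy
    rw [localRep_hat η Z hy]
    exact hZη _
  have h3 : formAt η x ![VectorField.lieBracket ℝ (hat Y x) (hat Z x) (φ x)] = 0 := by
    have h := hY.lie_symm Z hZ (fun y => (mem_kerForm_one (E := E)).2 (hZη y)) x
    have h' := (mem_kerForm_one (E := E)).1 h
    rw [← h']
    exact congrArg (fun u : E => formAt η x ![u]) (mlieBracket_eq_lieBracket_hat Y Z x).symm
  have hYx : hat Y x (φ x) = vecAt Y x := hat_self Y x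
  have hZx' : hat Z x (φ x) = v := (hat_self Z x).trans hZx
  -- In `dη(Y, Z) = Y(η Z) - Z(η Y) - η([Y, Z])` the first term vanishes because `Z` lies in `ker
  -- η`, and the last because `Y` preserves `ker η`. Only `-Z(η Y) = dh(Z)` remains.
  rw [← hη.smooth.localRep_dExt hx, hYx, hZx', localRep_self_two, h2.fderiv_eq, localRep_self_one,
    h3, fderiv_fun_const, Pi.zero_apply, zero_apply, zero_sub, sub_zero] at h1
  rw [h1, mfd_hamFun hη.smooth hY.smooth]

/-- If the Hamiltonian function of a Hamiltonian vector field `Y` is a first integral of the Reeb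
vector fields, then `ι_Y dη = dh`. -/
theorem IsEtaHamiltonian.dExt_apply [T2Space M] (hη : IsKContactForm η)
    {Y : VField E M} (hY : IsEtaHamiltonian η Y)
    (hR : ∀ R : Fin k → VField E M, IsReebFamily η R →
      ∀ α x, mvfderiv 𝓘(ℝ, E) (hamFun η Y) x (R α x) = 0) (x : M) (v : E) :
    formAt (dExt η) x ![vecAt Y x, v] = mfd E (Fin k → ℝ) (hamFun η Y) x v := by
  have hRw : ∀ w, mfd E (Fin k → ℝ) (hamFun η Y) x (hη.reeb x w) = 0 := by
    intro w
    have h0 : (mfd E (Fin k → ℝ) (hamFun η Y) x).comp (hη.reeb x) = 0 := by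
      refine ContinuousLinearMap.coe_injective (LinearMap.pi_ext' fun α => LinearMap.ext_ring ?_)
      exact hR _ hη.isReebFamily α x
    exact DFunLike.congr_fun h0 w
  set w := formAt η x ![v] with hw
  -- Split `v` into its Reeb part, on which both sides vanish, and a part in `ker η`, where the
  -- preceding lemma applies.
  have hv : v = hη.reeb x w + (v - hη.reeb x w) := by abel
  have h0 : formAt η x ![v - hη.reeb x w] = 0 := by
    rw [← oneFormL_apply, map_sub, oneFormL_apply, oneFormL_apply, hη.apply_reeb, hw, sub_self]
  have h1 := hY.dExt_apply_of_mem_ker hη h0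
  have h2 : formAt (dExt η) x ![vecAt Y x, hη.reeb x w] = 0 := by
    rw [map_vec_swap, hη.dExt_reeb, neg_zero]
  have h3 : formAt (dExt η) x ![vecAt Y x, v] = formAt (dExt η) x ![vecAt Y x, hη.reeb x w] +
      formAt (dExt η) x ![vecAt Y x, v - hη.reeb x w] := by
    rw [← twoFormL_apply, ← twoFormL_apply, ← twoFormL_apply, ← map_add, ← hv]
  rw [h3, h2, h1, zero_add, map_sub, hRw, sub_zero]

omit [FiniteDimensional ℝ E] [IsManifold 𝓘(ℝ, E) ∞ M] in
/-- A function whose differential vanishes on the Reeb distribution is constant on the leaves. -/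
theorem eq_of_leafProj_eq {G : Type*} [NormedAddCommGroup G] [NormedSpace ℝ G] {h : M → G}
    (hh : ContMDiff 𝓘(ℝ, E) 𝓘(ℝ, G) ∞ h)
    (hd : ∀ x v, (∀ v', formAt (dExt η) x ![v, v'] = 0) → mfd E G h x v = 0) {x y : M}
    (hxy : leafProj η x = leafProj η y) : h x = h y := by
  have h' : Relation.EqvGen (TangentlyJoined η) x y := Quotient.exact hxy
  clear hxy
  induction h' with
  | rel a b hab =>
    obtain ⟨γ, hγ, ht, rfl, rfl⟩ := hab
    have hdiff : Differentiable ℝ (fun t => h (γ t)) := fun t =>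
      (((hh _).mdifferentiableAt (by simp)).comp t
        ((hγ t).mdifferentiableAt (by simp))).differentiableAt
    refine is_const_of_deriv_eq_zero hdiff (fun t => ?_) 0 1
    have h1 := mfd_comp_apply (E := ℝ) (E' := E) (g := h) (f := γ) (x := t)
      ((hh _).mdifferentiableAt (by simp)) ((hγ t).mdifferentiableAt (by simp)) 1
    rw [mfd_eq_fderiv, hd _ (mfd ℝ E γ t 1) (mem_kerForm_two.1 (ht t))] at h1
    exact h1
  | refl a => rfl
  | symm a b _ ih => exact ih.symm
  | trans a b c _ _ ih₁ ih₂ => exact ih₁.trans ih₂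

end Hamiltonian

/-! ### Related vector fields: smoothness and brackets -/

section Related

variable {E : Type*} [NormedAddCommGroup E] [NormedSpace ℝ E]
  {M : Type*} [TopologicalSpace M] [ChartedSpace E M]
  {F : Type*} [NormedAddCommGroup F] [NormedSpace ℝ F]
  {N : Type*} [TopologicalSpace N] [ChartedSpace F N] {p : M → N} {k : ℕ}

/-- The vector fields `Y` and `Y'` are `p`-related. -/
def Related (p : M → N) (Y : VField E M) (Y' : VField F N) : Prop :=
  ∀ x, mfd E F p x (vecAt Y x) = vecAt Y' (p x)

theorem Related.unique (hps : Function.Surjective p) {Y : VField E M} {Y' Y'' : VField F N}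
    (h : Related p Y Y') (h' : Related p Y Y'') : Y' = Y'' := by
  funext y
  obtain ⟨x, rfl⟩ := hps y
  exact (h x).symm.trans (h' x)

variable [IsManifold 𝓘(ℝ, E) ∞ M] [IsManifold 𝓘(ℝ, F) ∞ N]

/-- Locally `X'_t(y) = Tp (X_t (s y))` for a smooth local section `s` of `p`, which is a composite
of smooth maps. -/
theorem IsJointlySmooth.of_related (hp : Manifold.IsSubmersion 𝓘(ℝ, E) 𝓘(ℝ, F) ∞ p)
    (hps : Function.Surjective p) {X : ℝ → VField E M} {X' : ℝ → VField F N}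
    (hX : IsJointlySmooth X) (h : ∀ t, Related p (X t) (X' t)) : IsJointlySmooth X' := by
  rintro ⟨t, y⟩
  obtain ⟨x, rfl⟩ := hps y
  obtain ⟨s, hs0, hs⟩ := exists_local_section hp x
  have hT : ContMDiff 𝓘(ℝ, E).tangent 𝓘(ℝ, F).tangent ∞ (tangentMap 𝓘(ℝ, E) 𝓘(ℝ, F) p) :=
    hp.contMDiff.contMDiff_tangentMap (by simp)
  have h1 : ContMDiffAt (𝓘(ℝ, ℝ).prod 𝓘(ℝ, F)) (𝓘(ℝ, ℝ).prod 𝓘(ℝ, E)) ∞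
      (fun q : ℝ × N => (q.1, s q.2)) (t, p x) :=
    contMDiffAt_fst.prodMk (ContMDiffAt.comp (g := s) (t, p x) hs.self_of_nhds.2 contMDiffAt_snd)
  have h2 := (hT _).comp (t, p x) (ContMDiffAt.comp (t, p x) (hX (t, s (p x))) h1)
  refine h2.congr_of_eventuallyEq ?_
  have h3 : ∀ᶠ q : ℝ × N in 𝓝 (t, p x), p (s q.2) = q.2 :=
    (continuous_snd.tendsto (t, p x)).eventually (hs.mono fun _ hy => hy.1)
  filter_upwards [h3] with q hq
  have h4 : (⟨p (s q.2), X' q.1 (p (s q.2))⟩ : TangentBundle 𝓘(ℝ, F) N) =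
      tangentMap 𝓘(ℝ, E) 𝓘(ℝ, F) p ⟨s q.2, X q.1 (s q.2)⟩ :=
    congrArg (fun u => (⟨p (s q.2), u⟩ : TangentBundle 𝓘(ℝ, F) N)) (h q.1 (s q.2)).symm
  rw [hq] at h4
  exact h4

theorem IsSmoothVF.of_related (hp : Manifold.IsSubmersion 𝓘(ℝ, E) 𝓘(ℝ, F) ∞ p)
    (hps : Function.Surjective p) {Y : VField E M} {Y' : VField F N}
    (hY : IsSmoothVF Y) (h : Related p Y Y') : IsSmoothVF Y' := by
  have h1 : IsJointlySmooth (fun _ : ℝ => Y) := ContMDiff.comp hY contMDiff_snd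
  have h2 := h1.of_related hp hps (X' := fun _ => Y') fun _ => h
  have h3 : ContMDiff 𝓘(ℝ, F) (𝓘(ℝ, ℝ).prod 𝓘(ℝ, F)) ∞ (fun y : N => ((0 : ℝ), y)) :=
    contMDiff_const.prodMk contMDiff_id
  exact ContMDiff.comp h2 h3

/-- In charts, relatedness reads `DP (Y) = Y' ∘ P`. Differentiating this along `Z`, and the same for
`Z` along `Y`, and subtracting gives the claim, since the second derivatives of `P` cancel by
symmetry. -/
theorem Related.mlieBracket [CompleteSpace E] [CompleteSpace F]
    (hp : ContMDiff 𝓘(ℝ, E) 𝓘(ℝ, F) ∞ p) {Y Z : VField E M}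
    {Y' Z' : VField F N} (hY : IsSmoothVF Y) (hZ : IsSmoothVF Z) (hY' : IsSmoothVF Y')
    (hZ' : IsSmoothVF Z') (h : Related p Y Y') (h' : Related p Z Z') :
    Related p (VectorField.mlieBracket 𝓘(ℝ, E) Y Z) (VectorField.mlieBracket 𝓘(ℝ, F) Y' Z') := by
  intro x
  set φ := extChartAt 𝓘(ℝ, E) x with hφ
  set χ := extChartAt 𝓘(ℝ, F) (p x) with hχ
  let P : E → F := fun z => χ (p (φ.symm z))
  have hx : φ x ∈ φ.target := mem_extChartAt_target x
  have hxx : φ.symm (φ x) = x := extChartAt_to_inv x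
  have hPx : P (φ x) = χ (p x) := by simp only [P, hxx]
  have hsym := contMDiffAt_extChartAt_symm hx
  have hpφ : ContMDiffAt 𝓘(ℝ, E) 𝓘(ℝ, F) ∞ (fun z => p (φ.symm z)) (φ x) :=
    ContMDiffAt.comp (g := p) (φ x) (hp _) hsym
  have hP : ContDiffAt ℝ ∞ P (φ x) := by
    refine (ContMDiffAt.comp (g := χ) (φ x) ?_ hpφ).contDiffAt
    refine contMDiffAt_extChartAt_of_mem_source ?_
    rw [hxx]
    exact mem_extChartAt_source (p x)
  have hnear : ∀ᶠ z in 𝓝 (φ x), z ∈ φ.target ∧ p (φ.symm z) ∈ χ.source := by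
    refine Filter.Eventually.and ((isOpen_extChartAt_target x).mem_nhds hx) ?_
    refine hpφ.continuousAt ?_
    rw [hxx]
    exact extChartAt_source_mem_nhds (p x)
  have hder : ∀ z, z ∈ φ.target ∧ p (φ.symm z) ∈ χ.source → ∀ v, fderiv ℝ P z v =
      mfd F F χ (p (φ.symm z)) (mfd E F p (φ.symm z) (mfd E E φ.symm z v)) := by
    rintro z ⟨h1, h2⟩ v
    have d1 := (contMDiffAt_extChartAt_symm h1).mdifferentiableAt (n := ∞) (by simp)
    have d2 := (hp (φ.symm z)).mdifferentiableAt (n := ∞) (by simp)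
    rw [← mfd_eq_fderiv, mfd_comp_apply (g := χ) (f := fun z => p (φ.symm z))
      ((contMDiffAt_extChartAt_of_mem_source h2).mdifferentiableAt (by simp))
      (MDifferentiableAt.comp (g := p) z d2 d1), mfd_comp_apply (g := p) (f := φ.symm) d2 d1]
  have hrel : ∀ {A : VField E M} {A' : VField F N}, Related p A A' →
      (fun z => fderiv ℝ P z (hat A x z)) =ᶠ[𝓝 (φ x)] fun z => hat A' (p x) (P z) := by
    intro A A' hA
    filter_upwards [hnear] with z hz
    rw [hder z hz, mfd_extChartAt_symm_hat A hz.1]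
    refine Eq.trans ?_ (mfd_extChartAt_apply_eq_hat A' hz.2)
    exact congrArg (mfd F F χ (p (φ.symm z))) (hA (φ.symm z))
  have hx' : P (φ x) ∈ χ.target := by rw [hPx]; exact mem_extChartAt_target (p x)
  have hPd : DifferentiableAt ℝ P (φ x) := hP.differentiableAt (by simp)
  have hcomp : ∀ {A : VField E M} {A' : VField F N}, IsSmoothVF A' → Related p A A' → ∀ v,
      fderiv ℝ (fun z => fderiv ℝ P z (hat A x z)) (φ x) v =
        fderiv ℝ (hat A' (p x)) (P (φ x)) (fderiv ℝ P (φ x) v) := by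
    intro A A' hA' hA v
    rw [(hrel hA).fderiv_eq, fderiv_fun_comp (φ x)
      ((hA'.contDiffAt_hat hx').differentiableAt (by simp)) hPd]
    rfl
  have key := VectorField.fderiv_apply_lieBracket (f := P) (V := hat Y x) (W := hat Z x) hP
    minSmoothness_two_le_infty ((hZ.contDiffAt_hat hx).differentiableAt (by simp))
    ((hY.contDiffAt_hat hx).differentiableAt (by simp))
  rw [hcomp hZ' h', hcomp hY' h, (hrel h).eq_of_nhds, (hrel h').eq_of_nhds, hPx] at key
  have hbase : ∀ v, fderiv ℝ P (φ x) v = mfd E F p x v := fun v => by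
    rw [hder _ hnear.self_of_nhds, mfd_extChartAt_symm_self, hxx]
    show mfd F F (extChartAt 𝓘(ℝ, F) (p x)) (p x) _ = _
    rw [mfd_extChartAt_self]
    rfl
  rw [hbase] at key
  refine Eq.trans (congrArg (mfd E F p x) (mlieBracket_eq_lieBracket_hat Y Z x)) ?_
  exact key.trans (mlieBracket_eq_lieBracket_hat Y' Z' (p x)).symm

end Related

/-! ### Projecting Hamiltonian vector fields -/

section Projection

variable {E : Type*} [NormedAddCommGroup E] [NormedSpace ℝ E] [FiniteDimensional ℝ E]
  {M : Type*} [TopologicalSpace M] [ChartedSpace E M] [IsManifold 𝓘(ℝ, E) ∞ M] [T2Space M] {k : ℕ}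
  {η : DForm E M 1 k} (hη : IsKContactForm η)
  {F : Type*} [NormedAddCommGroup F] [NormedSpace ℝ F] [FiniteDimensional ℝ F]
  [ChartedSpace F (LeafSpace η)] [IsManifold 𝓘(ℝ, F) ∞ (LeafSpace η)]
  (hp : Manifold.IsSubmersion 𝓘(ℝ, E) 𝓘(ℝ, F) ∞ (leafProj η))
include hη hp

/-- A Hamiltonian vector field whose Hamiltonian function is a first integral of the Reeb vector
fields projects to a Hamiltonian vector field on the leaf space. -/
theorem IsEtaHamiltonian.exists_related {Ω : DForm F (LeafSpace η) 2 k}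
    (hΩ : pullbackForm (leafProj η) Ω = dExt η) {Y : VField E M} (hY : IsEtaHamiltonian η Y)
    (hR : ∀ R : Fin k → VField E M, IsReebFamily η R →
      ∀ α x, mvfderiv 𝓘(ℝ, E) (hamFun η Y) x (R α x) = 0) :
    ∃ Y' : VField F (LeafSpace η), Related (leafProj η) Y Y' ∧ IsOmegaHamiltonian Ω Y' := by
  have hps := leafProj_surjective η
  have hdh := hY.dExt_apply hη hR
  have hh := contMDiff_hamFun hη.smooth hY.smooth
  have hconst : ∀ x y, leafProj η x = leafProj η y → hamFun η Y x = hamFun η Y y :=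
    -- Here `dh = ι_Y dη` vanishes on `ker dη`, so `h` is constant on leaves and defines `g` below.
    fun x y hxy => eq_of_leafProj_eq (η := η) hh (fun z v hv => by
      rw [← hdh, map_vec_swap, hv, neg_zero]) hxy
  choose s hs using hps
  let g : LeafSpace η → Fin k → ℝ := fun y => hamFun η Y (s y)
  have hg : ∀ x, g (leafProj η x) = hamFun η Y x := fun x => hconst _ _ (hs _)
  have hgs : ContMDiff 𝓘(ℝ, F) 𝓘(ℝ, Fin k → ℝ) ∞ g := by
    intro y
    obtain ⟨x, rfl⟩ := leafProj_surjective η y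
    obtain ⟨σ, hσ0, hσ⟩ := exists_local_section hp x
    refine (ContMDiffAt.comp (g := hamFun η Y) _ (hh _)
      hσ.self_of_nhds.2).congr_of_eventuallyEq ?_
    filter_upwards [hσ] with y hy
    show g y = hamFun η Y (σ y)
    rw [← hg, hy.1]
  have hdg : ∀ x v, mfd F (Fin k → ℝ) g (leafProj η x) (mfd E F (leafProj η) x v) =
      mfd E (Fin k → ℝ) (hamFun η Y) x v := fun x v => by
    rw [← mfd_comp_apply (E' := F) (g := g) (f := leafProj η)
      ((hgs _).mdifferentiableAt (by simp)) ((hp.contMDiff x).mdifferentiableAt (by simp))]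
    exact DFunLike.congr_fun (mfd_congr (Filter.Eventually.of_forall hg)) v
  have hΩY : ∀ x u, formAt Ω (leafProj η x) ![mfd E F (leafProj η) x (vecAt Y x), u] =
      mfd F (Fin k → ℝ) g (leafProj η x) u := fun x u => by
    obtain ⟨v, rfl⟩ := surjective_mfd_of_isSubmersion hp x u
    rw [pullbackForm_eq_iff.1 hΩ, hdg, hdh]
  have hnd := (hη.isKSymplecticForm hp hΩ).nondegenerate
  let Y' : LeafSpace η → F := fun y => mfd E F (leafProj η) (s y) (vecAt Y (s y))
  -- The contraction of `Ω` with `Tp (Y x)` is `dg` at the leaf of `x`, which does not depend on the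
  -- choice of `x` in the leaf. Nondegeneracy then makes `Tp (Y x)` itself independent of that
  -- choice.
  have hrel : Related (leafProj η) Y Y' := by
    intro x
    have h1 := hnd (leafProj η x)
    rw [← sub_eq_zero]
    have h2 : mfd E F (leafProj η) x (vecAt Y x) - vecAt Y' (leafProj η x) ∈
        kerForm Ω (leafProj η x) := by
      refine (mem_kerForm_two (E := F)).2 fun u => ?_
      have h3 := hΩY (s (leafProj η x)) u
      rw [hs] at h3
      rw [← twoFormL_apply, map_sub, sub_apply, twoFormL_apply, twoFormL_apply, hΩY, sub_eq_zero]
      exact h3.symm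
    rw [h1] at h2
    exact h2
  refine ⟨Y', hrel, hY.smooth.of_related hp (leafProj_surjective η) hrel, g, hgs, fun y u => ?_⟩
  have h3 := hΩY (s y) u
  rw [hs] at h3
  exact h3

end Projection

/-! ### Vessiot–Guldberg Lie algebras under projection -/

section LieAlgebras

variable {E : Type*} [NormedAddCommGroup E] [NormedSpace ℝ E]
  {M : Type*} [TopologicalSpace M] [ChartedSpace E M] [IsManifold 𝓘(ℝ, E) ∞ M]
  {F : Type*} [NormedAddCommGroup F] [NormedSpace ℝ F]
  {N : Type*} [TopologicalSpace N] [ChartedSpace F N] [IsManifold 𝓘(ℝ, F) ∞ N] {p : M → N}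

/-- The smallest Lie algebra of a Lie system is a Vessiot--Guldberg Lie algebra. -/
theorem IsLieSystem.isVessiotGuldberg_smallestLieAlgebra {X : ℝ → VField E M}
    (hX : IsLieSystem X) : IsVessiotGuldberg X (smallestLieAlgebra X) := by
  obtain ⟨V, hV⟩ := hX
  have hle : smallestLieAlgebra X ≤ V := sInf_le ⟨hV.lieAlgebra, hV.mem⟩
  have := hV.finiteDimensional
  refine ⟨⟨fun Y hY => hV.lieAlgebra.smooth Y (hle hY), fun Y hY Z hZ => ?_⟩,
    Submodule.finiteDimensional_of_le hle, fun t => ?_⟩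
  · refine Submodule.mem_sInf.2 fun V' hV' => ?_
    exact hV'.1.lie_mem Y (Submodule.mem_sInf.1 hY V' hV') Z (Submodule.mem_sInf.1 hZ V' hV')
  · exact Submodule.mem_sInf.2 fun V' hV' => hV'.2 t

-- Evaluating `Tp Y` at one chosen point of each fibre is linear in `Y` and defined for every field;
-- for projectable fields it is the projection. Linearity makes the image of `V` a
-- finite-dimensional subspace.
omit [IsManifold 𝓘(ℝ, E) ∞ M] [IsManifold 𝓘(ℝ, F) ∞ N] in
theorem exists_linearMap_related (hps : Function.Surjective p) {V : Submodule ℝ (VField E M)}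
    (h : ∀ Y ∈ V, ∃ Y' : VField F N, Related p Y Y') :
    ∃ L : VField E M →ₗ[ℝ] VField F N, ∀ Y ∈ V, Related p Y (L Y) := by
  choose s hs using hps
  let L : (M → E) →ₗ[ℝ] (N → F) :=
    { toFun := fun Y y => mfd E F p (s y) (Y (s y))
      map_add' := fun Y Z => by funext y; simp
      map_smul' := fun c Y => by funext y; simp }
  refine ⟨L, fun Y hY => ?_⟩
  obtain ⟨Y', hY'⟩ := h Y hY
  intro x
  have h1 := hY' (s (p x))
  rw [hs] at h1
  exact (hY' x).trans h1.symm

/-- The image of a Vessiot--Guldberg Lie algebra of projectable vector fields is a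
Vessiot--Guldberg Lie algebra of the projected system. -/
theorem IsVessiotGuldberg.map [CompleteSpace E] [CompleteSpace F]
    (hp : Manifold.IsSubmersion 𝓘(ℝ, E) 𝓘(ℝ, F) ∞ p) (hps : Function.Surjective p)
    {X : ℝ → VField E M} {V : Submodule ℝ (VField E M)} (hV : IsVessiotGuldberg X V)
    {L : VField E M →ₗ[ℝ] VField F N} (hL : ∀ Y ∈ V, Related p Y (L Y)) :
    IsVessiotGuldberg (fun t => L (X t)) (V.map L) := by
  have := hV.finiteDimensional
  have hsm : ∀ Y ∈ V, IsSmoothVF (L Y) := fun Y hY =>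
    (hV.lieAlgebra.smooth Y hY).of_related hp hps (hL Y hY)
  refine ⟨⟨?_, ?_⟩, inferInstance, fun t => Submodule.mem_map_of_mem (hV.mem t)⟩
  · rintro _ ⟨Y, hY, rfl⟩
    exact hsm Y hY
  · rintro _ ⟨Y, hY, rfl⟩ _ ⟨Z, hZ, rfl⟩
    have hYZ := hV.lieAlgebra.lie_mem Y hY Z hZ
    refine ⟨_, hYZ, (hL _ hYZ).unique hps ?_⟩
    exact Related.mlieBracket hp.contMDiff (hV.lieAlgebra.smooth Y hY)
      (hV.lieAlgebra.smooth Z hZ) (hsm Y hY) (hsm Z hZ) (hL Y hY) (hL Z hZ)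

end LieAlgebras

end KContact

end

/-! ### The main theorem -/

theorem mainTheorem2
    {E : Type*} [NormedAddCommGroup E] [NormedSpace ℝ E] [FiniteDimensional ℝ E]
    {M : Type*} [TopologicalSpace M] [ChartedSpace E M] [IsManifold 𝓘(ℝ, E) ∞ M]
    [T2Space M] [ConnectedSpace M]
    {k : ℕ} (hk : 1 ≤ k)
    (η : KContact.DForm E M 1 k) (X : ℝ → KContact.VField E M)
    (hX : KContact.IsProjectable η X)
    {F : Type*} [NormedAddCommGroup F] [NormedSpace ℝ F] [FiniteDimensional ℝ F]
    [ChartedSpace F (KContact.LeafSpace η)] [IsManifold 𝓘(ℝ, F) ∞ (KContact.LeafSpace η)]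
    [T2Space (KContact.LeafSpace η)]
    (hp : Manifold.IsSubmersion 𝓘(ℝ, E) 𝓘(ℝ, F) ∞ (KContact.leafProj η)) :
    ∃ Ω : KContact.DForm F (KContact.LeafSpace η) 2 k,
      KContact.pullbackForm (KContact.leafProj η) Ω = KContact.dExt η ∧
      (∀ Ω' : KContact.DForm F (KContact.LeafSpace η) 2 k,
        KContact.pullbackForm (KContact.leafProj η) Ω' = KContact.dExt η → Ω' = Ω) ∧
      KContact.IsKSymplecticForm Ω ∧
      ∃ X' : ℝ → KContact.VField F (KContact.LeafSpace η),
        KContact.IsPushforward (KContact.leafProj η) X X' ∧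
        (∀ X'' : ℝ → KContact.VField F (KContact.LeafSpace η),
          KContact.IsPushforward (KContact.leafProj η) X X'' → X'' = X') ∧
        KContact.IsKSymplecticLieSystem Ω X' ∧
        (∀ t, KContact.IsOmegaHamiltonian Ω (X' t)) ∧
        (KContact.IsJointlySmooth X → KContact.IsJointlySmooth X') := by
  have hη := hX.kcontact
  have hps := KContact.leafProj_surjective η
  have hds := KContact.surjective_mfd_of_isSubmersion hp
  obtain ⟨Ω, hΩ⟩ := KContact.exists_pullbackForm_eq hps hds
    fun x y h => hη.sameValues_dExt hp h
  have hsymp := hη.isKSymplecticForm hp hΩ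
  have hV := hX.lieSystem.isVessiotGuldberg_smallestLieAlgebra
  have hproj : ∀ Y ∈ KContact.smallestLieAlgebra X, ∃ Y' : KContact.VField F (KContact.LeafSpace η),
      KContact.Related (KContact.leafProj η) Y Y' ∧ KContact.IsOmegaHamiltonian Ω Y' :=
    fun Y hY => (hX.hamiltonian Y hY).exists_related hη hp hΩ (hX.first_integral Y hY)
  -- The Vessiot–Guldberg Lie algebra downstairs is the image under `L` of the smallest one
  -- upstairs, the one whose elements are assumed to be Hamiltonian with first integrals as
  -- Hamiltonian functions.
  obtain ⟨L, hL⟩ := KContact.exists_linearMap_related (V := KContact.smallestLieAlgebra X) hps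
    fun Y hY => (hproj Y hY).imp fun _ h => h.1
  have hham : ∀ Y ∈ KContact.smallestLieAlgebra X, KContact.IsOmegaHamiltonian Ω (L Y) := by
    intro Y hY
    obtain ⟨Y', h1, h2⟩ := hproj Y hY
    rwa [(hL Y hY).unique hps h1]
  refine ⟨Ω, hΩ, fun Ω' h' => KContact.pullbackForm_unique hps hds hΩ h', hsymp,
    fun t => L (X t), fun t x => hL (X t) (hV.mem t) x, fun X'' h'' => ?_,
    ⟨hsymp, _, hV.map hp hps hL, ?_⟩, fun t => hham (X t) (hV.mem t), fun hJ => ?_⟩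
  · funext t
    exact KContact.Related.unique hps (fun x => h'' t x) (hL (X t) (hV.mem t))
  · rintro _ ⟨Y, hY, rfl⟩
    exact hham Y hY
  · exact hJ.of_related hp hps fun t => hL (X t) (hV.mem t)
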